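/- Let $\mathcal G$ be a Lie groupoid over an $n$-dimensional (Hausdorff, second countable) smooth manifold $M$, with source $s$, target $t$, units $1_x$, and with $s$-fibres of constant dimension $r$. Let $A=\ker(ds)|_{M}$ be its Lie algebroid. For $F=\Lambda^{\mathrm{top}}(\cdot)^*$ or $F=|\Lambda^{\mathrm{top}}(\cdot)^*|$ (densities) consider the line bundle $F^{\mathrm{tr}}_A=F(A^*)\otimes F(TM)$, that is, the transverse volume bundle $\mathcal V^{\mathrm{tr}}_A$ or the transverse density bundle $\mathcal D^{\mathrm{tr}}_A$, with its canonical action of $\mathcal G$: for $g:x\to y$, the isomorphism $g_*:F^{\mathrm{tr}}_{A,x}\to F^{\mathrm{tr}}_{A,y}$ is induced by the two isomorphisms $$F(A_y)\otimes F(T_xM)\cong F(T_g\mathcal G)\cong F(A_x)\otimes F(T_yM)$$ given by the exact sequences $0\to A_y\to T_g\mathcal G\xrightarrow{ds}T_xM\to0$ (with the differential of $h\mapsto hg$ at $1_y$) and $0\to A_x\to T_g\mathcal G\xrightarrow{dt}T_yM\to 0$ (with minus the differential of $h\mapsto gh^{-1}$ at $1_x$). $\mathcal G$ is *transversely orientable*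 if $\mathcal V^{\mathrm{tr}}_A$ has an orientation preserved by the action of $\mathcal G$; a *transverse volume form* is a nowhere vanishing $\mathcal G$-invariant smooth section of $\mathcal V^{\mathrm{tr}}_A$. The *modular class* $\mathrm{mod}(\mathcal G)\in H^1_{\mathrm{diff}}(\mathcal G)$ (smooth functions $c$ on $\mathcal G$ with $c(gh)=c(g)+c(h)$, modulo those of the form $f\circ s-f\circ t$ with $f\in C^\infty(M)$) is the class of $c_\sigma(g)=\ln\big(\sigma(y)/g_*\sigma(x)\big)$, $g:x\to y$, for any smooth strictly positive section $\sigma$ of $\mathcal D^{\mathrm{tr}}_A$. For an open cover $\mathcal U$ of $M$ let $\mathcal G_{\mathcal U}$ be the pull-back of $\mathcal G$ to the disjoint union of the members of $\mathcal U$, and let $\check H^1_{\mathrm{diff}}(\mathcal G,\mathbb Z_2)=\varinjlim_{\mathcal U}H^1_{\mathrm{diff}}(\mathcal G_{\mathcal U},\mathbb Z_2)$, with $\mathbb Z_2=\{\pm1\}$ and the colimit taken over refinements of covers. The *transverse first Stiefel–Whitney class* $w_1^{\mathrm{tr}}(\mathcal G)\in\check H^1_{\mathrm{diff}}(\mathcal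 G,\mathbb Z_2)$ is the class of the cocycle $\operatorname{sign}\tilde c$ on $\mathcal G_{\mathcal U}$, where $\mathcal U$ is an open cover over whose members $U$ there are nowhere vanishing smooth sections $\sigma_U$ of $\mathcal V^{\mathrm{tr}}_A$, and $g_*\sigma_U(x)=\tilde c(g)\,\sigma_V(y)$ for an arrow $g:(U,x)\to(V,y)$ of $\mathcal G_{\mathcal U}$. Then these two classes exist and do not depend on the choices made, and: 1. $\mathcal G$ is transversely orientable if and only if $w_1^{\mathrm{tr}}(\mathcal G)=1$. 2. $\mathcal G$ admits a transverse volume form if and only if $\mathrm{mod}(\mathcal G)=0$ and $w_1^{\mathrm{tr}}(\mathcal G)=1$. -/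

import Mathlib

open scoped Manifold ContDiff Topology
open TopologicalSpace

noncomputable section

/-! ### Groupoids over a set of objects -/

/-- A groupoid with set of objects `M` and set of arrows `G`. An arrow `g` goes from `src g` to
`tgt g`, and `mul g h` is the composition `g ∘ h`, meaningful (and constrained) only if
`src g = tgt h`. -/
structure GroupoidOver (M G : Type*) where
  src : G → M
  tgt : G → M
  unit : M → G
  inv : G → G
  mul : G → G → G
  src_unit : ∀ x, src (unit x) = x
  tgt_unit : ∀ x, tgt (unit x) = x
  src_inv : ∀ g, src (inv g) = tgt g
  tgt_inv : ∀ g, tgt (inv g) = src g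
  src_mul : ∀ g h, src g = tgt h → src (mul g h) = src h
  tgt_mul : ∀ g h, src g = tgt h → tgt (mul g h) = tgt g
  mul_assoc : ∀ g h k, src g = tgt h → src h = tgt k → mul (mul g h) k = mul g (mul h k)
  mul_unit : ∀ g, mul g (unit (src g)) = g
  unit_mul : ∀ g, mul (unit (tgt g)) g = g
  inv_mul : ∀ g, mul (inv g) g = unit (src g)
  mul_inv : ∀ g, mul g (inv g) = unit (tgt g)

namespace GroupoidOver

variable {M G N N' N'' : Type*}

/-- The arrows `(y, g, x)`, `g : f x → f y`, of the pull-back of a groupoid along `f : N → M`. -/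
abbrev PullbackArrow (𝒢 : GroupoidOver M G) (f : N → M) : Type _ :=
  {p : N × G × N // 𝒢.tgt p.2.1 = f p.1 ∧ 𝒢.src p.2.1 = f p.2.2}

open Classical in
/-- The pull-back of a groupoid along a map `f : N → M`. -/
def pullback (𝒢 : GroupoidOver M G) (f : N → M) : GroupoidOver N (𝒢.PullbackArrow f) where
  src p := p.1.2.2
  tgt p := p.1.1
  unit y := ⟨(y, 𝒢.unit (f y), y), 𝒢.tgt_unit _, 𝒢.src_unit _⟩
  inv p := ⟨(p.1.2.2, 𝒢.inv p.1.2.1, p.1.1), by simp [𝒢.tgt_inv, p.2.2],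
    by simp [𝒢.src_inv, p.2.1]⟩
  mul p q :=
    if h : p.1.2.2 = q.1.1 then
      ⟨(p.1.1, 𝒢.mul p.1.2.1 q.1.2.1, q.1.2.2),
        by
          have hc : 𝒢.src p.1.2.1 = 𝒢.tgt q.1.2.1 := by rw [p.2.2, q.2.1, h]
          exact ⟨(𝒢.tgt_mul _ _ hc).trans p.2.1, (𝒢.src_mul _ _ hc).trans q.2.2⟩⟩
    else p
  src_unit _ := rfl
  tgt_unit _ := rfl
  src_inv _ := rfl
  tgt_inv _ := rfl
  src_mul p q h := by rw [dif_pos h]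
  tgt_mul p q h := by rw [dif_pos h]
  mul_assoc p q k h h' := by
    have h1 : 𝒢.src p.1.2.1 = 𝒢.tgt q.1.2.1 := by rw [p.2.2, q.2.1, h]
    have h2 : 𝒢.src q.1.2.1 = 𝒢.tgt k.1.2.1 := by rw [q.2.2, k.2.1, h']
    simp only [dif_pos h, dif_pos h', 𝒢.mul_assoc _ _ _ h1 h2]
  mul_unit p := by
    rw [dif_pos rfl]
    apply Subtype.ext
    have := 𝒢.mul_unit p.1.2.1
    rw [p.2.2] at this
    simp [this]
  unit_mul p := by
    rw [dif_pos rfl]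
    apply Subtype.ext
    have := 𝒢.unit_mul p.1.2.1
    rw [p.2.1] at this
    simp [this]
  inv_mul p := by
    rw [dif_pos rfl]
    apply Subtype.ext
    simp [𝒢.inv_mul, p.2.2]
  mul_inv p := by
    rw [dif_pos rfl]
    apply Subtype.ext
    simp [𝒢.mul_inv, p.2.1]

/-- The map induced on the arrows of pull-back groupoids by a map of the objects over `M`. -/
def pullbackArrowMap (𝒢 : GroupoidOver M G) {f : N → M} {f' : N' → M} (φ : N' → N)
    (h : ∀ y, f (φ y) = f' y) (p : 𝒢.PullbackArrow f') : 𝒢.PullbackArrow f :=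
  ⟨(φ p.1.1, p.1.2.1, φ p.1.2.2), by simp [h, p.2.1], by simp [h, p.2.2]⟩

theorem pullback_mul_val (𝒢 : GroupoidOver M G) (f : N → M) (p q : 𝒢.PullbackArrow f)
    (h : p.1.2.2 = q.1.1) :
    ((𝒢.pullback f).mul p q).1 = (p.1.1, 𝒢.mul p.1.2.1 q.1.2.1, q.1.2.2) := by
  simp [pullback, dif_pos h]

/-! ### Degree one differentiable cohomology with coefficients in a discrete abelian group

A smooth map into a discrete (that is, zero-dimensional Lie) group is a locally constant map. -/

section Discrete

variable (A : Type*) [CommGroup A]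

/-- The group of differentiable `1`-cocycles with values in the discrete abelian group `A`. -/
def discreteCocycles [TopologicalSpace G] (𝒢 : GroupoidOver M G) : Subgroup (G → A) where
  carrier := {c | IsLocallyConstant c ∧
    ∀ g h, 𝒢.src g = 𝒢.tgt h → c (𝒢.mul g h) = c g * c h}
  one_mem' := ⟨IsLocallyConstant.const 1, fun _ _ _ => by simp⟩
  mul_mem' := fun {c d} hc hd => ⟨hc.1.mul hd.1, fun g h e => by
    simp only [Pi.mul_apply, hc.2 g h e, hd.2 g h e]; exact mul_mul_mul_comm _ _ _ _⟩
  inv_mem' := fun {c} hc => ⟨hc.1.inv, fun g h e => by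
    simp only [Pi.inv_apply, hc.2 g h e, _root_.mul_inv]⟩

/-- The subgroup of coboundaries `g ↦ f (src g) / f (tgt g)`, with `f` locally constant. -/
def discreteCoboundaries [TopologicalSpace M] [TopologicalSpace G] (𝒢 : GroupoidOver M G) :
    Subgroup (𝒢.discreteCocycles A) where
  carrier := {c | ∃ f : M → A, IsLocallyConstant f ∧ ∀ g, c.1 g = f (𝒢.src g) / f (𝒢.tgt g)}
  one_mem' := ⟨1, IsLocallyConstant.const 1, fun _ => by simp⟩
  mul_mem' := by
    rintro c d ⟨f, hf, hcf⟩ ⟨k, hk, hdk⟩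
    exact ⟨f * k, hf.mul hk, fun g => by
      simp [hcf, hdk, mul_div_mul_comm]⟩
  inv_mem' := by
    rintro c ⟨f, hf, hcf⟩
    exact ⟨f⁻¹, hf.inv, fun g => by simp [hcf, div_eq_mul_inv, mul_comm]⟩

/-- The differentiable cohomology group `H¹(𝒢, A)`, for a discrete abelian group `A`. -/
abbrev discreteH1 [TopologicalSpace M] [TopologicalSpace G] (𝒢 : GroupoidOver M G) : Type _ :=
  𝒢.discreteCocycles A ⧸ 𝒢.discreteCoboundaries A

variable {A}
variable [TopologicalSpace G] [TopologicalSpace N] [TopologicalSpace N'] [TopologicalSpace N'']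

theorem continuous_pullbackArrowMap (𝒢 : GroupoidOver M G) {f : N → M} {f' : N' → M}
    (φ : N' → N) (hφ : Continuous φ) (h : ∀ y, f (φ y) = f' y) :
    Continuous (𝒢.pullbackArrowMap φ h) := by
  have hv : Continuous (fun p : 𝒢.PullbackArrow f' => p.1) := continuous_subtype_val
  exact Continuous.subtype_mk (by fun_prop) _

/-- Pull-back of cocycles. -/
def cocycleMap (𝒢 : GroupoidOver M G) {f : N → M} {f' : N' → M} (φ : N' → N)
    (hφ : Continuous φ) (h : ∀ y, f (φ y) = f' y) :
    (𝒢.pullback f).discreteCocycles A →* (𝒢.pullback f').discreteCocycles A where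
  toFun c := ⟨fun p => c.1 (𝒢.pullbackArrowMap φ h p),
    c.2.1.comp_continuous (𝒢.continuous_pullbackArrowMap φ hφ h), fun p q e => by
      have e' : (𝒢.pullback f).src (𝒢.pullbackArrowMap φ h p) =
        (𝒢.pullback f).tgt (𝒢.pullbackArrowMap φ h q) := congrArg φ e
      rw [← c.2.2 _ _ e']
      refine congrArg c.1 ?_
      apply Subtype.ext
      rw [𝒢.pullback_mul_val f _ _ e']
      simp [pullbackArrowMap, 𝒢.pullback_mul_val f' p q e]⟩
  map_one' := rfl
  map_mul' _ _ := rfl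

/-- The map induced in cohomology by a continuous map of the objects over `M`. -/
def discreteH1Map (𝒢 : GroupoidOver M G) {f : N → M} {f' : N' → M} (φ : N' → N)
    (hφ : Continuous φ) (h : ∀ y, f (φ y) = f' y) :
    (𝒢.pullback f).discreteH1 A →* (𝒢.pullback f').discreteH1 A :=
  QuotientGroup.map _ _ (𝒢.cocycleMap φ hφ h) (by
    rintro c ⟨k, hk, hck⟩
    exact ⟨k ∘ φ, hk.comp_continuous hφ, fun p => hck _⟩)

/-- The map induced in cohomology does not depend on the map of objects over `M`. -/
theorem discreteH1Map_congr [TopologicalSpace M] (𝒢 : GroupoidOver M G) (hu : Continuous 𝒢.unit)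
    {f : N → M} {f' : N' → M} (hf' : Continuous f') (φ ψ : N' → N)
    (hφ : Continuous φ) (h : ∀ y, f (φ y) = f' y) (hψ : Continuous ψ) (h' : ∀ y, f (ψ y) = f' y)
    (z : (𝒢.pullback f).discreteH1 A) :
    𝒢.discreteH1Map φ hφ h z = 𝒢.discreteH1Map ψ hψ h' z := by
  induction z using QuotientGroup.induction_on with
  | H c =>
    refine QuotientGroup.eq.2 ?_
    -- the connecting units `f' y`, seen as arrows from `φ y` to `ψ y`
    let e : N' → 𝒢.PullbackArrow f := fun y =>
      ⟨(ψ y, 𝒢.unit (f' y), φ y), by simp [𝒢.tgt_unit, h'], by simp [𝒢.src_unit, h]⟩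
    have he : Continuous e := Continuous.subtype_mk (by fun_prop) _
    refine ⟨fun y => (c.1 (e y))⁻¹, (c.2.1.comp_continuous he).inv, fun p => ?_⟩
    have key : c.1 (𝒢.pullbackArrowMap ψ h' p) * c.1 (e p.1.2.2) =
        c.1 (e p.1.1) * c.1 (𝒢.pullbackArrowMap φ h p) := by
      have e1 : (𝒢.pullback f).src (𝒢.pullbackArrowMap ψ h' p) =
        (𝒢.pullback f).tgt (e p.1.2.2) := rfl
      have e2 : (𝒢.pullback f).src (e p.1.1) =
        (𝒢.pullback f).tgt (𝒢.pullbackArrowMap φ h p) := rfl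
      rw [← c.2.2 _ _ e1, ← c.2.2 _ _ e2]
      refine congrArg c.1 ?_
      apply Subtype.ext
      rw [𝒢.pullback_mul_val f _ _ e1, 𝒢.pullback_mul_val f _ _ e2]
      have m1 := 𝒢.mul_unit p.1.2.1
      have m2 := 𝒢.unit_mul p.1.2.1
      rw [p.2.2] at m1
      rw [p.2.1] at m2
      simp [e, pullbackArrowMap, m1, m2]
    change (c.1 (𝒢.pullbackArrowMap φ h p))⁻¹ * c.1 (𝒢.pullbackArrowMap ψ h' p) =
      (c.1 (e p.1.2.2))⁻¹ / (c.1 (e p.1.1))⁻¹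
    rw [eq_mul_inv_of_mul_eq key, div_inv_eq_mul, mul_comm (c.1 (e p.1.1)),
      _root_.mul_assoc, inv_mul_cancel_left, mul_comm]

theorem discreteH1Map_id (𝒢 : GroupoidOver M G) {f : N → M}
    (z : (𝒢.pullback f).discreteH1 A) :
    𝒢.discreteH1Map id continuous_id (fun _ => rfl) z = z := by
  induction z using QuotientGroup.induction_on with
  | H c => rfl

theorem discreteH1Map_comp (𝒢 : GroupoidOver M G) {f : N → M} {f' : N' → M} {f'' : N'' → M}
    (φ : N' → N) (hφ : Continuous φ) (h : ∀ y, f (φ y) = f' y)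
    (ψ : N'' → N') (hψ : Continuous ψ) (h' : ∀ y, f' (ψ y) = f'' y)
    (z : (𝒢.pullback f).discreteH1 A) :
    𝒢.discreteH1Map ψ hψ h' (𝒢.discreteH1Map φ hφ h z) =
      𝒢.discreteH1Map (φ ∘ ψ) (hφ.comp hψ) (fun y => (h _).trans (h' y)) z := by
  induction z using QuotientGroup.induction_on with
  | H c => rfl

end Discrete

end GroupoidOver

/-! ### Open covers and refinement -/

/-- A cover of `M` by open subsets. -/
structure OpenCover (M : Type*) [TopologicalSpace M] where
  sets : Set (Opens M)
  covers : ∀ x, ∃ U ∈ sets, x ∈ U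

namespace OpenCover

variable {M : Type*} [TopologicalSpace M]

/-- `𝒰 ≤ 𝒱` if `𝒱` is finer than `𝒰`. -/
instance : Preorder (OpenCover M) where
  le 𝒰 𝒱 := ∀ V ∈ 𝒱.sets, ∃ U ∈ 𝒰.sets, V ≤ U
  le_refl _ V hV := ⟨V, hV, le_rfl⟩
  le_trans _ _ _ h h' W hW := by
    obtain ⟨V, hV, hWV⟩ := h' W hW
    obtain ⟨U, hU, hVU⟩ := h V hV
    exact ⟨U, hU, hWV.trans hVU⟩

instance : Nonempty (OpenCover M) := ⟨⟨{⊤}, fun _ => ⟨⊤, rfl, trivial⟩⟩⟩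

instance : IsDirectedOrder (OpenCover M) where
  directed 𝒰 𝒱 := by
    refine ⟨⟨{W | ∃ U ∈ 𝒰.sets, ∃ V ∈ 𝒱.sets, W = U ⊓ V}, fun x => ?_⟩, ?_, ?_⟩
    · obtain ⟨U, hU, hx⟩ := 𝒰.covers x
      obtain ⟨V, hV, hx'⟩ := 𝒱.covers x
      exact ⟨U ⊓ V, ⟨U, hU, V, hV, rfl⟩, hx, hx'⟩
    · rintro W ⟨U, hU, V, hV, rfl⟩
      exact ⟨U, hU, inf_le_left⟩
    · rintro W ⟨U, hU, V, hV, rfl⟩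
      exact ⟨V, hV, inf_le_right⟩

/-- The disjoint union of the members of a cover. -/
abbrev Total (𝒰 : OpenCover M) : Type _ := Σ U : 𝒰.sets, (U.1 : Opens M)

/-- The canonical map from the disjoint union of the members of a cover to the space. -/
def proj (𝒰 : OpenCover M) (p : 𝒰.Total) : M := p.2.1

theorem continuous_proj (𝒰 : OpenCover M) : Continuous 𝒰.proj :=
  continuous_sigma fun _ => continuous_subtype_val

/-- A map of disjoint unions induced by (a choice of) a refinement function. -/
def refineMap {𝒰 𝒱 : OpenCover M} (h : 𝒰 ≤ 𝒱) (p : 𝒱.Total) : 𝒰.Total :=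
  ⟨⟨(h p.1.1 p.1.2).choose, (h p.1.1 p.1.2).choose_spec.1⟩,
    ⟨p.2.1, (h p.1.1 p.1.2).choose_spec.2 p.2.2⟩⟩

theorem continuous_refineMap {𝒰 𝒱 : OpenCover M} (h : 𝒰 ≤ 𝒱) : Continuous (refineMap h) :=
  continuous_sigma fun V =>
    (continuous_sigmaMk (ι := 𝒰.sets) (σ := fun U => (U.1 : Opens M))
      (i := ⟨(h V.1 V.2).choose, (h V.1 V.2).choose_spec.1⟩)).comp
    (Continuous.subtype_mk (f := fun x : V.1 => x.1) continuous_subtype_val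
      fun x => (h V.1 V.2).choose_spec.2 x.2)

theorem proj_refineMap {𝒰 𝒱 : OpenCover M} (h : 𝒰 ≤ 𝒱) (p : 𝒱.Total) :
    𝒰.proj (refineMap h p) = 𝒱.proj p := rfl

end OpenCover

/-! ### Lie groupoids -/

/-- A Lie groupoid with objects the `n`-dimensional manifold `M` and with arrows the
`(r + n)`-dimensional manifold `G`, so that its Lie algebroid has rank `r`. -/
structure LieGroupoid (n r : ℕ) (M G : Type*)
    [TopologicalSpace M] [ChartedSpace (EuclideanSpace ℝ (Fin n)) M]
    [TopologicalSpace G] [ChartedSpace (EuclideanSpace ℝ (Fin (r + n))) G]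
    extends GroupoidOver M G where
  contMDiff_src : ContMDiff (𝓡 (r + n)) (𝓡 n) ∞ src
  contMDiff_tgt : ContMDiff (𝓡 (r + n)) (𝓡 n) ∞ tgt
  contMDiff_unit : ContMDiff (𝓡 n) (𝓡 (r + n)) ∞ unit
  contMDiff_inv : ContMDiff (𝓡 (r + n)) (𝓡 (r + n)) ∞ inv
  contMDiffOn_mul : ContMDiffOn ((𝓡 (r + n)).prod (𝓡 (r + n))) (𝓡 (r + n)) ∞
    (fun p : G × G => mul p.1 p.2) {p | src p.1 = tgt p.2}
  surjective_mfderiv_src : ∀ g, Function.Surjective (mfderiv (𝓡 (r + n)) (𝓡 n) src g)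
  surjective_mfderiv_tgt : ∀ g, Function.Surjective (mfderiv (𝓡 (r + n)) (𝓡 n) tgt g)

namespace LieGroupoid

variable {n r : ℕ} {M G : Type*}
  [TopologicalSpace M] [ChartedSpace (EuclideanSpace ℝ (Fin n)) M]
  [TopologicalSpace G] [ChartedSpace (EuclideanSpace ℝ (Fin (r + n))) G]
  (𝒢 : LieGroupoid n r M G)

/-! ### Differentiable cohomology -/

/-- The space of differentiable `1`-cocycles: the smooth functions `c` on `G` such that
`c (g h) = c g + c h` whenever `g` and `h` are composable. -/
def realCocycles : Submodule ℝ (G → ℝ) where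
  carrier := {c | ContMDiff (𝓡 (r + n)) 𝓘(ℝ, ℝ) ∞ c ∧
    ∀ g h, 𝒢.src g = 𝒢.tgt h → c (𝒢.mul g h) = c g + c h}
  zero_mem' := ⟨contMDiff_const, fun _ _ _ => by simp⟩
  add_mem' := fun {c d} hc hd => ⟨hc.1.add hd.1, fun g h e => by
    simp only [Pi.add_apply, hc.2 g h e, hd.2 g h e]; ring⟩
  smul_mem' := fun a c hc => ⟨contMDiff_const.mul hc.1, fun g h e => by
    simp only [Pi.smul_apply, hc.2 g h e, smul_add]⟩

/-- The space of coboundaries `δ f : g ↦ f (src g) - f (tgt g)`, with `f` smooth on `M`. -/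
def realCoboundaries : Submodule ℝ 𝒢.realCocycles where
  carrier := {c | ∃ f : M → ℝ, ContMDiff (𝓡 n) 𝓘(ℝ, ℝ) ∞ f ∧
    ∀ g, c.1 g = f (𝒢.src g) - f (𝒢.tgt g)}
  zero_mem' := ⟨0, contMDiff_const, fun _ => by simp⟩
  add_mem' := by
    rintro c d ⟨f, hf, hcf⟩ ⟨k, hk, hdk⟩
    exact ⟨f + k, hf.add hk, fun g => by simp [hcf, hdk]; ring⟩
  smul_mem' := by
    rintro a c ⟨f, hf, hcf⟩
    exact ⟨a • f, contMDiff_const.mul hf, fun g => by simp [hcf]; ring⟩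

/-- The first differentiable cohomology `H¹_diff(𝒢)`. -/
abbrev H1diff : Type _ := 𝒢.realCocycles ⧸ 𝒢.realCoboundaries

section Cech

variable (A : Type*) [CommGroup A]

/-- The restriction map `H¹(𝒢_𝒰, A) → H¹(𝒢_𝒱, A)`, for `𝒱` a refinement of `𝒰`. -/
def cechMap (𝒰 𝒱 : OpenCover M) (h : 𝒰 ≤ 𝒱) :
    (𝒢.pullback 𝒰.proj).discreteH1 A →* (𝒢.pullback 𝒱.proj).discreteH1 A :=
  𝒢.discreteH1Map (OpenCover.refineMap h) (OpenCover.continuous_refineMap h)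
    (OpenCover.proj_refineMap h)

instance : DirectedSystem (fun 𝒰 : OpenCover M => (𝒢.pullback 𝒰.proj).discreteH1 A)
    (fun 𝒰 𝒱 h => 𝒢.cechMap A 𝒰 𝒱 h) where
  map_self 𝒰 z := by
    rw [cechMap, 𝒢.discreteH1Map_congr 𝒢.contMDiff_unit.continuous 𝒰.continuous_proj _ id _ _
      continuous_id (fun _ => rfl), 𝒢.discreteH1Map_id]
  map_map 𝒲 𝒱 𝒰 h h' z := by
    rw [cechMap, cechMap, cechMap, 𝒢.discreteH1Map_comp]
    exact 𝒢.discreteH1Map_congr 𝒢.contMDiff_unit.continuous 𝒲.continuous_proj _ _ _ _ _ _ z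

/-- The Čech-type differentiable cohomology `Ȟ¹_diff(𝒢, A)` with coefficients in a discrete abelian
group `A`: the colimit over the open covers `𝒰` of `M` of the groups `H¹_diff(𝒢_𝒰, A)`, where
`𝒢_𝒰` is the pull-back of `𝒢` to the disjoint union of the members of `𝒰`. -/
abbrev CechH1 : Type _ :=
  DirectLimit (fun 𝒰 : OpenCover M => (𝒢.pullback 𝒰.proj).discreteH1 A)
    (fun 𝒰 𝒱 h => 𝒢.cechMap A 𝒰 𝒱 h)

end Cech

/-! ### The Lie algebroid as a vector bundle, and translations -/

/-- The fibre `A_x` of the Lie algebroid: the kernel of `d src` at the unit at `x`. -/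
abbrev algebroidFibre (x : M) : Submodule ℝ (TangentSpace (𝓡 (r + n)) (𝒢.unit x)) :=
  LinearMap.ker (mfderiv (𝓡 (r + n)) (𝓡 n) 𝒢.src (𝒢.unit x)).toLinearMap

/-- The right translation `A_y → T_g G`, for `g : x → y`: the differential at `1_y` of `h ↦ h g`,
which is defined on the fibre of `src` over `y`. (The vectors of `A_y` are tangent to that fibre,
so their images do not depend on the derivative used for the other directions.) -/
def rightTranslation (g : G) :
    𝒢.algebroidFibre (𝒢.tgt g) →ₗ[ℝ] TangentSpace (𝓡 (r + n)) g :=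
  (mfderivWithin (𝓡 (r + n)) (𝓡 (r + n)) (fun h => 𝒢.mul h g)
    (𝒢.src ⁻¹' {𝒢.tgt g}) (𝒢.unit (𝒢.tgt g))).toLinearMap.domRestrict
    (𝒢.algebroidFibre (𝒢.tgt g))

/-- The left translation `A_x → T_g G`, for `g : x → y`: minus the differential at `1_x` of
`h ↦ g h⁻¹`, which is defined on the fibre of `src` over `x`. It takes values in the kernel of
`d tgt`. (For a Lie group it is the differential of `h ↦ g h` at the identity.) -/
def leftTranslation (g : G) :
    𝒢.algebroidFibre (𝒢.src g) →ₗ[ℝ] TangentSpace (𝓡 (r + n)) g :=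
  -(mfderivWithin (𝓡 (r + n)) (𝓡 (r + n)) (fun h => 𝒢.mul g (𝒢.inv h))
    (𝒢.src ⁻¹' {𝒢.src g}) (𝒢.unit (𝒢.src g))).toLinearMap.domRestrict
    (𝒢.algebroidFibre (𝒢.src g))

theorem finrank_algebroidFibre (x : M) : Module.finrank ℝ (𝒢.algebroidFibre x) = r := by
  have : FiniteDimensional ℝ (TangentSpace (𝓡 (r + n)) (𝒢.unit x)) :=
    inferInstanceAs (FiniteDimensional ℝ (EuclideanSpace ℝ (Fin (r + n))))
  have h := LinearMap.finrank_range_add_finrank_ker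
    (mfderiv (𝓡 (r + n)) (𝓡 n) 𝒢.src (𝒢.unit x)).toLinearMap
  have h1 : Module.finrank ℝ (TangentSpace (𝓡 n) (𝒢.src (𝒢.unit x))) = n :=
    finrank_euclideanSpace_fin
  have h2 : Module.finrank ℝ (TangentSpace (𝓡 (r + n)) (𝒢.unit x)) = r + n :=
    finrank_euclideanSpace_fin
  rw [LinearMap.range_eq_top.2 (𝒢.surjective_mfderiv_src (𝒢.unit x)), finrank_top, h1, h2] at h
  exact Nat.add_left_cancel (h.trans (Nat.add_comm r n))

/-! ### The transverse volume and density bundles -/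

/-- The fibre at `x` of `F(A*) ⊗ F(TM)`, where `F(V)` is the line of the functions `ξ` on the set of
frames of `V` with `ξ(e · P) = χ(det P) ξ(e)`, for a character `χ` of `ℝˣ` extended by `χ 0 = 0`.
An element `α ⊗ β` of `F(A_x*) ⊗ F(T_x M)` is seen as the function `(a, X) ↦ α(a^∨) β(X)` of a frame
`a` of `A_x`, with dual frame `a^∨`, and a frame `X` of `T_x M`. Here `a'.det a` is the determinant
of the matrix that takes `a'` to `a`, so that it is inverse to `a.det a'`. -/
def transverseFibre (χ : ℝ →*₀ ℝ) (x : M) :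
    Submodule ℝ (Module.Basis (Fin r) ℝ (𝒢.algebroidFibre x) →
      Module.Basis (Fin n) ℝ (TangentSpace (𝓡 n) x) → ℝ) where
  carrier := {ξ | ∀ (a a' : Module.Basis (Fin r) ℝ (𝒢.algebroidFibre x))
    (X X' : Module.Basis (Fin n) ℝ (TangentSpace (𝓡 n) x)), ξ a' X' = χ (a'.det a) * χ (X.det X') * ξ a X}
  zero_mem' := fun _ _ _ _ => by simp
  add_mem' := fun {ξ η} hξ hη a a' X X' => by
    simp only [Pi.add_apply, hξ a a' X X', hη a a' X X']; ring
  smul_mem' := fun c ξ hξ a a' X X' => by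
    simp only [Pi.smul_apply, smul_eq_mul, hξ a a' X X']; ring

/-- The basis of `T_g G` given by the model space. -/
def tangentBasis (g : G) : Module.Basis (Fin r ⊕ Fin n) ℝ (TangentSpace (𝓡 (r + n)) g) :=
  (EuclideanSpace.basisFun (Fin (r + n)) ℝ).toBasis.reindex finSumFinEquiv.symm

/-- The determinant of a family of `r + n` vectors of `U`, as a form in the first `r` vectors. -/
theorem det_sumElim_left {U V : Type*} [AddCommGroup U] [Module ℝ U] [AddCommGroup V] [Module ℝ V]
    (B : Module.Basis (Fin r ⊕ Fin n) ℝ U) (L : V →ₗ[ℝ] U) (w : Fin n → U)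
    (a a' : Module.Basis (Fin r) ℝ V) :
    B.det (Sum.elim (L ∘ a') w) = a.det a' * B.det (Sum.elim (L ∘ a) w) := by
  let D : V [⋀^Fin r]→ₗ[ℝ] ℝ :=
    { toFun := fun v => B.det (Sum.elim (L ∘ v) w)
      map_update_add' := fun v i p q => by
        classical
        simp [Function.comp_update, -Sum.update_elim_inl]
      map_update_smul' := fun v i c p => by
        classical
        simp [Function.comp_update, -Sum.update_elim_inl]
      map_eq_zero_of_eq' := fun v i j h hij =>
        B.det.map_eq_zero_of_eq _ (i := Sum.inl i) (j := Sum.inl j) (by simp [h])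
          (by simpa using hij) }
  have := congrArg (fun E => E a') (D.eq_smul_basis_det a)
  simpa [D, mul_comm] using this

/-- The determinant of a family of `r + n` vectors of `U`, as a form in the last `n` vectors. -/
theorem det_sumElim_right {U V : Type*} [AddCommGroup U] [Module ℝ U] [AddCommGroup V] [Module ℝ V]
    (B : Module.Basis (Fin r ⊕ Fin n) ℝ U) (L : V →ₗ[ℝ] U) (w : Fin r → U)
    (a a' : Module.Basis (Fin n) ℝ V) :
    B.det (Sum.elim w (L ∘ a')) = a.det a' * B.det (Sum.elim w (L ∘ a)) := by
  let D : V [⋀^Fin n]→ₗ[ℝ] ℝ :=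
    { toFun := fun v => B.det (Sum.elim w (L ∘ v))
      map_update_add' := fun v i p q => by
        classical
        simp [Function.comp_update, -Sum.update_elim_inr]
      map_update_smul' := fun v i c p => by
        classical
        simp [Function.comp_update, -Sum.update_elim_inr]
      map_eq_zero_of_eq' := fun v i j h hij =>
        B.det.map_eq_zero_of_eq _ (i := Sum.inr i) (j := Sum.inr j) (by simp [h])
          (by simpa using hij) }
  have := congrArg (fun E => E a') (D.eq_smul_basis_det a)
  simpa [D, mul_comm] using this

/-- A linear section of `d src : T_g G → T_x M`, for `g : x → y`. -/
def srcLift (g : G) : TangentSpace (𝓡 n) (𝒢.src g) →ₗ[ℝ] TangentSpace (𝓡 (r + n)) g :=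
  ((mfderiv (𝓡 (r + n)) (𝓡 n) 𝒢.src g).toLinearMap.exists_rightInverse_of_surjective
    (LinearMap.range_eq_top.2 (𝒢.surjective_mfderiv_src g))).choose

/-- A linear section of `d tgt : T_g G → T_y M`, for `g : x → y`. -/
def tgtLift (g : G) : TangentSpace (𝓡 n) (𝒢.tgt g) →ₗ[ℝ] TangentSpace (𝓡 (r + n)) g :=
  ((mfderiv (𝓡 (r + n)) (𝓡 n) 𝒢.tgt g).toLinearMap.exists_rightInverse_of_surjective
    (LinearMap.range_eq_top.2 (𝒢.surjective_mfderiv_tgt g))).choose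

/-- For `g : x → y`, frames `b` of `A_x`, `X` of `T_x M`, `a` of `A_y` and `Y` of `T_y M`, the
determinant of the matrix that takes the frame of `T_g G` induced by `a` and `X` through the exact
sequence `0 → A_y → T_g G → T_x M → 0` of the right translation and `d src` to the frame induced by
`b` and `Y` through the exact sequence `0 → A_x → T_g G → T_y M → 0` of the left translation and
`d tgt`. (It does not depend on the chosen lifts.) -/
def frameRatio (g : G)
    (b : Module.Basis (Fin r) ℝ (𝒢.algebroidFibre (𝒢.src g)))
    (X : Module.Basis (Fin n) ℝ (TangentSpace (𝓡 n) (𝒢.src g)))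
    (a : Module.Basis (Fin r) ℝ (𝒢.algebroidFibre (𝒢.tgt g)))
    (Y : Module.Basis (Fin n) ℝ (TangentSpace (𝓡 n) (𝒢.tgt g))) : ℝ :=
  (tangentBasis (r := r) (n := n) g).det
      (Sum.elim (𝒢.leftTranslation g ∘ b) (𝒢.tgtLift g ∘ Y)) /
    (tangentBasis (r := r) (n := n) g).det
      (Sum.elim (𝒢.rightTranslation g ∘ a) (𝒢.srcLift g ∘ X))

/-- Some frame of `A_x`. -/
def someFrame (x : M) : Module.Basis (Fin r) ℝ (𝒢.algebroidFibre x) :=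
  have : FiniteDimensional ℝ (TangentSpace (𝓡 (r + n)) (𝒢.unit x)) :=
    inferInstanceAs (FiniteDimensional ℝ (EuclideanSpace ℝ (Fin (r + n))))
  Module.finBasisOfFinrankEq ℝ (𝒢.algebroidFibre x) (𝒢.finrank_algebroidFibre x)

/-- Some frame of `T_x M`. -/
def someTangentFrame (x : M) : Module.Basis (Fin n) ℝ (TangentSpace (𝓡 n) x) :=
  (EuclideanSpace.basisFun (Fin n) ℝ).toBasis

/-- The action `g_*` of `g : x → y` on the transverse bundle: `(g_* ξ)(a, Y) = χ(det P) ξ(b, X)`, where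
`P` takes the frame of `T_g G` induced by `(a, X)` to the one induced by `(b, Y)`. (The result does
not depend on `b` and `X`.) -/
def transverseAction (χ : ℝ →*₀ ℝ) (g : G) :
    𝒢.transverseFibre χ (𝒢.src g) →ₗ[ℝ] 𝒢.transverseFibre χ (𝒢.tgt g) where
  toFun ξ := ⟨fun a Y =>
      χ (𝒢.frameRatio g (𝒢.someFrame (𝒢.src g)) (someTangentFrame (𝒢.src g)) a Y) *
        ξ.1 (𝒢.someFrame (𝒢.src g)) (someTangentFrame (𝒢.src g)), fun a a' Y Y' => by
    have hinv : (a.det a')⁻¹ = a'.det a := by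
      have h1 : a'.det a * a.det a' = 1 := by rw [Module.Basis.det_mul_det, Module.Basis.det_self]
      exact (eq_inv_of_mul_eq_one_left h1).symm
    unfold frameRatio
    beta_reduce
    rw [det_sumElim_right _ (𝒢.tgtLift g) _ Y Y', det_sumElim_left _ (𝒢.rightTranslation g) _ a a',
      ← hinv, ← map_mul, ← mul_assoc, ← map_mul]
    congr 2
    rw [mul_div_mul_comm, div_eq_mul_inv (Y.det Y')]
    ring⟩
  map_add' ξ η := by
    apply Subtype.ext
    funext a Y
    simp [mul_add]
  map_smul' c ξ := by
    apply Subtype.ext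
    funext a Y
    simp [mul_left_comm]

/-- Smoothness on the open set `U` of a section of the transverse bundle: its values on smooth
local frames of `A` and of `TM` are smooth. -/
def IsSmoothOn [IsManifold (𝓡 n) ∞ M] [IsManifold (𝓡 (r + n)) ∞ G] (χ : ℝ →*₀ ℝ)
    (σ : ∀ x : M, 𝒢.transverseFibre χ x) (U : Opens M) : Prop :=
  ∀ W : Opens M, W ≤ U →
    ∀ (a : ∀ x : M, Module.Basis (Fin r) ℝ (𝒢.algebroidFibre x))
      (X : ∀ x : M, Module.Basis (Fin n) ℝ (TangentSpace (𝓡 n) x)),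
      (∀ i, ContMDiffOn (𝓡 n) (𝓡 (r + n)).tangent ∞
        (fun x => (⟨𝒢.unit x, (a x i).1⟩ : TangentBundle (𝓡 (r + n)) G)) W) →
      (∀ j, ContMDiffOn (𝓡 n) (𝓡 n).tangent ∞
        (fun x => (⟨x, X x j⟩ : TangentBundle (𝓡 n) M)) W) →
      ContMDiffOn (𝓡 n) 𝓘(ℝ, ℝ) ∞ (fun x => (σ x).1 (a x) (X x)) W

variable [IsManifold (𝓡 n) ∞ M] [IsManifold (𝓡 (r + n)) ∞ G]

/-- The character whose transverse bundle is the transverse volume bundle `V_A^tr`. -/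
abbrev volumeCharacter : ℝ →*₀ ℝ := MonoidWithZeroHom.id ℝ

/-- The character whose transverse bundle is the transverse density bundle `D_A^tr`. -/
abbrev densityCharacter : ℝ →*₀ ℝ := absHom

/-- `𝒢` admits a transverse volume form: a nowhere vanishing smooth section of the transverse
volume bundle which is `𝒢`-invariant. -/
def AdmitsTransverseVolumeForm : Prop :=
  ∃ σ : ∀ x : M, 𝒢.transverseFibre volumeCharacter x,
    𝒢.IsSmoothOn volumeCharacter σ ⊤ ∧ (∀ x, σ x ≠ 0) ∧
    ∀ g, 𝒢.transverseAction volumeCharacter g (σ (𝒢.src g)) = σ (𝒢.tgt g)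

/-- `𝒢` is transversely orientable: the transverse volume bundle has an orientation (a continuous
choice of a ray in each fibre, that is, one given locally by smooth nowhere vanishing sections) that
is preserved by the action of `𝒢`. -/
def TransverselyOrientable : Prop :=
  ∃ o : ∀ x : M, Module.Ray ℝ (𝒢.transverseFibre volumeCharacter x),
    (∀ x : M, ∃ U : Opens M, x ∈ U ∧ ∃ σ : ∀ y : M, 𝒢.transverseFibre volumeCharacter y,
      𝒢.IsSmoothOn volumeCharacter σ U ∧
      ∀ y ∈ U, ∃ h : σ y ≠ 0, rayOfNeZero ℝ (σ y) h = o y) ∧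
    ∀ (g : G) (v : 𝒢.transverseFibre volumeCharacter (𝒢.src g)) (hv : v ≠ 0),
      rayOfNeZero ℝ v hv = o (𝒢.src g) →
      ∃ h : 𝒢.transverseAction volumeCharacter g v ≠ 0,
        rayOfNeZero ℝ (𝒢.transverseAction volumeCharacter g v) h = o (𝒢.tgt g)

/-! ### The modular class and the transverse first Stiefel–Whitney class -/

/-- `κ` is the class of the cocycle `c_σ(g) = log (σ(y) / g_* σ(x))`, `g : x → y`, for some smooth
strictly positive section `σ` of the transverse density bundle. -/
def IsModularClass (κ : 𝒢.H1diff) : Prop :=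
  ∃ σ : ∀ x : M, 𝒢.transverseFibre densityCharacter x,
    𝒢.IsSmoothOn densityCharacter σ ⊤ ∧ (∀ x a X, 0 < (σ x).1 a X) ∧
    ∃ c : 𝒢.realCocycles,
      (∀ g, σ (𝒢.tgt g) =
        Real.exp (c.1 g) • 𝒢.transverseAction densityCharacter g (σ (𝒢.src g))) ∧
      κ = Submodule.Quotient.mk c

/-- The modular class of `𝒢`. -/
def modularClass : 𝒢.H1diff := Classical.epsilon 𝒢.IsModularClass

/-- `w` is the class obtained from some open cover `𝒰` of `M` and some smooth nowhere vanishing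
sections `σ_U` of the transverse volume bundle over the members `U` of `𝒰`, as the class in the
colimit of the cocycle `g ↦ sign c̃(g)` on `𝒢_𝒰`, where `g_* σ_U(x) = c̃(g) σ_V(y)` for an arrow
`g : (U, x) → (V, y)` of `𝒢_𝒰`. -/
def IsTransverseStiefelWhitneyClass (w : 𝒢.CechH1 ℤˣ) : Prop :=
  ∃ (𝒰 : OpenCover M) (σ : 𝒰.sets → ∀ x : M, 𝒢.transverseFibre volumeCharacter x),
    (∀ U : 𝒰.sets, 𝒢.IsSmoothOn volumeCharacter (σ U) U.1 ∧ ∀ x ∈ U.1, σ U x ≠ 0) ∧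
    ∃ c : (𝒢.pullback 𝒰.proj).discreteCocycles ℤˣ,
      (∀ p : 𝒢.PullbackArrow 𝒰.proj, ∃ l : ℝ, 0 < l ∧
        𝒢.transverseAction volumeCharacter p.1.2.1 (σ p.1.2.2.1 (𝒢.src p.1.2.1)) =
          (l * ((c.1 p : ℤ) : ℝ)) • σ p.1.1.1 (𝒢.tgt p.1.2.1)) ∧
      w = Quotient.mk _ ⟨𝒰, QuotientGroup.mk c⟩

/-- The transverse first Stiefel–Whitney class of `𝒢`. -/
def transverseStiefelWhitneyClass : 𝒢.CechH1 ℤˣ :=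
  Classical.epsilon 𝒢.IsTransverseStiefelWhitneyClass

end LieGroupoid

end

/-!
Choose a frame of `A_x` and a frame of `T_xM` at every point `x`. For an arrow `g : x → y` the two
exact sequences turn these into two frames of `T_g G`, and the action of `g` on the transverse
bundle of a character `χ` is given by `χ` of their ratio, the determinant of one frame in the
other. Computing the derivative of the multiplication on the tangent space of the pairs of
composable arrows shows that the ratio is multiplicative, and it is smooth when the frames are.

The coefficient `c(g)` with `g_* σ(x) = c(g) σ'(y)`, for nowhere vanishing sections, is therefore a
smooth cocycle up to a change of sections. For densities `-log c` gives the modular class, and for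
volume elements `sign c` gives `w₁`. If `w₁ = 1`, multiplying the local sections by locally constant
signs makes all coefficients positive, so that the sections define an invariant orientation, and
conversely. If `mod = 0`, rescaling a positive density by `exp f` makes it invariant. Given an
invariant positive density `δ` and oriented local sections `σ_U`, normalized so that `|σ_U| = δ`,
the coefficients of the `σ_U` are positive of absolute value `1`; hence they are `1`, and the `σ_U`
agree on overlaps and form an invariant volume form.
-/

/-! ### Determinants of frames adapted to exact sequences -/

section LinearAlgebra

theorem linearIndependent_sumElim_of_comp {R κ ι V W : Type*} [Ring R] [AddCommGroup V]
    [Module R V] [AddCommGroup W] [Module R W] (p : W →ₗ[R] V) {k : κ → W} {w : ι → W}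
    (hk : LinearIndependent R k) (hpk : ∀ i, p (k i) = 0) (hw : LinearIndependent R (p ∘ w)) :
    LinearIndependent R (Sum.elim k w) := by
  refine hk.sum_type (hw.of_comp p) (Disjoint.mono_left ?_ (Submodule.range_ker_disjoint hw).symm)
  rw [Submodule.span_le]
  rintro _ ⟨i, rfl⟩
  exact hpk i

theorem linearIndependent_of_eq_basis {R ι V : Type*} [Semiring R] [AddCommMonoid V] [Module R V]
    (B : Module.Basis ι R V) {v : ι → V} (h : ∀ i, v i = B i) : LinearIndependent R v :=
  funext h ▸ B.linearIndependent

theorem sign_sumComm (κ : Type*) [Fintype κ] [DecidableEq κ] :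
    Equiv.Perm.sign (Equiv.sumComm κ κ : Equiv.Perm (κ ⊕ κ)) = (-1) ^ Fintype.card κ := by
  have sign_swap : Equiv.Perm.sign (Equiv.prodCongrRight fun _ : κ => Equiv.swap true false) =
      (-1) ^ Fintype.card κ := by
    rw [Equiv.Perm.sign_prodCongrRight, Equiv.Perm.sign_swap (by decide), Finset.prod_const,
      Finset.card_univ]
  rw [← sign_swap]
  let e : κ ⊕ κ ≃ κ × Bool := (Equiv.boolProdEquivSum κ).symm.trans (Equiv.prodComm Bool κ)
  refine Equiv.Perm.sign_eq_sign_of_equiv _ _ e ?_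
  rintro (i | i) <;> simp [e, Equiv.prodCongrRight]

section CommRing

variable {R κ ι V W : Type*} [CommRing R] [AddCommGroup V] [Module R V] [AddCommGroup W]
  [Module R W] [Fintype κ] [Fintype ι] [DecidableEq κ] [DecidableEq ι]

theorem basis_det_eq_mul (B B' : Module.Basis ι R W) (v : ι → W) :
    B.det v = B.det B' * B'.det v := by
  simpa using congrArg (fun f => f v) (B.det.eq_smul_basis_det B')

theorem basis_det_mul_det_symm (B B' : Module.Basis ι R W) : B.det B' * B'.det B = 1 := by
  rw [Module.Basis.det_mul_det, Module.Basis.det_self]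

theorem det_sumElim_swap (B : Module.Basis (κ ⊕ (κ ⊕ ι)) R W) (a b : κ → W) (w : ι → W) :
    B.det (Sum.elim a (Sum.elim b w)) =
      (-1) ^ Fintype.card κ * B.det (Sum.elim b (Sum.elim a w)) := by
  let τ : Equiv.Perm (κ ⊕ (κ ⊕ ι)) :=
    (Equiv.sumAssoc κ κ ι).permCongr (Equiv.sumCongr (Equiv.sumComm κ κ) (Equiv.refl ι))
  have sign_τ : Equiv.Perm.sign τ = (-1) ^ Fintype.card κ := by
    rw [Equiv.Perm.sign_permCongr]
    exact (Equiv.Perm.sign_sumCongr _ _).trans (by simp [sign_sumComm])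
  have comp_τ : Sum.elim b (Sum.elim a w) ∘ τ = Sum.elim a (Sum.elim b w) := by
    funext x
    rcases x with (i | i | i) <;> simp [τ, Equiv.permCongr_apply]
  rw [← comp_τ, B.det.map_perm, sign_τ, Units.smul_def, zsmul_eq_mul]
  push_cast
  rfl

theorem det_sumElim_neg (B : Module.Basis (κ ⊕ ι) R W) (a : κ → W) (w : ι → W) :
    B.det (Sum.elim (-a) w) = (-1) ^ Fintype.card κ * B.det (Sum.elim a w) := by
  have smul_eq : (fun i => (Sum.elim (fun _ => -1) (fun _ => 1) i : R) • Sum.elim a w i) =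
      Sum.elim (-a) w := by
    funext i
    rcases i with (i | i) <;> simp
  rw [← smul_eq]
  simpa [Fintype.prod_sum_type] using B.det.toMultilinearMap.map_smul_univ
    (Sum.elim (fun _ => -1) (fun _ => 1)) (Sum.elim a w)

theorem det_sumElim_of_adapted (B : Module.Basis (κ ⊕ ι) R W) (C : Module.Basis ι R V)
    (p : W →ₗ[R] V) (hp_inl : ∀ i, p (B (Sum.inl i)) = 0)
    (hp_inr : ∀ j, p (B (Sum.inr j)) = C j) (w : ι → W) :
    B.det (Sum.elim (B ∘ Sum.inl) w) = C.det (p ∘ w) := by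
  have repr_inr (v : W) (j : ι) : B.repr v (Sum.inr j) = C.repr (p v) j := by
    conv_rhs => rw [← B.sum_repr v, Fintype.sum_sum_type]
    simp [hp_inl, hp_inr, Finsupp.single_apply]
  have toMatrix_eq : B.toMatrix (Sum.elim (B ∘ Sum.inl) w) = Matrix.fromBlocks 1
      (Matrix.of fun i j => B.repr (w j) (Sum.inl i)) 0 (C.toMatrix (p ∘ w)) := by
    ext (i | i) (j | j) <;>
      simp [Module.Basis.toMatrix_apply, repr_inr, Matrix.one_apply, Finsupp.single_apply, eq_comm]
  rw [Module.Basis.det_apply, toMatrix_eq, Matrix.det_fromBlocks_zero₂₁, Matrix.det_one, one_mul,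
    Module.Basis.det_apply]

end CommRing

section Field

variable {K κ ι U V W : Type*} [Field K] [AddCommGroup U] [Module K U] [AddCommGroup V]
  [Module K V] [AddCommGroup W] [Module K W] [Fintype κ] [Fintype ι] [DecidableEq κ]
  [DecidableEq ι]

theorem linearIndependent_iff_basis_det_ne_zero (B : Module.Basis ι K W) {v : ι → W} :
    LinearIndependent K v ↔ B.det v ≠ 0 := by
  have : FiniteDimensional K W := B.finiteDimensional_of_finite
  rw [← isUnit_iff_ne_zero, ← B.is_basis_iff_det, iff_self_and]
  exact fun hv => hv.span_eq_top_of_card_eq_finrank' (Module.finrank_eq_card_basis B).symm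

theorem basis_det_div_basis_det (B B' : Module.Basis ι K W) (v w : ι → W) :
    B.det v / B.det w = B'.det v / B'.det w := by
  rw [basis_det_eq_mul B B' v, basis_det_eq_mul B B' w,
    mul_div_mul_left _ _ (B.isUnit_det B').ne_zero]

theorem exists_det_sumElim_eq_mul_det (B : Module.Basis (κ ⊕ ι) K W) (C : Module.Basis ι K V)
    (p : W →ₗ[K] V) (hp : Function.Surjective p) {k : κ → W} (hk : LinearIndependent K k)
    (hpk : ∀ i, p (k i) = 0) :
    ∃ c : K, c ≠ 0 ∧ ∀ w : ι → W, B.det (Sum.elim k w) = c * C.det (p ∘ w) := by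
  choose s hs using fun j => hp (C j)
  have hli : LinearIndependent K (Sum.elim k s) :=
    linearIndependent_sumElim_of_comp p hk hpk
      ((funext hs : p ∘ s = C) ▸ C.linearIndependent)
  have hdet : IsUnit (B.det (Sum.elim k s)) :=
    isUnit_iff_ne_zero.2 ((linearIndependent_iff_basis_det_ne_zero B).1 hli)
  let B' := Module.Basis.mk hli (B.is_basis_iff_det.2 hdet).2.ge
  refine ⟨B.det B', (B.isUnit_det B').ne_zero, fun w => ?_⟩
  rw [basis_det_eq_mul B B', ← det_sumElim_of_adapted B' C p (by simp [B', hpk]) (by simp [B', hs])]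
  congr 3
  funext i
  simp [B']

theorem det_sumElim_ne_zero_of_comp (B : Module.Basis (κ ⊕ ι) K W) (p : W →ₗ[K] V) {k : κ → W}
    {w : ι → W} (hk : LinearIndependent K k) (hpk : ∀ i, p (k i) = 0)
    (hw : LinearIndependent K (p ∘ w)) : B.det (Sum.elim k w) ≠ 0 :=
  (linearIndependent_iff_basis_det_ne_zero B).1 (linearIndependent_sumElim_of_comp p hk hpk hw)

theorem det_sumElim_eq_of_comp_eq (B : Module.Basis (κ ⊕ ι) K W) (C : Module.Basis ι K V)
    (p : W →ₗ[K] V) (hp : Function.Surjective p) {k : κ → W} {w w' : ι → W}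
    (hk : LinearIndependent K k) (hpk : ∀ i, p (k i) = 0) (hww' : p ∘ w = p ∘ w') :
    B.det (Sum.elim k w) = B.det (Sum.elim k w') := by
  obtain ⟨c, -, det_eq⟩ := exists_det_sumElim_eq_mul_det B C p hp hk hpk
  rw [det_eq, det_eq, hww']

/-- Up to factors which cancel, each of the six determinants is the determinant with respect to `B`
of a frame consisting of two of the families `u`, `k`, `l` and one of `x`, `y`, `z`. -/
theorem det_mul_det_mul_det_eq {W' : Type*} [AddCommGroup W'] [Module K W']
    (B : Module.Basis (κ ⊕ (κ ⊕ ι)) K W')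
    (Bg : Module.Basis (κ ⊕ ι) K U) (Bh : Module.Basis (κ ⊕ ι) K V) (Bm : Module.Basis (κ ⊕ ι) K W)
    (pg : W' →ₗ[K] U) (ph : W' →ₗ[K] V) (m : W' →ₗ[K] W)
    (hpg : Function.Surjective pg) (hph : Function.Surjective ph) (hm : Function.Surjective m)
    {u k l : κ → W'} (x y z : ι → W')
    (hu : LinearIndependent K u) (hk : LinearIndependent K k) (hl : LinearIndependent K l)
    (hpu : ∀ i, ph (u i) = 0) (hmk : ∀ i, m (k i) = 0) (hpl : ∀ i, pg (l i) = 0) :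
    Bm.det (Sum.elim (m ∘ l) (m ∘ z)) *
        (Bg.det (Sum.elim (pg ∘ u) (pg ∘ y)) * Bh.det (Sum.elim (ph ∘ k) (ph ∘ x))) =
      Bg.det (Sum.elim (-(pg ∘ k)) (pg ∘ z)) * Bh.det (Sum.elim (ph ∘ l) (ph ∘ y)) *
        Bm.det (Sum.elim (m ∘ u) (m ∘ x)) := by
  obtain ⟨ch, hch, det_u⟩ := exists_det_sumElim_eq_mul_det B Bh ph hph hu hpu
  obtain ⟨cg, hcg, det_l⟩ := exists_det_sumElim_eq_mul_det B Bg pg hpg hl hpl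
  obtain ⟨cm, hcm, det_k⟩ := exists_det_sumElim_eq_mul_det B Bm m hm hk hmk
  have det_ukx := det_u (Sum.elim k x)
  have det_uly := det_u (Sum.elim l y)
  have det_luy := det_l (Sum.elim u y)
  have det_lkz := det_l (Sum.elim k z)
  have det_kux := det_k (Sum.elim u x)
  have det_klz := det_k (Sum.elim l z)
  rw [Sum.comp_elim] at det_ukx det_uly det_luy det_lkz det_kux det_klz
  refine mul_left_cancel₀ (mul_ne_zero (mul_ne_zero hcm hcg) hch) ?_
  calc _ = (cm * Bm.det (Sum.elim (m ∘ l) (m ∘ z))) * (cg * Bg.det (Sum.elim (pg ∘ u) (pg ∘ y))) *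
        (ch * Bh.det (Sum.elim (ph ∘ k) (ph ∘ x))) := by ring
    _ = (cm * Bm.det (Sum.elim (m ∘ u) (m ∘ x))) *
        ((-1) ^ Fintype.card κ * (cg * Bg.det (Sum.elim (pg ∘ k) (pg ∘ z)))) *
        (ch * Bh.det (Sum.elim (ph ∘ l) (ph ∘ y))) := by
      rw [← det_ukx, ← det_uly, ← det_luy, ← det_lkz, ← det_kux, ← det_klz,
        det_sumElim_swap B k u x, det_sumElim_swap B k l z, det_sumElim_swap B u l y]
      rcases neg_one_pow_eq_or K (Fintype.card κ) with h | h <;> rw [h] <;> ring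
    _ = _ := by rw [det_sumElim_neg Bg (pg ∘ k) (pg ∘ z)]; ring

end Field

end LinearAlgebra

/-! ### Velocities of curves -/

section Velocity

variable {E : Type*} [NormedAddCommGroup E] [NormedSpace ℝ E] {H : Type*} [TopologicalSpace H]
  {I : ModelWithCorners ℝ E H} {N : Type*} [TopologicalSpace N] [ChartedSpace H N]
  {E' : Type*} [NormedAddCommGroup E'] [NormedSpace ℝ E'] {H' : Type*} [TopologicalSpace H']
  {I' : ModelWithCorners ℝ E' H'} {N' : Type*} [TopologicalSpace N'] [ChartedSpace H' N']

variable (I) in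
/-- The curve `c` passes through `p` at the time `0`, with velocity `v`. The point `p` is a separate
argument so that velocities at points which are only propositionally equal can be compared. -/
def HasVelocity (c : ℝ → N) (p : N) (v : TangentSpace I p) : Prop :=
  c 0 = p ∧ HasMFDerivAt 𝓘(ℝ, ℝ) I c 0 (ContinuousLinearMap.toSpanSingleton ℝ (v : E))

namespace HasVelocity

variable {c c' : ℝ → N} {p : N} {v w : TangentSpace I p}

theorem of_eq {q : N} {v : E} (hv : HasVelocity I c p v) (h : p = q) : HasVelocity I c q v :=
  h ▸ hv

theorem unique (hv : HasVelocity I c p v) (hw : HasVelocity I c p w) : v = w := by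
  have injective {u u' : E} (h : ContinuousLinearMap.toSpanSingleton ℝ u =
      ContinuousLinearMap.toSpanSingleton ℝ u') : u = u' :=
    ContinuousLinearMap.toSpanSingleton_inj.1 h
  exact injective (hasMFDerivAt_unique hv.2 hw.2)

theorem tendsto (hv : HasVelocity I c p v) : Filter.Tendsto c (𝓝 0) (𝓝 p) :=
  hv.1 ▸ hv.2.continuousAt.tendsto

theorem congr (hv : HasVelocity I c p v) (h : c =ᶠ[𝓝 0] c') : HasVelocity I c' p v := by
  obtain ⟨rfl, hc⟩ := hv
  exact ⟨h.eq_of_nhds.symm, (hc.congr_of_eventuallyEq h.symm :)⟩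

theorem const (p : N) : HasVelocity I (fun _ : ℝ => p) p 0 := by
  refine ⟨rfl, ?_⟩
  exact (hasMFDerivAt_const p (0 : ℝ)).congr_mfderiv
    (ContinuousLinearMap.toSpanSingleton_zero ℝ (M₁ := E)).symm

theorem prodMk {c' : ℝ → N'} {p' : N'} {v' : TangentSpace I' p'} (hv : HasVelocity I c p v)
    (hv' : HasVelocity I' c' p' v') :
    HasVelocity (I.prod I') (fun t => (c t, c' t)) (p, p') (v, v') := by
  obtain ⟨rfl, hc⟩ := hv
  obtain ⟨rfl, hc'⟩ := hv'
  exact ⟨rfl, hc.prodMk hc'⟩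

theorem mfderivWithin (hv : HasVelocity I c p v) {f : N → N'} {s : Set N}
    (hf : MDifferentiableWithinAt I I' f s p) (hs : ∀ᶠ t in 𝓝 0, c t ∈ s) :
    HasVelocity I' (fun t => f (c t)) (f p) (mfderivWithin I I' f s p v) := by
  obtain ⟨rfl, hc⟩ := hv
  refine ⟨rfl, ?_⟩
  have hfc := (hf.hasMFDerivWithinAt.comp 0 hc.hasMFDerivWithinAt subset_rfl).hasMFDerivAt hs
  have comp_toSpanSingleton (D : E →L[ℝ] E') (u : E) :
      D.comp (ContinuousLinearMap.toSpanSingleton ℝ u) =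
        ContinuousLinearMap.toSpanSingleton ℝ (D u) := D.comp_toSpanSingleton u
  exact hfc.congr_mfderiv (comp_toSpanSingleton _ _)

theorem mfderiv (hv : HasVelocity I c p v) {f : N → N'} (hf : MDifferentiableAt I I' f p) :
    HasVelocity I' (fun t => f (c t)) (f p) (mfderiv I I' f p v) := by
  rw [← mfderivWithin_univ]
  exact hv.mfderivWithin hf.mdifferentiableWithinAt (Filter.Eventually.of_forall fun _ => trivial)

theorem mfderiv_eq_zero (hv : HasVelocity I c p v) {f : N → N'} (hf : MDifferentiableAt I I' f p)
    (hfc : ∀ᶠ t in 𝓝 0, f (c t) = f p) : _root_.mfderiv I I' f p v = 0 :=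
  ((hv.mfderiv hf).congr hfc).unique (const (f p))

theorem hasDerivAt_extChartAt [IsManifold I 1 N] (hv : HasVelocity I c p v) {p₀ : N}
    (hp : p ∈ (chartAt H p₀).source) :
    HasDerivAt (F := E) (fun t => extChartAt I p₀ (c t))
      (trivializationAt E (TangentSpace I) p₀ ⟨p, v⟩).2 0 := by
  obtain ⟨rfl, hc⟩ := hv
  have hchart := hasMFDerivAt_extChartAt (I := I) hp
  rw [mfderiv_chartAt_eq_tangentCoordChange hp] at hchart
  have comp_toSpanSingleton (D : E →L[ℝ] E) (u : E) :
      D.comp (ContinuousLinearMap.toSpanSingleton ℝ u) =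
        ContinuousLinearMap.toSpanSingleton ℝ (D u) := D.comp_toSpanSingleton u
  exact ((hchart.comp 0 hc).congr_mfderiv (comp_toSpanSingleton _ _)).hasFDerivAt

theorem extChartAt_symm_comp [I.Boundaryless] {γ : ℝ → E} {v : E} (hγ : HasDerivAt γ v 0)
    (hγ0 : γ 0 = extChartAt I p p) : HasVelocity I (fun t => (extChartAt I p).symm (γ t)) p v := by
  have hγp : Filter.Tendsto γ (𝓝 0) (𝓝 (extChartAt I p p)) := hγ0 ▸ hγ.continuousAt.tendsto
  have symm_γ0 : (extChartAt I p).symm (γ 0) = p := by rw [hγ0, extChartAt_to_inv]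
  refine ⟨symm_γ0, ?_, ?_⟩
  · rw [ContinuousAt, symm_γ0]
    have tendsto_symm_γ := (continuousAt_extChartAt_symm (I := I) p).tendsto.comp hγp
    rwa [extChartAt_to_inv] at tendsto_symm_γ
  · have hchart :
        HasDerivAt (F := E) (fun t => extChartAt I p ((extChartAt I p).symm (γ t))) v 0 := by
      refine hγ.congr_of_eventuallyEq ?_
      filter_upwards [hγp (extChartAt_target_mem_nhds p)] with t ht
      exact (extChartAt I p).right_inv ht
    simp only [symm_γ0, writtenInExtChartAt]
    exact hchart.hasFDerivAt.hasFDerivWithinAt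

end HasVelocity

variable {E'' : Type*} [NormedAddCommGroup E''] [NormedSpace ℝ E''] {H'' : Type*}
  [TopologicalSpace H''] {I'' : ModelWithCorners ℝ E'' H''} {N'' : Type*} [TopologicalSpace N'']
  [ChartedSpace H'' N'']

theorem exists_hasDerivAt_of_mem_ker [CompleteSpace E] [FiniteDimensional ℝ E'] {F : E → E'}
    {D : E →L[ℝ] E'} {a : E} (hF : HasStrictFDerivAt F D a) (hD : Function.Surjective D) {v : E}
    (hv : D v = 0) :
    ∃ γ : ℝ → E, γ 0 = a ∧ HasDerivAt γ v 0 ∧ ∀ᶠ t in 𝓝 0, F (γ t) = F a := by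
  have range_eq_top : D.range = ⊤ := LinearMap.range_eq_top.2 hD
  let κ : D.ker := ⟨v, hv⟩
  refine ⟨fun t => hF.implicitFunction F D range_eq_top (F a) (t • κ), ?_, ?_, ?_⟩
  · simp only [zero_smul, HasStrictFDerivAt.implicitFunction_apply_image]
  · have hasDerivAt_line : HasDerivAt (fun t : ℝ => t • κ) κ 0 := by
      simpa using (hasDerivAt_id (0 : ℝ)).smul_const κ
    exact (hF.to_implicitFunction range_eq_top).hasFDerivAt.comp_hasDerivAt_of_eq 0 hasDerivAt_line
      (zero_smul ℝ κ).symm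
  · have tendsto_line : Filter.Tendsto (fun t : ℝ => (F a, t • κ)) (𝓝 0) (𝓝 (F a, 0)) :=
      (show Continuous fun t : ℝ => (F a, t • κ) by fun_prop).tendsto' 0 _ (by simp)
    exact tendsto_line.eventually (hF.map_implicitFunction_eq range_eq_top)

theorem hasStrictFDerivAt_writtenInExtChartAt [I.Boundaryless]
    {f : N → N'} {p : N} (hf : ContMDiffAt I I' 1 f p) :
    HasStrictFDerivAt (E := E) (F := E') (writtenInExtChartAt I I' p f)
      (mfderiv I I' f p) (extChartAt I p p) := by
  have contDiffAt := (contMDiffAt_iff.1 hf).2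
  rw [I.range_eq_univ, contDiffWithinAt_univ] at contDiffAt
  have mfderiv_eq : (mfderiv I I' f p : E →L[ℝ] E') =
      fderiv ℝ (writtenInExtChartAt I I' p f) (extChartAt I p p) := by
    rw [(hf.mdifferentiableAt one_ne_zero).mfderiv, I.range_eq_univ]
    exact congrFun (fderivWithin_univ (𝕜 := ℝ) (E := E) (F := E')) _
  rw [mfderiv_eq]
  exact contDiffAt.hasStrictFDerivAt one_ne_zero

theorem exists_hasVelocity_fibreProduct [CompleteSpace E] [CompleteSpace E']
    [FiniteDimensional ℝ E''] [I.Boundaryless] [I'.Boundaryless]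
    {f : N → N''} {f' : N' → N''} {p : N} {p' : N'} (hf : ContMDiffAt I I'' 1 f p)
    (hf' : ContMDiffAt I' I'' 1 f' p') (hp : f p = f' p')
    (hsurj : Function.Surjective (mfderiv I I'' f p)) (v : TangentSpace I p)
    (v' : TangentSpace I' p')
    (hv : (mfderiv I I'' f p v : E'') = (mfderiv I' I'' f' p' v' : E'')) :
    ∃ (c : ℝ → N) (c' : ℝ → N'), HasVelocity I c p v ∧ HasVelocity I' c' p' v' ∧
      ∀ᶠ t in 𝓝 0, f (c t) = f' (c' t) := by
  let D : E →L[ℝ] E'' := mfderiv I I'' f p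
  let D' : E' →L[ℝ] E'' := mfderiv I' I'' f' p'
  -- The fibre product is, in the charts, the zero set of the submersion `difference`.
  let difference : E × E' → E'' := fun x =>
    writtenInExtChartAt I I'' p f x.1 - writtenInExtChartAt I' I'' p' f' x.2
  let a : E × E' := (extChartAt I p p, extChartAt I' p' p')
  have hasStrictFDerivAt_difference : HasStrictFDerivAt difference
      (D.comp (ContinuousLinearMap.fst ℝ E E') - D'.comp (ContinuousLinearMap.snd ℝ E E')) a :=
    (HasStrictFDerivAt.comp a (g := writtenInExtChartAt I I'' p f)
      (hasStrictFDerivAt_writtenInExtChartAt hf) hasStrictFDerivAt_fst).sub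
    (HasStrictFDerivAt.comp a (g := writtenInExtChartAt I' I'' p' f')
      (hasStrictFDerivAt_writtenInExtChartAt hf') hasStrictFDerivAt_snd)
  have difference_a : difference a = 0 := by simp [difference, a, writtenInExtChartAt, hp]
  obtain ⟨γ, hγ0, hγ, hγ_zero⟩ := exists_hasDerivAt_of_mem_ker hasStrictFDerivAt_difference
    (fun y => (hsurj y).imp' (fun x => ((x, 0) : E × E')) fun x hx => by
      change D x - D' 0 = y
      rw [map_zero, sub_zero]
      exact hx)
    (v := (v, v')) (sub_eq_zero.2 hv)
  have hc : HasVelocity I (fun t => (extChartAt I p).symm (γ t).1) p v :=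
    HasVelocity.extChartAt_symm_comp hγ.fst (congrArg Prod.fst hγ0)
  have hc' : HasVelocity I' (fun t => (extChartAt I' p').symm (γ t).2) p' v' :=
    HasVelocity.extChartAt_symm_comp hγ.snd (congrArg Prod.snd hγ0)
  refine ⟨_, _, hc, hc', ?_⟩
  filter_upwards [hγ_zero,
    hf.continuousAt.tendsto.comp hc.tendsto (extChartAt_source_mem_nhds (I := I'') (f p)),
    hf'.continuousAt.tendsto.comp hc'.tendsto (extChartAt_source_mem_nhds (I := I'') (f' p'))]
    with t ht hfc hfc'
  rw [difference_a, sub_eq_zero] at ht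
  simp only [writtenInExtChartAt, Function.comp_apply] at ht
  rw [← hp] at ht hfc'
  exact (extChartAt I'' (f p)).injOn hfc hfc' ht

theorem exists_hasVelocity_fibre [CompleteSpace E] [FiniteDimensional ℝ E''] [I.Boundaryless]
    {f : N → N''} {p : N} (hf : ContMDiffAt I I'' 1 f p)
    (hsurj : Function.Surjective (mfderiv I I'' f p)) (v : TangentSpace I p)
    (hv : mfderiv I I'' f p v = 0) :
    ∃ c : ℝ → N, HasVelocity I c p v ∧ ∀ᶠ t in 𝓝 0, f (c t) = f p := by
  obtain ⟨c, _, hc, _, hfc⟩ := exists_hasVelocity_fibreProduct (I' := I) (p' := p)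
    (f' := fun _ : N => f p) hf contMDiffAt_const rfl hsurj v 0
    (by rw [map_zero]; exact hv)
  exact ⟨c, hc, hfc⟩

end Velocity

section SmoothVelocity

variable {E : Type*} [NormedAddCommGroup E] [NormedSpace ℝ E] {H : Type*} [TopologicalSpace H]
  {I : ModelWithCorners ℝ E H} {P : Type*} [TopologicalSpace P] [ChartedSpace H P]
  {E' : Type*} [NormedAddCommGroup E'] [NormedSpace ℝ E'] {H' : Type*} [TopologicalSpace H']
  {I' : ModelWithCorners ℝ E' H'} {Q : Type*} [TopologicalSpace Q] [ChartedSpace H' Q]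

theorem exists_hasDerivAt_comp_of_hasVelocity [IsManifold I ∞ P] {m : ℕ} {f : P → Q} {s : Set P}
    {p₀ : P} (hp₀ : p₀ ∈ s) (hf : ContMDiffWithinAt I I' (m + 1) f s p₀) :
    ∃ D : P → E →L[ℝ] E', ContMDiffWithinAt I 𝓘(ℝ, E →L[ℝ] E') m D s p₀ ∧
      ∀ᶠ p in 𝓝[s] p₀, ∀ (c : ℝ → P) (v : TangentSpace I p), HasVelocity I c p v →
        (∀ᶠ t in 𝓝 0, c t ∈ s) → HasDerivAt (fun t => extChartAt I' (f p₀) (f (c t)))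
          (D p (trivializationAt E (TangentSpace I) p₀ ⟨p, v⟩).2) 0 := by
  have : IsManifold I 1 P := .of_le (n := ∞) (by simp)
  let S : Set E := (extChartAt I p₀).symm ⁻¹' s ∩ Set.range I
  obtain ⟨u, hu, -, f', hf', hf'_smooth⟩ :=
    (contDiffWithinAt_succ_iff_hasFDerivWithinAt (by simp)).1 (contMDiffWithinAt_iff.1 hf).2
  have mem_S : extChartAt I p₀ p₀ ∈ S := ⟨by simpa using hp₀, Set.mem_range_self _⟩
  rw [Set.insert_eq_of_mem mem_S] at hu
  have mem_u : ∀ᶠ p in 𝓝[s] p₀, p ∈ (extChartAt I p₀).source ∧ extChartAt I p₀ p ∈ u := by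
    rw [← map_extChartAt_nhdsWithin (I := I) p₀] at hu
    exact Filter.Eventually.and (mem_nhdsWithin_of_mem_nhds (extChartAt_source_mem_nhds p₀)) hu
  refine ⟨fun p => f' (extChartAt I p₀ p), ?_, ?_⟩
  · have comp_smooth : ContMDiffWithinAt I 𝓘(ℝ, E →L[ℝ] E') m
        (fun p => f' (extChartAt I p₀ p)) (extChartAt I p₀ ⁻¹' u) p₀ :=
      hf'_smooth.contMDiffWithinAt.comp p₀ contMDiffAt_extChartAt.contMDiffWithinAt
        (Set.mapsTo_preimage _ _)
    exact comp_smooth.mono_of_mem_nhdsWithin (mem_u.mono fun _ => And.right)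
  filter_upwards [eventually_eventually_nhdsWithin.2 mem_u, mem_u] with p hpu ⟨hp, hp'⟩ c v hc hcs
  have eventually_mem_u : ∀ᶠ t in 𝓝 0, c t ∈ (extChartAt I p₀).source ∧ extChartAt I p₀ (c t) ∈ u :=
    (tendsto_nhdsWithin_iff.2 ⟨hc.tendsto, hcs⟩).eventually hpu
  rw [extChartAt_source] at hp
  have chain_rule := (hf' _ hp').comp_hasDerivWithinAt_of_eq (x := (0 : ℝ))
    (f := fun t => extChartAt I p₀ (c t))
    ((hc.hasDerivAt_extChartAt hp).hasDerivWithinAt (s := {t | extChartAt I p₀ (c t) ∈ u}))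
    (fun t ht => ht) (by simp only [hc.1])
  refine (chain_rule.hasDerivAt (eventually_mem_u.mono fun _ => And.right)).congr_of_eventuallyEq ?_
  filter_upwards [eventually_mem_u] with t ht
  simp only [Function.comp_apply, (extChartAt I p₀).left_inv ht.1]

variable {F : Type*} [NormedAddCommGroup F] [NormedSpace ℝ F] {K : Type*} [TopologicalSpace K]
  {J : ModelWithCorners ℝ F K} {N : Type*} [TopologicalSpace N] [ChartedSpace K N]

theorem contMDiffAt_of_hasVelocity [IsManifold I ∞ P] [IsManifold I' ∞ Q] {f : P → Q} {s : Set P}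
    (hf : ContMDiffOn I I' ∞ f s) {φ : N → P} {x₀ : N} (hφs : ∀ x, φ x ∈ s)
    {v : ∀ x, TangentSpace I (φ x)}
    (hv : ContMDiffAt J I.tangent ∞ (fun x => (⟨φ x, v x⟩ : TangentBundle I P)) x₀)
    {ψ : N → Q} (hψ : ∀ x, f (φ x) = ψ x) {w : ∀ x, TangentSpace I' (ψ x)}
    (hw : ∀ᶠ x in 𝓝 x₀, ∃ c : ℝ → P, HasVelocity I c (φ x) (v x) ∧ (∀ᶠ t in 𝓝 0, c t ∈ s) ∧
      HasVelocity I' (fun t => f (c t)) (ψ x) (w x)) :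
    ContMDiffAt J I'.tangent ∞ (fun x => (⟨ψ x, w x⟩ : TangentBundle I' Q)) x₀ := by
  obtain ⟨hφ, hv_snd⟩ := Bundle.contMDiffAt_totalSpace.1 hv
  have hf₀ := hf (φ x₀) (hφs x₀)
  have hψ_smooth : ContMDiffAt J I' ∞ ψ x₀ :=
    (funext hψ : f ∘ φ = ψ) ▸ hf₀.comp x₀ hφ.contMDiffWithinAt fun x _ => hφs x
  refine Bundle.contMDiffAt_totalSpace.2 ⟨hψ_smooth, contMDiffAt_infty.2 fun m => ?_⟩
  obtain ⟨D, hD, hasDerivAt_D⟩ := exists_hasDerivAt_comp_of_hasVelocity (m := m) (hφs x₀)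
    (hf₀.of_le (by exact_mod_cast le_top))
  have hDφ : ContMDiffAt J 𝓘(ℝ, E →L[ℝ] E') m (fun x => D (φ x)) x₀ :=
    hD.comp x₀ (hφ.of_le (by exact_mod_cast le_top)).contMDiffWithinAt fun x _ => hφs x
  refine (hDφ.clm_apply (hv_snd.of_le (by exact_mod_cast le_top))).congr_of_eventuallyEq ?_
  have hφ_tendsto : Filter.Tendsto φ (𝓝 x₀) (𝓝[s] (φ x₀)) :=
    tendsto_nhdsWithin_iff.2 ⟨hφ.continuousAt, Filter.Eventually.of_forall hφs⟩
  filter_upwards [hφ_tendsto.eventually hasDerivAt_D, hw,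
    hψ_smooth.continuousAt (extChartAt_source_mem_nhds (I := I') (ψ x₀))] with x hDx
    ⟨c, hc, hcs, hfc⟩ hx
  have hasDerivAt_w := hfc.hasDerivAt_extChartAt (p₀ := ψ x₀) (by rwa [extChartAt_source] at hx)
  rw [← hψ x₀] at hasDerivAt_w ⊢
  exact HasDerivAt.unique (F := E') hasDerivAt_w (hDx c (v x) hc hcs)

end SmoothVelocity

section SmoothFamily

variable {E : Type*} [NormedAddCommGroup E] [NormedSpace ℝ E] {H : Type*} [TopologicalSpace H]
  {I : ModelWithCorners ℝ E H} {P : Type*} [TopologicalSpace P] [ChartedSpace H P]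
  {F : Type*} [NormedAddCommGroup F] [NormedSpace ℝ F] {K : Type*} [TopologicalSpace K]
  {J : ModelWithCorners ℝ F K} {N : Type*} [TopologicalSpace N] [ChartedSpace K N]

theorem tangentBundle_mk_eq {p q : P} (h : p = q) (v : E) :
    (⟨p, v⟩ : TangentBundle I P) = ⟨q, v⟩ := by
  subst h
  rfl

variable [IsManifold I ∞ P]

variable (I) in
/-- The vector field near `p₀` which is constant in the chart at `p₀`. -/
noncomputable def chartVector (p₀ : P) (e : E) (p : P) : TangentSpace I p :=
  (trivializationAt E (TangentSpace I) p₀).symm p e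

theorem trivializationAt_chartVector {p₀ p : P} (hp : p ∈ (chartAt H p₀).source) (e : E) :
    (trivializationAt E (TangentSpace I) p₀ ⟨p, chartVector I p₀ e p⟩).2 = e :=
  congrArg Prod.snd ((trivializationAt E (TangentSpace I) p₀).apply_mk_symm hp e)

theorem chartVector_trivializationAt {p₀ p : P} (hp : p ∈ (chartAt H p₀).source)
    (v : TangentSpace I p) :
    chartVector I p₀ (trivializationAt E (TangentSpace I) p₀ ⟨p, v⟩).2 p = v :=
  (trivializationAt E (TangentSpace I) p₀).symm_apply_apply_mk hp v

theorem contMDiffAt_chartVector {p₀ : P} {φ : N → P} {x₀ : N} (hφ : ContMDiffAt J I ∞ φ x₀)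
    (hp : φ x₀ ∈ (chartAt H p₀).source) (e : E) :
    ContMDiffAt J I.tangent ∞ (fun x => (⟨φ x, chartVector I p₀ e (φ x)⟩ : TangentBundle I P))
      x₀ := by
  refine ((trivializationAt E (TangentSpace I) p₀).contMDiffAt_iff hp).2 ⟨hφ, ?_⟩
  refine (contMDiffAt_const (c := e)).congr_of_eventuallyEq ?_
  filter_upwards [hφ.continuousAt ((chartAt H p₀).open_source.mem_nhds hp)] with x hx
  exact trivializationAt_chartVector hx e

theorem contMDiffAt_tangent_sub {φ : N → P} {x₀ : N} {v w : ∀ x, TangentSpace I (φ x)}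
    (hv : ContMDiffAt J I.tangent ∞ (fun x => (⟨φ x, v x⟩ : TangentBundle I P)) x₀)
    (hw : ContMDiffAt J I.tangent ∞ (fun x => (⟨φ x, w x⟩ : TangentBundle I P)) x₀) :
    ContMDiffAt J I.tangent ∞ (fun x => (⟨φ x, v x - w x⟩ : TangentBundle I P)) x₀ := by
  obtain ⟨hφ, hv_snd⟩ := Bundle.contMDiffAt_totalSpace.1 hv
  obtain ⟨-, hw_snd⟩ := Bundle.contMDiffAt_totalSpace.1 hw
  refine Bundle.contMDiffAt_totalSpace.2 ⟨hφ, (hv_snd.sub hw_snd).congr_of_eventuallyEq ?_⟩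
  filter_upwards [hφ.continuousAt ((chartAt H (φ x₀)).open_source.mem_nhds
    (mem_chart_source H (φ x₀)))] with x hx
  exact ((trivializationAt E (TangentSpace I) (φ x₀)).linear ℝ hx).map_sub (v x) (w x)

theorem contMDiffAt_tangent_neg {φ : N → P} {x₀ : N} {v : ∀ x, TangentSpace I (φ x)}
    (hv : ContMDiffAt J I.tangent ∞ (fun x => (⟨φ x, v x⟩ : TangentBundle I P)) x₀) :
    ContMDiffAt J I.tangent ∞ (fun x => (⟨φ x, -v x⟩ : TangentBundle I P)) x₀ := by
  simpa using contMDiffAt_tangent_sub (contMDiffAt_tangent_sub hv hv) hv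

theorem contMDiffAt_mfderiv {E' H' P' : Type*} [NormedAddCommGroup E'] [NormedSpace ℝ E']
    [TopologicalSpace H'] {I' : ModelWithCorners ℝ E' H'} [TopologicalSpace P'] [ChartedSpace H' P']
    [IsManifold I' ∞ P'] {f : P → P'} (hf : ContMDiff I I' ∞ f) {φ : N → P} {x₀ : N}
    {v : ∀ x, TangentSpace I (φ x)}
    (hv : ContMDiffAt J I.tangent ∞ (fun x => (⟨φ x, v x⟩ : TangentBundle I P)) x₀) :
    ContMDiffAt J I'.tangent ∞
      (fun x => (⟨f (φ x), mfderiv I I' f (φ x) (v x)⟩ : TangentBundle I' P')) x₀ :=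
  ((hf.contMDiff_tangentMap (m := ∞) (by simp)).contMDiffAt
    (x := (⟨φ x₀, v x₀⟩ : TangentBundle I P))).comp x₀ hv

variable {ι : Type*}

open Classical in
variable (I) in
/-- The frame of the tangent bundle near `p₀` which is constant in the chart at `p₀`; its values
outside of the domain of that chart are irrelevant. -/
noncomputable def chartBasis (B : Module.Basis ι ℝ E) (p₀ p : P) :
    Module.Basis ι ℝ (TangentSpace I p) :=
  if hp : p ∈ (trivializationAt E (TangentSpace I) p₀).baseSet then
    B.map ((trivializationAt E (TangentSpace I) p₀).linearEquivAt ℝ p hp).symm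
  else
    B.map ((trivializationAt E (TangentSpace I) p).linearEquivAt ℝ p (mem_chart_source H p)).symm

theorem chartBasis_apply (B : Module.Basis ι ℝ E) {p₀ p : P} (hp : p ∈ (chartAt H p₀).source)
    (i : ι) : chartBasis I B p₀ p i = chartVector I p₀ (B i) p := by
  rw [chartBasis, dif_pos (c := p ∈ (trivializationAt E (TangentSpace I) p₀).baseSet) hp]
  rfl

variable [Fintype ι] [DecidableEq ι]

theorem chartBasis_det (B : Module.Basis ι ℝ E) {p₀ p : P} (hp : p ∈ (chartAt H p₀).source)
    (v : ι → TangentSpace I p) :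
    (chartBasis I B p₀ p).det v =
      B.det (fun i => (trivializationAt E (TangentSpace I) p₀ ⟨p, v i⟩).2) := by
  rw [chartBasis, dif_pos (c := p ∈ (trivializationAt E (TangentSpace I) p₀).baseSet) hp,
    Module.Basis.det_map]
  rfl

theorem contDiff_basis_det (B : Module.Basis ι ℝ E) :
    ContDiff ℝ ∞ (fun v : ι → E => B.det v) := by
  have : FiniteDimensional ℝ E := B.finiteDimensional_of_finite
  have contDiff_coord (i j : ι) : ContDiff ℝ ∞ fun v : ι → E => B.coord j (v i) :=
    (LinearMap.toContinuousLinearMap (B.coord j)).contDiff.comp (contDiff_apply ℝ E i)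
  simp only [Module.Basis.det_apply, Matrix.det_apply', Module.Basis.toMatrix_apply]
  exact ContDiff.sum fun σ _ =>
    contDiff_const.mul (contDiff_prod fun i _ => contDiff_coord i (σ i))

theorem contMDiffAt_chartBasis_det (B : Module.Basis ι ℝ E) {φ : N → P} {x₀ : N} {p₀ : P}
    (hp : φ x₀ = p₀) (hφ : ContMDiffAt J I ∞ φ x₀) {v : ∀ x, ι → TangentSpace I (φ x)}
    (hv : ∀ i, ContMDiffAt J I.tangent ∞ (fun x => (⟨φ x, v x i⟩ : TangentBundle I P)) x₀) :
    ContMDiffAt J 𝓘(ℝ, ℝ) ∞ (fun x => (chartBasis I B p₀ (φ x)).det (v x)) x₀ := by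
  subst hp
  have contMDiffAt_coordinates : ContMDiffAt J 𝓘(ℝ, ι → E) ∞
      (fun x i => (trivializationAt E (TangentSpace I) (φ x₀) ⟨φ x, v x i⟩).2) x₀ :=
    contMDiffAt_pi_space.2 fun i => (Bundle.contMDiffAt_totalSpace.1 (hv i)).2
  refine ((contDiff_basis_det B).contMDiff.contMDiffAt.comp x₀
    contMDiffAt_coordinates).congr_of_eventuallyEq ?_
  filter_upwards [hφ.continuousAt ((chartAt H (φ x₀)).open_source.mem_nhds
    (mem_chart_source H (φ x₀)))] with x hx
  exact chartBasis_det B hx _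

theorem exists_contMDiffAt_vector_eq (p₀ : P) (e : TangentSpace I p₀) :
    ∃ w : ∀ p, TangentSpace I p, w p₀ = e ∧
      ContMDiffAt I I.tangent ∞ (fun p => (⟨p, w p⟩ : TangentBundle I P)) p₀ :=
  ⟨chartVector I p₀ (trivializationAt E (TangentSpace I) p₀ ⟨p₀, e⟩).2,
    chartVector_trivializationAt (mem_chart_source H p₀) e,
    contMDiffAt_chartVector (φ := id) contMDiffAt_id (mem_chart_source H p₀) _⟩

/-- The ratio of the determinants of `(k, w)` and of `df(w)` is the same for all `w`, so it can be
computed with a smooth family. -/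
theorem contMDiffAt_chartBasis_det_sumElim {κ : Type*} [Fintype κ] [DecidableEq κ]
    [IsManifold J ∞ N] (B : Module.Basis (κ ⊕ ι) ℝ E) (C : Module.Basis ι ℝ F) {f : P → N}
    (hf : ContMDiff I J ∞ f) (hf_surj : ∀ p, Function.Surjective (mfderiv I J f p)) {p₀ : P}
    {k : ∀ p, κ → TangentSpace I p} (hk : ∀ p, LinearIndependent ℝ (k p))
    (hfk : ∀ p i, mfderiv I J f p (k p i) = 0)
    (k_smooth : ∀ i, ContMDiffAt I I.tangent ∞ (fun p => (⟨p, k p i⟩ : TangentBundle I P)) p₀)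
    {w : ∀ p, ι → TangentSpace I p} (hw : LinearIndependent ℝ (mfderiv I J f p₀ ∘ w p₀))
    (fw_smooth : ∀ j, ContMDiffAt I J.tangent ∞
      (fun p => (⟨f p, mfderiv I J f p (w p j)⟩ : TangentBundle J N)) p₀) :
    ContMDiffAt I 𝓘(ℝ, ℝ) ∞
      (fun p => (chartBasis I B p₀ p).det (Sum.elim (k p) (w p))) p₀ := by
  choose w' w'_p₀ w'_smooth using fun j => exists_contMDiffAt_vector_eq p₀ (w p₀ j)
  have contMDiffAt_det_w' : ContMDiffAt I 𝓘(ℝ, ℝ) ∞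
      (fun p => (chartBasis I B p₀ p).det (Sum.elim (k p) fun j => w' j p)) p₀ := by
    refine contMDiffAt_chartBasis_det (φ := fun p => p) B rfl contMDiffAt_id ?_
    rintro (i | j)
    · exact k_smooth i
    · exact w'_smooth j
  have contMDiffAt_det_fw := contMDiffAt_chartBasis_det C (φ := f) (x₀ := p₀) rfl hf.contMDiffAt
    (v := fun p j => mfderiv I J f p (w p j)) fw_smooth
  have contMDiffAt_det_fw' := contMDiffAt_chartBasis_det C (φ := f) (x₀ := p₀) rfl hf.contMDiffAt
    (v := fun p j => mfderiv I J f p (w' j p)) fun j => contMDiffAt_mfderiv hf (w'_smooth j)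
  have det_fw'_ne_zero :
      (chartBasis J C (f p₀) (f p₀)).det (fun j => mfderiv I J f p₀ (w' j p₀)) ≠ 0 := by
    simp only [w'_p₀]
    exact (linearIndependent_iff_basis_det_ne_zero _).1 hw
  refine ((contMDiffAt_det_w'.mul contMDiffAt_det_fw).div₀ contMDiffAt_det_fw'
    det_fw'_ne_zero).congr_of_eventuallyEq ?_
  filter_upwards [contMDiffAt_det_fw'.continuousAt.eventually_ne det_fw'_ne_zero] with p hp
  obtain ⟨c, -, hc⟩ := exists_det_sumElim_eq_mul_det (chartBasis I B p₀ p)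
    (chartBasis J C (f p₀) (f p)) (mfderiv I J f p).toLinearMap (hf_surj p) (hk p) (hfk p)
  simp only [Pi.mul_apply, Pi.div_apply]
  rw [hc, hc]
  exact eq_div_of_mul_eq hp (mul_right_comm _ _ _)

theorem contMDiffAt_tangent_prodMk {P' E' H' : Type*} [NormedAddCommGroup E'] [NormedSpace ℝ E']
    [TopologicalSpace H'] {I' : ModelWithCorners ℝ E' H'} [TopologicalSpace P'] [ChartedSpace H' P']
    [IsManifold I' ∞ P'] {φ : N → P} {φ' : N → P'} {x₀ : N} {v : ∀ x, TangentSpace I (φ x)}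
    {v' : ∀ x, TangentSpace I' (φ' x)}
    (hv : ContMDiffAt J I.tangent ∞ (fun x => (⟨φ x, v x⟩ : TangentBundle I P)) x₀)
    (hv' : ContMDiffAt J I'.tangent ∞ (fun x => (⟨φ' x, v' x⟩ : TangentBundle I' P')) x₀) :
    ContMDiffAt J (I.prod I').tangent ∞
      (fun x => (⟨(φ x, φ' x), (v x, v' x)⟩ : TangentBundle (I.prod I') (P × P'))) x₀ :=
  contMDiff_equivTangentBundleProd_symm.contMDiffAt.comp x₀ (hv.prodMk hv')

variable (P) in
theorem contMDiff_tangent_zero :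
    ContMDiff I I.tangent ∞ (fun p : P => (⟨p, 0⟩ : TangentBundle I P)) :=
  Bundle.contMDiff_zeroSection (IB := I) (F := E) ℝ (TangentSpace I : P → Type _)

end SmoothFamily

theorem contMDiffAt_log_comp {E H N : Type*} [NormedAddCommGroup E] [NormedSpace ℝ E]
    [TopologicalSpace H] {I : ModelWithCorners ℝ E H} [TopologicalSpace N] [ChartedSpace H N]
    {f : N → ℝ} {x : N} (hf : ContMDiffAt I 𝓘(ℝ, ℝ) ∞ f x) (hx : f x ≠ 0) :
    ContMDiffAt I 𝓘(ℝ, ℝ) ∞ (fun y => Real.log (f y)) x :=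
  (Real.contDiffAt_log.2 hx).contMDiffAt.comp x hf

/-! ### Signs -/

/-- The sign of a nonzero real number, as an element of `ℤ₂ = {±1}`; the value at `0` is `-1`. -/
noncomputable def signUnit (t : ℝ) : ℤˣ := if 0 < t then 1 else -1

theorem signUnit_eq_one_iff {t : ℝ} : signUnit t = 1 ↔ 0 < t := by
  unfold signUnit
  split_ifs with pos
  · simp only [pos]
  · simpa only [pos, iff_false] using by decide

theorem signUnit_mul {s t : ℝ} (hs : s ≠ 0) (ht : t ≠ 0) :
    signUnit (s * t) = signUnit s * signUnit t := by
  rcases hs.lt_or_gt with hs | hs <;> rcases ht.lt_or_gt with ht | ht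
  · simp [signUnit, mul_pos_of_neg_of_neg hs ht, hs.not_gt, ht.not_gt]
  · simp [signUnit, (mul_neg_of_neg_of_pos hs ht).not_gt, hs.not_gt, ht]
  · simp [signUnit, (mul_neg_of_pos_of_neg hs ht).not_gt, hs, ht.not_gt]
  · simp [signUnit, mul_pos hs ht, hs, ht]

theorem signUnit_div {s t : ℝ} (hs : s ≠ 0) (ht : t ≠ 0) :
    signUnit (s / t) = signUnit s / signUnit t := by
  rw [eq_div_iff_mul_eq', ← signUnit_mul (div_ne_zero hs ht) ht, div_mul_cancel₀ _ ht]

theorem signUnit_intCast (u : ℤˣ) : signUnit ((u : ℤ) : ℝ) = u := by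
  rcases Int.units_eq_one_or u with rfl | rfl <;> simp [signUnit]

theorem abs_mul_signUnit (t : ℝ) : |t| * ((signUnit t : ℤ) : ℝ) = t := by
  unfold signUnit
  split_ifs with pos
  · simp [abs_of_pos pos]
  · simp [abs_of_nonpos (not_lt.1 pos)]

theorem units_intCast_ne_zero (u : ℤˣ) : ((u : ℤ) : ℝ) ≠ 0 :=
  Int.cast_ne_zero.2 u.ne_zero

theorem exists_pos_eq_mul_iff {t : ℝ} (ht : t ≠ 0) {u : ℤˣ} :
    (∃ l : ℝ, 0 < l ∧ t = l * ((u : ℤ) : ℝ)) ↔ u = signUnit t := by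
  constructor
  · rintro ⟨l, hl, rfl⟩
    rw [signUnit_mul hl.ne' (units_intCast_ne_zero u), signUnit_eq_one_iff.2 hl, one_mul,
      signUnit_intCast]
  · rintro rfl
    exact ⟨|t|, abs_pos.2 ht, (abs_mul_signUnit t).symm⟩

theorem eventually_signUnit_eq {X : Type*} [TopologicalSpace X] {f : X → ℝ} {x : X}
    (hf : ContinuousAt f x) (hx : f x ≠ 0) : ∀ᶠ y in 𝓝 x, signUnit (f y) = signUnit (f x) := by
  rcases hx.lt_or_gt with neg | pos
  · filter_upwards [hf.eventually_lt_const neg] with y hy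
    simp only [signUnit, neg.not_gt, hy.not_gt, if_false]
  · filter_upwards [hf.eventually_const_lt pos] with y hy
    simp only [signUnit, pos, hy, if_true]

namespace OpenCover

variable {M : Type*} [TopologicalSpace M] {𝒰 𝒱 : OpenCover M}

/-! ### Functions on the members of a cover -/

/-- The member of the coarser cover `𝒰` chosen by `refineMap` to contain the member `V` of `𝒱`. -/
noncomputable def refineIndex (h : 𝒰 ≤ 𝒱) (V : 𝒱.sets) : 𝒰.sets :=
  ⟨(h V.1 V.2).choose, (h V.1 V.2).choose_spec.1⟩

theorem le_refineIndex (h : 𝒰 ≤ 𝒱) (V : 𝒱.sets) : V.1 ≤ (refineIndex h V).1 :=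
  (h V.1 V.2).choose_spec.2

theorem eventually_fst_eq (q : 𝒰.Total) : ∀ᶠ p in 𝓝 q, p.1 = q.1 := by
  obtain ⟨U, x⟩ := q
  rw [Sigma.nhds_mk, Filter.eventually_map]
  exact Filter.Eventually.of_forall fun _ => rfl

theorem isLocallyConstant_iff {A : Type*} {F : 𝒰.sets → M → A} :
    IsLocallyConstant (fun q : 𝒰.Total => F q.1 (𝒰.proj q)) ↔
      ∀ U : 𝒰.sets, ∀ x ∈ U.1, ∀ᶠ y in 𝓝 x, F U y = F U x := by
  rw [IsLocallyConstant.iff_eventually_eq, Sigma.forall]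
  refine forall_congr' fun U => Subtype.forall.trans (forall₂_congr fun x hx => ?_)
  rw [Sigma.nhds_mk, Filter.eventually_map, ← map_nhds_subtype_coe_eq_nhds hx
    (U.1.isOpen.mem_nhds hx), Filter.eventually_map]
  rfl

end OpenCover

namespace GroupoidOver

variable {M G : Type*} (𝒢 : GroupoidOver M G) {g h k : G}

theorem inv_mul_cancel_left (hgh : 𝒢.src g = 𝒢.tgt h) : 𝒢.mul (𝒢.inv g) (𝒢.mul g h) = h := by
  rw [← 𝒢.mul_assoc _ _ _ (𝒢.src_inv g) hgh, 𝒢.inv_mul, hgh, 𝒢.unit_mul]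

theorem mul_inv_cancel_right (hgh : 𝒢.src g = 𝒢.tgt h) : 𝒢.mul (𝒢.mul g h) (𝒢.inv h) = g := by
  rw [𝒢.mul_assoc _ _ _ hgh (𝒢.tgt_inv h).symm, 𝒢.mul_inv, ← hgh, 𝒢.mul_unit]

theorem src_mul_inv (hgh : 𝒢.src g = 𝒢.src h) : 𝒢.src (𝒢.mul g (𝒢.inv h)) = 𝒢.tgt h := by
  rw [𝒢.src_mul _ _ (by rw [hgh, 𝒢.tgt_inv]), 𝒢.src_inv]

theorem tgt_mul_inv (hgh : 𝒢.src g = 𝒢.src h) : 𝒢.tgt (𝒢.mul g (𝒢.inv h)) = 𝒢.tgt g :=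
  𝒢.tgt_mul _ _ (by rw [hgh, 𝒢.tgt_inv])

theorem mul_inv_mul_mul (hgk : 𝒢.src g = 𝒢.src k) (hkh : 𝒢.src k = 𝒢.tgt h) :
    𝒢.mul (𝒢.mul g (𝒢.inv k)) (𝒢.mul k h) = 𝒢.mul g h := by
  rw [𝒢.mul_assoc _ _ _ (by rw [hgk, 𝒢.tgt_inv]) (by rw [𝒢.src_inv, 𝒢.tgt_mul _ _ hkh]),
    𝒢.inv_mul_cancel_left hkh]

theorem inv_inv (g : G) : 𝒢.inv (𝒢.inv g) = g := by
  have cancel := 𝒢.inv_mul_cancel_left (𝒢.src_inv g)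
  rwa [𝒢.inv_mul, ← 𝒢.tgt_inv, ← 𝒢.src_inv (𝒢.inv g), 𝒢.mul_unit] at cancel

theorem inv_unit (x : M) : 𝒢.inv (𝒢.unit x) = 𝒢.unit x := by
  have mul_unit_eq := 𝒢.mul_unit (𝒢.inv (𝒢.unit x))
  have inv_mul_eq := 𝒢.inv_mul (𝒢.unit x)
  rw [𝒢.src_inv, 𝒢.tgt_unit] at mul_unit_eq
  rw [𝒢.src_unit] at inv_mul_eq
  exact mul_unit_eq.symm.trans inv_mul_eq

end GroupoidOver

namespace LieGroupoid

variable {n r : ℕ} {M G : Type*}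
  [TopologicalSpace M] [ChartedSpace (EuclideanSpace ℝ (Fin n)) M]
  [TopologicalSpace G] [ChartedSpace (EuclideanSpace ℝ (Fin (r + n))) G]

section Translations

variable (𝒢 : LieGroupoid n r M G)

theorem mdifferentiableAt_src (g : G) : MDifferentiableAt (𝓡 (r + n)) (𝓡 n) 𝒢.src g :=
  𝒢.contMDiff_src.mdifferentiableAt (by simp)

theorem mdifferentiableAt_tgt (g : G) : MDifferentiableAt (𝓡 (r + n)) (𝓡 n) 𝒢.tgt g :=
  𝒢.contMDiff_tgt.mdifferentiableAt (by simp)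

theorem mdifferentiableAt_inv (g : G) : MDifferentiableAt (𝓡 (r + n)) (𝓡 (r + n)) 𝒢.inv g :=
  𝒢.contMDiff_inv.mdifferentiableAt (by simp)

theorem mdifferentiableWithinAt_mul {g h : G} (hgh : 𝒢.src g = 𝒢.tgt h) :
    MDifferentiableWithinAt ((𝓡 (r + n)).prod (𝓡 (r + n))) (𝓡 (r + n))
      (fun p : G × G => 𝒢.mul p.1 p.2) {p | 𝒢.src p.1 = 𝒢.tgt p.2} (g, h) :=
  (𝒢.contMDiffOn_mul (g, h) hgh).mdifferentiableWithinAt (by simp)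

theorem exists_section_eq {x : M} (a : 𝒢.algebroidFibre x) :
    ∃ α : ∀ y, 𝒢.algebroidFibre y, α x = a := by
  classical exact ⟨fun y => if h : x = y then h ▸ a else 0, dif_pos rfl⟩

/-! ### Translations and the derivative of the multiplication -/

/-- The derivative of the multiplication at a pair of composable arrows. It is meaningful on the
vectors tangent to the set of pairs of composable arrows. -/
noncomputable def mulDeriv (g h : G) :
    (TangentSpace (𝓡 (r + n)) g × TangentSpace (𝓡 (r + n)) h) →ₗ[ℝ]
      TangentSpace (𝓡 (r + n)) (𝒢.mul g h) :=
  (mfderivWithin ((𝓡 (r + n)).prod (𝓡 (r + n))) (𝓡 (r + n)) (fun p : G × G => 𝒢.mul p.1 p.2)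
    {p | 𝒢.src p.1 = 𝒢.tgt p.2} (g, h)).toLinearMap

variable {𝒢}

theorem hasVelocity_mul {g h : G} (hgh : 𝒢.src g = 𝒢.tgt h) {c c' : ℝ → G}
    {ξ : TangentSpace (𝓡 (r + n)) g} {η : TangentSpace (𝓡 (r + n)) h}
    (hc : HasVelocity (𝓡 (r + n)) c g ξ) (hc' : HasVelocity (𝓡 (r + n)) c' h η)
    (hcc' : ∀ᶠ t in 𝓝 0, 𝒢.src (c t) = 𝒢.tgt (c' t)) :
    HasVelocity (𝓡 (r + n)) (fun t => 𝒢.mul (c t) (c' t)) (𝒢.mul g h) (𝒢.mulDeriv g h (ξ, η)) :=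
  (hc.prodMk hc').mfderivWithin (f := fun p : G × G => 𝒢.mul p.1 p.2)
    (s := {p | 𝒢.src p.1 = 𝒢.tgt p.2}) (𝒢.mdifferentiableWithinAt_mul hgh) hcc'

theorem exists_hasVelocity_algebroidFibre (x : M) (a : 𝒢.algebroidFibre x) :
    ∃ c : ℝ → G, HasVelocity (𝓡 (r + n)) c (𝒢.unit x) a.1 ∧ ∀ᶠ t in 𝓝 0, 𝒢.src (c t) = x := by
  obtain ⟨c, hc, hcs⟩ := exists_hasVelocity_fibre (p := 𝒢.unit x)
    ((𝒢.contMDiff_src (𝒢.unit x)).of_le (m := 1) (by simp)) (𝒢.surjective_mfderiv_src _) a.1 a.2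
  exact ⟨c, hc, by simpa only [𝒢.src_unit] using hcs⟩

/-- The vectors of `A` are values of a section, so that they can be compared at points which are
equal only propositionally. -/
theorem hasVelocity_rightTranslation {g : G} {y : M} (hy : 𝒢.tgt g = y)
    (a : ∀ x, 𝒢.algebroidFibre x) {c : ℝ → G} (hc : HasVelocity (𝓡 (r + n)) c (𝒢.unit y) (a y).1)
    (hcy : ∀ᶠ t in 𝓝 0, 𝒢.src (c t) = y) :
    HasVelocity (𝓡 (r + n)) (fun t => 𝒢.mul (c t) g) g (𝒢.rightTranslation g (a (𝒢.tgt g))) := by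
  subst hy
  have mdifferentiable : MDifferentiableWithinAt (𝓡 (r + n)) (𝓡 (r + n)) (fun h => 𝒢.mul h g)
      (𝒢.src ⁻¹' {𝒢.tgt g}) (𝒢.unit (𝒢.tgt g)) :=
    MDifferentiableWithinAt.comp (f := fun h => (h, g)) _
      (𝒢.mdifferentiableWithinAt_mul (𝒢.src_unit _))
      (mdifferentiableAt_id.prodMk mdifferentiableAt_const).mdifferentiableWithinAt fun _ => id
  exact (hc.mfderivWithin mdifferentiable hcy).of_eq (𝒢.unit_mul g)

theorem hasVelocity_leftTranslation {g : G} {x : M} (hx : 𝒢.src g = x)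
    (b : ∀ x, 𝒢.algebroidFibre x) {c : ℝ → G} (hc : HasVelocity (𝓡 (r + n)) c (𝒢.unit x) (b x).1)
    (hcx : ∀ᶠ t in 𝓝 0, 𝒢.src (c t) = x) :
    HasVelocity (𝓡 (r + n)) (fun t => 𝒢.mul g (𝒢.inv (c t))) g
      (-𝒢.leftTranslation g (b (𝒢.src g))) := by
  subst hx
  have mdifferentiable : MDifferentiableWithinAt (𝓡 (r + n)) (𝓡 (r + n))
      (fun h => 𝒢.mul g (𝒢.inv h)) (𝒢.src ⁻¹' {𝒢.src g}) (𝒢.unit (𝒢.src g)) :=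
    MDifferentiableWithinAt.comp (f := fun h => (g, 𝒢.inv h)) _
      (𝒢.mdifferentiableWithinAt_mul (by rw [𝒢.tgt_inv, 𝒢.src_unit]))
      (mdifferentiableAt_const.prodMk (𝒢.mdifferentiableAt_inv _)).mdifferentiableWithinAt
      fun h hh => ((𝒢.tgt_inv h).trans hh).symm
  have neg_leftTranslation : -𝒢.leftTranslation g (b (𝒢.src g)) =
      (mfderivWithin (𝓡 (r + n)) (𝓡 (r + n)) (fun h => 𝒢.mul g (𝒢.inv h))
        (𝒢.src ⁻¹' {𝒢.src g}) (𝒢.unit (𝒢.src g)) (b (𝒢.src g)).1 :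
          EuclideanSpace ℝ (Fin (r + n))) :=
    neg_neg (G := EuclideanSpace ℝ (Fin (r + n))) _
  rw [neg_leftTranslation]
  exact (hc.mfderivWithin mdifferentiable hcx).of_eq (q := g)
    (by simp only [𝒢.inv_unit, 𝒢.mul_unit])

theorem mfderiv_src_rightTranslation (g : G) (a : 𝒢.algebroidFibre (𝒢.tgt g)) :
    mfderiv (𝓡 (r + n)) (𝓡 n) 𝒢.src g (𝒢.rightTranslation g a) = 0 := by
  obtain ⟨α, rfl⟩ := 𝒢.exists_section_eq a
  obtain ⟨c, hc, hcs⟩ := exists_hasVelocity_algebroidFibre _ (α (𝒢.tgt g))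
  exact (hasVelocity_rightTranslation rfl α hc hcs).mfderiv_eq_zero (𝒢.mdifferentiableAt_src g)
    (hcs.mono fun t ht => 𝒢.src_mul _ _ ht)

theorem mfderiv_tgt_leftTranslation (g : G) (b : 𝒢.algebroidFibre (𝒢.src g)) :
    mfderiv (𝓡 (r + n)) (𝓡 n) 𝒢.tgt g (𝒢.leftTranslation g b) = 0 := by
  obtain ⟨β, rfl⟩ := 𝒢.exists_section_eq b
  obtain ⟨c, hc, hcs⟩ := exists_hasVelocity_algebroidFibre _ (β (𝒢.src g))
  have mfderiv_neg := (hasVelocity_leftTranslation rfl β hc hcs).mfderiv_eq_zero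
    (𝒢.mdifferentiableAt_tgt g) (hcs.mono fun t ht => 𝒢.tgt_mul_inv ht.symm)
  rwa [map_neg, neg_eq_zero] at mfderiv_neg

theorem rightTranslation_injective (g : G) : Function.Injective (𝒢.rightTranslation g) := by
  refine (injective_iff_map_eq_zero _).2 fun a ha => ?_
  obtain ⟨α, rfl⟩ := 𝒢.exists_section_eq a
  obtain ⟨c, hc, hcs⟩ := exists_hasVelocity_algebroidFibre _ (α (𝒢.tgt g))
  have hcg := hasVelocity_rightTranslation rfl α hc hcs
  rw [show 𝒢.rightTranslation g (α (𝒢.tgt g)) = 0 from ha] at hcg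
  have hcgg := hasVelocity_mul (𝒢.tgt_inv g).symm hcg (HasVelocity.const (𝒢.inv g))
    (hcs.mono fun t ht => by rw [𝒢.src_mul _ _ ht, 𝒢.tgt_inv])
  rw [show 𝒢.mulDeriv g (𝒢.inv g) (0, 0) = 0 from map_zero _] at hcgg
  exact Subtype.ext (hc.unique ((HasVelocity.of_eq hcgg (𝒢.mul_inv g)).congr
    (hcs.mono fun t ht => 𝒢.mul_inv_cancel_right ht)))

theorem leftTranslation_injective (g : G) : Function.Injective (𝒢.leftTranslation g) := by
  refine (injective_iff_map_eq_zero _).2 fun b hb => ?_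
  obtain ⟨β, rfl⟩ := 𝒢.exists_section_eq b
  obtain ⟨c, hc, hcs⟩ := exists_hasVelocity_algebroidFibre _ (β (𝒢.src g))
  have hgc := hasVelocity_leftTranslation rfl β hc hcs
  rw [show 𝒢.leftTranslation g (β (𝒢.src g)) = 0 from hb, neg_zero] at hgc
  have hggc := hasVelocity_mul (𝒢.src_inv g) (HasVelocity.const (𝒢.inv g)) hgc
    (hcs.mono fun t ht => by rw [𝒢.src_inv, 𝒢.tgt_mul_inv ht.symm])
  rw [show 𝒢.mulDeriv (𝒢.inv g) g (0, 0) = 0 from map_zero _] at hggc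
  have hinv := hggc.mfderiv (𝒢.mdifferentiableAt_inv _)
  rw [map_zero] at hinv
  have hc_zero : HasVelocity (𝓡 (r + n)) c (𝒢.unit (𝒢.src g)) 0 :=
    HasVelocity.of_eq (hinv.congr (hcs.mono fun t ht => by
      simp only [𝒢.inv_mul_cancel_left (show 𝒢.src g = 𝒢.tgt (𝒢.inv (c t)) by rw [𝒢.tgt_inv, ht]),
        𝒢.inv_inv])) (by rw [𝒢.inv_mul, 𝒢.inv_unit])
  exact Subtype.ext (hc.unique hc_zero)

theorem mulDeriv_rightTranslation {g h : G} (hgh : 𝒢.src g = 𝒢.tgt h)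
    (a : ∀ x, 𝒢.algebroidFibre x) :
    𝒢.mulDeriv g h (𝒢.rightTranslation g (a (𝒢.tgt g)), 0) =
      𝒢.rightTranslation (𝒢.mul g h) (a (𝒢.tgt (𝒢.mul g h))) := by
  obtain ⟨c, hc, hcs⟩ := exists_hasVelocity_algebroidFibre _ (a (𝒢.tgt g))
  have hcgh := hasVelocity_mul hgh (hasVelocity_rightTranslation rfl a hc hcs)
    (HasVelocity.const h) (hcs.mono fun t ht => by rw [𝒢.src_mul _ _ ht, hgh])
  exact (hcgh.congr (hcs.mono fun t ht => 𝒢.mul_assoc _ _ _ ht hgh)).unique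
    (hasVelocity_rightTranslation (𝒢.tgt_mul g h hgh) a hc hcs)

theorem mulDeriv_leftTranslation {g h : G} (hgh : 𝒢.src g = 𝒢.tgt h)
    (b : ∀ x, 𝒢.algebroidFibre x) :
    𝒢.mulDeriv g h (0, 𝒢.leftTranslation h (b (𝒢.src h))) =
      𝒢.leftTranslation (𝒢.mul g h) (b (𝒢.src (𝒢.mul g h))) := by
  obtain ⟨c, hc, hcs⟩ := exists_hasVelocity_algebroidFibre _ (b (𝒢.src h))
  have hghc := hasVelocity_mul hgh (HasVelocity.const g) (hasVelocity_leftTranslation rfl b hc hcs)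
    (hcs.mono fun t ht => by rw [𝒢.tgt_mul_inv ht.symm, hgh])
  have mulDeriv_neg := (hghc.congr (hcs.mono fun t ht =>
    (𝒢.mul_assoc g h _ hgh (by rw [𝒢.tgt_inv, ht])).symm)).unique
    (hasVelocity_leftTranslation (𝒢.src_mul g h hgh) b hc hcs)
  rw [← neg_zero, ← Prod.neg_mk, map_neg] at mulDeriv_neg
  exact neg_injective mulDeriv_neg

theorem mulDeriv_neg_leftTranslation_rightTranslation {g h : G} (hgh : 𝒢.src g = 𝒢.tgt h)
    (a : ∀ x, 𝒢.algebroidFibre x) :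
    𝒢.mulDeriv g h (-𝒢.leftTranslation g (a (𝒢.src g)),
      𝒢.rightTranslation h (a (𝒢.tgt h))) = 0 := by
  obtain ⟨c, hc, hcs⟩ := exists_hasVelocity_algebroidFibre _ (a (𝒢.tgt h))
  have hgcch := hasVelocity_mul hgh (hasVelocity_leftTranslation hgh a hc hcs)
    (hasVelocity_rightTranslation rfl a hc hcs) (hcs.mono fun t ht => by
      rw [𝒢.src_mul_inv (hgh.trans ht.symm), 𝒢.tgt_mul _ _ ht])
  exact (hgcch.congr (hcs.mono fun t ht => 𝒢.mul_inv_mul_mul (hgh.trans ht.symm) ht)).unique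
    (HasVelocity.const (𝒢.mul g h))

variable (𝒢) in
/-- The tangent space at `(g, h)` to the space of pairs of composable arrows. The vectors
`d src (ξ)` and `d tgt (η)`, tangent to `M` at `src g` and `tgt h`, are compared in the model space.
-/
noncomputable def composableTangent (g h : G) :
    Submodule ℝ (TangentSpace (𝓡 (r + n)) g × TangentSpace (𝓡 (r + n)) h) :=
  LinearMap.eqLocus (M₂ := EuclideanSpace ℝ (Fin n))
    ((mfderiv (𝓡 (r + n)) (𝓡 n) 𝒢.src g).toLinearMap ∘ₗ LinearMap.fst ℝ _ _)
    ((mfderiv (𝓡 (r + n)) (𝓡 n) 𝒢.tgt h).toLinearMap ∘ₗ LinearMap.snd ℝ _ _)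

theorem mk_mem_composableTangent {g h : G} {ξ : TangentSpace (𝓡 (r + n)) g}
    {η : TangentSpace (𝓡 (r + n)) h} : (ξ, η) ∈ 𝒢.composableTangent g h ↔
      (mfderiv (𝓡 (r + n)) (𝓡 n) 𝒢.src g ξ : EuclideanSpace ℝ (Fin n)) =
        (mfderiv (𝓡 (r + n)) (𝓡 n) 𝒢.tgt h η : EuclideanSpace ℝ (Fin n)) :=
  Iff.rfl

theorem exists_hasVelocity_of_mem_composableTangent {g h : G} (hgh : 𝒢.src g = 𝒢.tgt h)
    {ξ : TangentSpace (𝓡 (r + n)) g} {η : TangentSpace (𝓡 (r + n)) h}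
    (hξη : (ξ, η) ∈ 𝒢.composableTangent g h) :
    ∃ c c' : ℝ → G, HasVelocity (𝓡 (r + n)) c g ξ ∧ HasVelocity (𝓡 (r + n)) c' h η ∧
      ∀ᶠ t in 𝓝 0, 𝒢.src (c t) = 𝒢.tgt (c' t) :=
  exists_hasVelocity_fibreProduct ((𝒢.contMDiff_src g).of_le (by simp))
    ((𝒢.contMDiff_tgt h).of_le (by simp)) hgh (𝒢.surjective_mfderiv_src g) ξ η hξη

theorem mfderiv_src_mulDeriv {g h : G} (hgh : 𝒢.src g = 𝒢.tgt h)
    {ξ : TangentSpace (𝓡 (r + n)) g} {η : TangentSpace (𝓡 (r + n)) h}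
    (hξη : (ξ, η) ∈ 𝒢.composableTangent g h) :
    (mfderiv (𝓡 (r + n)) (𝓡 n) 𝒢.src (𝒢.mul g h) (𝒢.mulDeriv g h (ξ, η)) :
      EuclideanSpace ℝ (Fin n)) = mfderiv (𝓡 (r + n)) (𝓡 n) 𝒢.src h η := by
  obtain ⟨c, c', hc, hc', hcc'⟩ := exists_hasVelocity_of_mem_composableTangent hgh hξη
  have hsrc := ((hasVelocity_mul hgh hc hc' hcc').mfderiv (𝒢.mdifferentiableAt_src _)).of_eq
    (𝒢.src_mul g h hgh)
  exact (hsrc.congr (hcc'.mono fun t ht => 𝒢.src_mul _ _ ht)).unique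
    (hc'.mfderiv (𝒢.mdifferentiableAt_src h))

theorem mfderiv_tgt_mulDeriv {g h : G} (hgh : 𝒢.src g = 𝒢.tgt h)
    {ξ : TangentSpace (𝓡 (r + n)) g} {η : TangentSpace (𝓡 (r + n)) h}
    (hξη : (ξ, η) ∈ 𝒢.composableTangent g h) :
    (mfderiv (𝓡 (r + n)) (𝓡 n) 𝒢.tgt (𝒢.mul g h) (𝒢.mulDeriv g h (ξ, η)) :
      EuclideanSpace ℝ (Fin n)) = mfderiv (𝓡 (r + n)) (𝓡 n) 𝒢.tgt g ξ := by
  obtain ⟨c, c', hc, hc', hcc'⟩ := exists_hasVelocity_of_mem_composableTangent hgh hξη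
  have htgt := ((hasVelocity_mul hgh hc hc' hcc').mfderiv (𝒢.mdifferentiableAt_tgt _)).of_eq
    (𝒢.tgt_mul g h hgh)
  exact (htgt.congr (hcc'.mono fun t ht => 𝒢.tgt_mul _ _ ht)).unique
    (hc.mfderiv (𝒢.mdifferentiableAt_tgt g))

theorem mfderiv_src_srcLift (g : G) (X : TangentSpace (𝓡 n) (𝒢.src g)) :
    mfderiv (𝓡 (r + n)) (𝓡 n) 𝒢.src g (𝒢.srcLift g X) = X :=
  LinearMap.congr_fun ((mfderiv (𝓡 (r + n)) (𝓡 n) 𝒢.src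
    g).toLinearMap.exists_rightInverse_of_surjective
      (LinearMap.range_eq_top.2 (𝒢.surjective_mfderiv_src g))).choose_spec X

theorem mfderiv_tgt_tgtLift (g : G) (Y : TangentSpace (𝓡 n) (𝒢.tgt g)) :
    mfderiv (𝓡 (r + n)) (𝓡 n) 𝒢.tgt g (𝒢.tgtLift g Y) = Y :=
  LinearMap.congr_fun ((mfderiv (𝓡 (r + n)) (𝓡 n) 𝒢.tgt
    g).toLinearMap.exists_rightInverse_of_surjective
      (LinearMap.range_eq_top.2 (𝒢.surjective_mfderiv_tgt g))).choose_spec Y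

end Translations

/-! ### Multiplicativity of the frame ratio -/

section Multiplicativity

variable {𝒢 : LieGroupoid n r M G}

theorem linearIndependent_rightTranslation (g : G)
    (a : Module.Basis (Fin r) ℝ (𝒢.algebroidFibre (𝒢.tgt g))) :
    LinearIndependent ℝ (𝒢.rightTranslation g ∘ a) :=
  a.linearIndependent.map' _ (LinearMap.ker_eq_bot.2 (rightTranslation_injective g))

theorem linearIndependent_leftTranslation (g : G)
    (b : Module.Basis (Fin r) ℝ (𝒢.algebroidFibre (𝒢.src g))) :
    LinearIndependent ℝ (𝒢.leftTranslation g ∘ b) :=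
  b.linearIndependent.map' _ (LinearMap.ker_eq_bot.2 (leftTranslation_injective g))

theorem mfderiv_src_comp_srcLift (g : G) (X : Fin n → TangentSpace (𝓡 n) (𝒢.src g)) :
    (mfderiv (𝓡 (r + n)) (𝓡 n) 𝒢.src g).toLinearMap ∘ 𝒢.srcLift g ∘ X = X :=
  funext fun j => mfderiv_src_srcLift g (X j)

theorem mfderiv_tgt_comp_tgtLift (g : G) (Y : Fin n → TangentSpace (𝓡 n) (𝒢.tgt g)) :
    (mfderiv (𝓡 (r + n)) (𝓡 n) 𝒢.tgt g).toLinearMap ∘ 𝒢.tgtLift g ∘ Y = Y :=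
  funext fun j => mfderiv_tgt_tgtLift g (Y j)

theorem det_rightTranslation_eq_of_lift (g : G)
    (B : Module.Basis (Fin r ⊕ Fin n) ℝ (TangentSpace (𝓡 (r + n)) g))
    (a : Module.Basis (Fin r) ℝ (𝒢.algebroidFibre (𝒢.tgt g)))
    (X : Module.Basis (Fin n) ℝ (TangentSpace (𝓡 n) (𝒢.src g)))
    (w : Fin n → TangentSpace (𝓡 (r + n)) g)
    (hw : ∀ j, mfderiv (𝓡 (r + n)) (𝓡 n) 𝒢.src g (w j) = X j) :
    B.det (Sum.elim (𝒢.rightTranslation g ∘ a) w) =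
      B.det (Sum.elim (𝒢.rightTranslation g ∘ a) (𝒢.srcLift g ∘ X)) :=
  det_sumElim_eq_of_comp_eq B X (mfderiv (𝓡 (r + n)) (𝓡 n) 𝒢.src g).toLinearMap
    (𝒢.surjective_mfderiv_src g) (linearIndependent_rightTranslation g a)
    (fun i => mfderiv_src_rightTranslation g (a i))
    ((funext hw).trans (mfderiv_src_comp_srcLift g X).symm)

theorem det_leftTranslation_eq_of_lift (g : G)
    (B : Module.Basis (Fin r ⊕ Fin n) ℝ (TangentSpace (𝓡 (r + n)) g))
    (b : Module.Basis (Fin r) ℝ (𝒢.algebroidFibre (𝒢.src g)))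
    (Y : Module.Basis (Fin n) ℝ (TangentSpace (𝓡 n) (𝒢.tgt g)))
    (w : Fin n → TangentSpace (𝓡 (r + n)) g)
    (hw : ∀ j, mfderiv (𝓡 (r + n)) (𝓡 n) 𝒢.tgt g (w j) = Y j) :
    B.det (Sum.elim (𝒢.leftTranslation g ∘ b) w) =
      B.det (Sum.elim (𝒢.leftTranslation g ∘ b) (𝒢.tgtLift g ∘ Y)) :=
  det_sumElim_eq_of_comp_eq B Y (mfderiv (𝓡 (r + n)) (𝓡 n) 𝒢.tgt g).toLinearMap
    (𝒢.surjective_mfderiv_tgt g) (linearIndependent_leftTranslation g b)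
    (fun i => mfderiv_tgt_leftTranslation g (b i))
    ((funext hw).trans (mfderiv_tgt_comp_tgtLift g Y).symm)

theorem det_rightTranslation_srcLift_ne_zero (g : G)
    (B : Module.Basis (Fin r ⊕ Fin n) ℝ (TangentSpace (𝓡 (r + n)) g))
    (a : Module.Basis (Fin r) ℝ (𝒢.algebroidFibre (𝒢.tgt g)))
    (X : Module.Basis (Fin n) ℝ (TangentSpace (𝓡 n) (𝒢.src g))) :
    B.det (Sum.elim (𝒢.rightTranslation g ∘ a) (𝒢.srcLift g ∘ X)) ≠ 0 :=
  det_sumElim_ne_zero_of_comp B (mfderiv (𝓡 (r + n)) (𝓡 n) 𝒢.src g).toLinearMap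
    (linearIndependent_rightTranslation g a) (fun i => mfderiv_src_rightTranslation g (a i))
    ((mfderiv_src_comp_srcLift g X).symm ▸ X.linearIndependent)

theorem det_leftTranslation_tgtLift_ne_zero (g : G)
    (B : Module.Basis (Fin r ⊕ Fin n) ℝ (TangentSpace (𝓡 (r + n)) g))
    (b : Module.Basis (Fin r) ℝ (𝒢.algebroidFibre (𝒢.src g)))
    (Y : Module.Basis (Fin n) ℝ (TangentSpace (𝓡 n) (𝒢.tgt g))) :
    B.det (Sum.elim (𝒢.leftTranslation g ∘ b) (𝒢.tgtLift g ∘ Y)) ≠ 0 :=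
  det_sumElim_ne_zero_of_comp B (mfderiv (𝓡 (r + n)) (𝓡 n) 𝒢.tgt g).toLinearMap
    (linearIndependent_leftTranslation g b) (fun i => mfderiv_tgt_leftTranslation g (b i))
    ((mfderiv_tgt_comp_tgtLift g Y).symm ▸ Y.linearIndependent)

theorem frameRatio_ne_zero (g : G)
    (b : Module.Basis (Fin r) ℝ (𝒢.algebroidFibre (𝒢.src g)))
    (X : Module.Basis (Fin n) ℝ (TangentSpace (𝓡 n) (𝒢.src g)))
    (a : Module.Basis (Fin r) ℝ (𝒢.algebroidFibre (𝒢.tgt g)))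
    (Y : Module.Basis (Fin n) ℝ (TangentSpace (𝓡 n) (𝒢.tgt g))) :
    𝒢.frameRatio g b X a Y ≠ 0 :=
  div_ne_zero (det_leftTranslation_tgtLift_ne_zero g _ b Y)
    (det_rightTranslation_srcLift_ne_zero g _ a X)

theorem frameRatio_eq_of_src (g : G)
    (b b' : Module.Basis (Fin r) ℝ (𝒢.algebroidFibre (𝒢.src g)))
    (X X' : Module.Basis (Fin n) ℝ (TangentSpace (𝓡 n) (𝒢.src g)))
    (a : Module.Basis (Fin r) ℝ (𝒢.algebroidFibre (𝒢.tgt g)))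
    (Y : Module.Basis (Fin n) ℝ (TangentSpace (𝓡 n) (𝒢.tgt g))) :
    𝒢.frameRatio g b X a Y = 𝒢.frameRatio g b' X' a Y * (b'.det b * X.det X') := by
  have det_eq_inv : X'.det X = (X.det X')⁻¹ :=
    eq_inv_of_mul_eq_one_left (basis_det_mul_det_symm X' X)
  unfold frameRatio
  rw [det_sumElim_left _ (𝒢.leftTranslation g) _ b' b, det_sumElim_right _ (𝒢.srcLift g) _ X' X,
    det_eq_inv, mul_div_mul_comm, div_inv_eq_mul]
  ring

instance finiteDimensional_tangentSpace (x : M) : FiniteDimensional ℝ (TangentSpace (𝓡 n) x) :=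
  inferInstanceAs (FiniteDimensional ℝ (EuclideanSpace ℝ (Fin n)))

theorem finrank_composableTangent (g h : G) :
    Module.finrank ℝ (𝒢.composableTangent g h) = Fintype.card (Fin r ⊕ (Fin r ⊕ Fin n)) := by
  have finrank_tangentSpace (g : G) : Module.finrank ℝ (TangentSpace (𝓡 (r + n)) g) = r + n :=
    finrank_euclideanSpace_fin
  let dsrc : TangentSpace (𝓡 (r + n)) g →ₗ[ℝ] EuclideanSpace ℝ (Fin n) :=
    (mfderiv (𝓡 (r + n)) (𝓡 n) 𝒢.src g).toLinearMap
  let dtgt : TangentSpace (𝓡 (r + n)) h →ₗ[ℝ] EuclideanSpace ℝ (Fin n) :=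
    (mfderiv (𝓡 (r + n)) (𝓡 n) 𝒢.tgt h).toLinearMap
  let difference := dsrc ∘ₗ LinearMap.fst ℝ _ _ - dtgt ∘ₗ LinearMap.snd ℝ _ _
  have range_eq_top : LinearMap.range difference = ⊤ := by
    refine LinearMap.range_eq_top.2 fun y => ?_
    obtain ⟨ξ, hξ : dsrc ξ = y⟩ := 𝒢.surjective_mfderiv_src g y
    exact ⟨(ξ, 0), by simp [difference, hξ]⟩
  have ker_eq : LinearMap.ker difference = 𝒢.composableTangent g h :=
    (LinearMap.eqLocus_eq_ker_sub _ _).symm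
  have rank_nullity := LinearMap.finrank_range_add_finrank_ker difference
  rw [range_eq_top, ker_eq, finrank_top, finrank_euclideanSpace_fin, Module.finrank_prod,
    finrank_tangentSpace, finrank_tangentSpace] at rank_nullity
  simp only [Fintype.card_sum, Fintype.card_fin]
  omega

theorem exists_mk_mem_composableTangent_left (g : G) {h : G} (η : TangentSpace (𝓡 (r + n)) h) :
    ∃ ξ, (ξ, η) ∈ 𝒢.composableTangent g h :=
  𝒢.surjective_mfderiv_src g (mfderiv (𝓡 (r + n)) (𝓡 n) 𝒢.tgt h η : EuclideanSpace ℝ (Fin n))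

theorem exists_mk_mem_composableTangent_right {g : G} (h : G) (ξ : TangentSpace (𝓡 (r + n)) g) :
    ∃ η, (ξ, η) ∈ 𝒢.composableTangent g h :=
  (𝒢.surjective_mfderiv_tgt h
    (mfderiv (𝓡 (r + n)) (𝓡 n) 𝒢.src g ξ : EuclideanSpace ℝ (Fin n))).imp fun _ => Eq.symm

theorem rightTranslation_zero_mem_composableTangent (g h : G)
    (a : 𝒢.algebroidFibre (𝒢.tgt g)) : (𝒢.rightTranslation g a, 0) ∈ 𝒢.composableTangent g h :=
  mk_mem_composableTangent.2 (by rw [mfderiv_src_rightTranslation, map_zero]; rfl)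

theorem zero_leftTranslation_mem_composableTangent (g h : G)
    (b : 𝒢.algebroidFibre (𝒢.src h)) : (0, 𝒢.leftTranslation h b) ∈ 𝒢.composableTangent g h :=
  mk_mem_composableTangent.2 (by rw [mfderiv_tgt_leftTranslation, map_zero]; rfl)

theorem neg_leftTranslation_rightTranslation_mem_composableTangent {g h : G}
    (hgh : 𝒢.src g = 𝒢.tgt h) (a : ∀ x, 𝒢.algebroidFibre x) :
    (-𝒢.leftTranslation g (a (𝒢.src g)), 𝒢.rightTranslation h (a (𝒢.tgt h))) ∈
      𝒢.composableTangent g h := by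
  obtain ⟨c, hc, hcs⟩ := exists_hasVelocity_algebroidFibre _ (a (𝒢.tgt h))
  have hleft := (hasVelocity_leftTranslation hgh a hc hcs).mfderiv (𝒢.mdifferentiableAt_src g)
  have hright := (hasVelocity_rightTranslation rfl a hc hcs).mfderiv (𝒢.mdifferentiableAt_tgt h)
  refine mk_mem_composableTangent.2 (HasVelocity.unique (I := 𝓡 n) hleft
    ((HasVelocity.of_eq hright hgh.symm).congr (hcs.mono fun t ht => ?_)))
  exact (𝒢.tgt_mul _ _ ht).trans (𝒢.src_mul_inv (hgh.trans ht.symm)).symm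

theorem apply_eq_of_eq {k : ℕ} (X : ∀ x : M, Module.Basis (Fin k) ℝ (TangentSpace (𝓡 n) x))
    {x y : M} (h : x = y) (j : Fin k) :
    (X x j : EuclideanSpace ℝ (Fin n)) = (X y j : EuclideanSpace ℝ (Fin n)) := by
  subst h
  rfl

theorem mfderiv_src_mulDeriv_srcLift {g h : G} (hgh : 𝒢.src g = 𝒢.tgt h)
    (X : ∀ x : M, Module.Basis (Fin n) ℝ (TangentSpace (𝓡 n) x)) (j : Fin n)
    {ξ : TangentSpace (𝓡 (r + n)) g} (hξ : (ξ, 𝒢.srcLift h (X _ j)) ∈ 𝒢.composableTangent g h) :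
    mfderiv (𝓡 (r + n)) (𝓡 n) 𝒢.src (𝒢.mul g h) (𝒢.mulDeriv g h (ξ, 𝒢.srcLift h (X _ j))) =
      X _ j :=
  (mfderiv_src_mulDeriv hgh hξ).trans
    ((mfderiv_src_srcLift h _).trans (apply_eq_of_eq X (𝒢.src_mul g h hgh).symm j))

theorem mfderiv_tgt_mulDeriv_tgtLift {g h : G} (hgh : 𝒢.src g = 𝒢.tgt h)
    (X : ∀ x : M, Module.Basis (Fin n) ℝ (TangentSpace (𝓡 n) x)) (j : Fin n)
    {η : TangentSpace (𝓡 (r + n)) h} (hη : (𝒢.tgtLift g (X _ j), η) ∈ 𝒢.composableTangent g h) :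
    mfderiv (𝓡 (r + n)) (𝓡 n) 𝒢.tgt (𝒢.mul g h) (𝒢.mulDeriv g h (𝒢.tgtLift g (X _ j), η)) =
      X _ j :=
  (mfderiv_tgt_mulDeriv hgh hη).trans
    ((mfderiv_tgt_tgtLift g _).trans (apply_eq_of_eq X (𝒢.tgt_mul g h hgh).symm j))

theorem map_mulDeriv_composableTangent {g h : G} (hgh : 𝒢.src g = 𝒢.tgt h) :
    (𝒢.composableTangent g h).map (𝒢.mulDeriv g h) = ⊤ := by
  choose ξ hξ using fun j => exists_mk_mem_composableTangent_left (𝒢 := 𝒢) g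
    (𝒢.srcLift h (someTangentFrame (𝒢.src h) j))
  let frame : Fin r ⊕ Fin n → TangentSpace (𝓡 (r + n)) (𝒢.mul g h) :=
    Sum.elim (𝒢.rightTranslation (𝒢.mul g h) ∘ 𝒢.someFrame _)
      fun j => 𝒢.mulDeriv g h (ξ j, 𝒢.srcLift h (someTangentFrame (𝒢.src h) j))
  have linearIndependent_frame : LinearIndependent ℝ frame := by
    refine linearIndependent_sumElim_of_comp
      (mfderiv (𝓡 (r + n)) (𝓡 n) 𝒢.src (𝒢.mul g h)).toLinearMap
      (linearIndependent_rightTranslation _ _) (fun i => mfderiv_src_rightTranslation _ _) ?_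
    exact linearIndependent_of_eq_basis (someTangentFrame (𝒢.src (𝒢.mul g h)))
      fun j => mfderiv_src_mulDeriv_srcLift hgh someTangentFrame j (hξ j)
  rw [eq_top_iff, ← linearIndependent_frame.span_eq_top_of_card_eq_finrank'
    (Module.finrank_eq_card_basis (tangentBasis _)).symm, Submodule.span_le]
  rintro _ ⟨i | j, rfl⟩
  · exact ⟨_, rightTranslation_zero_mem_composableTangent g h _,
      mulDeriv_rightTranslation hgh fun x => 𝒢.someFrame x i⟩
  · exact ⟨_, hξ j, rfl⟩

/-- The frames of the tangent spaces at `g`, `h` and `gh` that enter the three frame ratios are all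
images of families of vectors tangent to the space of pairs of composable arrows. -/
theorem det_leftTranslation_mul_det_mul_det {g h : G} (hgh : 𝒢.src g = 𝒢.tgt h)
    (a : ∀ x, Module.Basis (Fin r) ℝ (𝒢.algebroidFibre x))
    (x y z : Fin n → 𝒢.composableTangent g h) :
    (tangentBasis (𝒢.mul g h)).det
        (Sum.elim (𝒢.leftTranslation _ ∘ a _) (fun j => 𝒢.mulDeriv g h (z j))) *
      ((tangentBasis g).det (Sum.elim (𝒢.rightTranslation g ∘ a _) (fun j => (y j).1.1)) *
        (tangentBasis h).det (Sum.elim (𝒢.rightTranslation h ∘ a _) (fun j => (x j).1.2))) =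
    (tangentBasis g).det (Sum.elim (𝒢.leftTranslation g ∘ a _) (fun j => (z j).1.1)) *
        (tangentBasis h).det (Sum.elim (𝒢.leftTranslation h ∘ a _) (fun j => (y j).1.2)) *
      (tangentBasis (𝒢.mul g h)).det
        (Sum.elim (𝒢.rightTranslation _ ∘ a _) (fun j => 𝒢.mulDeriv g h (x j))) := by
  let W := 𝒢.composableTangent g h
  let B : Module.Basis (Fin r ⊕ (Fin r ⊕ Fin n)) ℝ W :=
    (Module.finBasisOfFinrankEq ℝ W (finrank_composableTangent g h)).reindex
      (Fintype.equivFin _).symm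
  let fst := (LinearMap.fst ℝ _ _).domRestrict W
  let snd := (LinearMap.snd ℝ _ _).domRestrict W
  let mul := (𝒢.mulDeriv g h).domRestrict W
  let u (i : Fin r) : W := ⟨_, rightTranslation_zero_mem_composableTangent g h (a _ i)⟩
  let k (i : Fin r) : W :=
    ⟨_, neg_leftTranslation_rightTranslation_mem_composableTangent hgh fun x => a x i⟩
  let l (i : Fin r) : W := ⟨_, zero_leftTranslation_mem_composableTangent g h (a _ i)⟩
  have fst_surjective : Function.Surjective fst := fun ξ =>
    (exists_mk_mem_composableTangent_right h ξ).elim fun _ hη => ⟨⟨_, hη⟩, rfl⟩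
  have snd_surjective : Function.Surjective snd := fun η =>
    (exists_mk_mem_composableTangent_left g η).elim fun _ hξ => ⟨⟨_, hξ⟩, rfl⟩
  have mul_surjective : Function.Surjective mul := LinearMap.range_eq_top.1
    ((LinearMap.range_domRestrict _ _).trans (map_mulDeriv_composableTangent hgh))
  have mul_comp_u : mul ∘ u = 𝒢.rightTranslation (𝒢.mul g h) ∘ a _ :=
    funext fun i => mulDeriv_rightTranslation hgh fun x => a x i
  have mul_comp_l : mul ∘ l = 𝒢.leftTranslation (𝒢.mul g h) ∘ a _ :=
    funext fun i => mulDeriv_leftTranslation hgh fun x => a x i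
  have neg_fst_comp_k : -(fst ∘ k) = 𝒢.leftTranslation g ∘ a _ := funext fun i => neg_neg _
  rw [← mul_comp_u, ← mul_comp_l, ← neg_fst_comp_k]
  exact det_mul_det_mul_det_eq B (tangentBasis g) (tangentBasis h) (tangentBasis (𝒢.mul g h))
    fst snd mul fst_surjective snd_surjective mul_surjective (u := u) (k := k) (l := l) x y z
    (.of_comp fst (linearIndependent_rightTranslation g (a _)))
    (.of_comp snd (linearIndependent_rightTranslation h (a _)))
    (.of_comp snd (linearIndependent_leftTranslation h (a _))) (fun _ => rfl)
    (fun i => mulDeriv_neg_leftTranslation_rightTranslation hgh fun x => a x i) (fun _ => rfl)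

theorem frameRatio_mul {g h : G} (hgh : 𝒢.src g = 𝒢.tgt h)
    (a : ∀ x, Module.Basis (Fin r) ℝ (𝒢.algebroidFibre x))
    (X : ∀ x : M, Module.Basis (Fin n) ℝ (TangentSpace (𝓡 n) x)) :
    𝒢.frameRatio (𝒢.mul g h) (a _) (X _) (a _) (X _) =
      𝒢.frameRatio g (a _) (X _) (a _) (X _) * 𝒢.frameRatio h (a _) (X _) (a _) (X _) := by
  choose ξ hξ using fun j =>
    exists_mk_mem_composableTangent_left (𝒢 := 𝒢) g (𝒢.srcLift h (X _ j))
  choose η hη using fun j =>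
    exists_mk_mem_composableTangent_right (𝒢 := 𝒢) h (𝒢.tgtLift g (X _ j))
  have lifts_mem (j : Fin n) :
      (𝒢.srcLift g (X _ j), 𝒢.tgtLift h (X _ j)) ∈ 𝒢.composableTangent g h := by
    rw [mk_mem_composableTangent, mfderiv_src_srcLift, mfderiv_tgt_tgtLift]
    exact apply_eq_of_eq X hgh j
  unfold frameRatio
  rw [div_mul_div_comm, div_eq_div_iff (det_rightTranslation_srcLift_ne_zero _ _ _ _)
      (mul_ne_zero (det_rightTranslation_srcLift_ne_zero _ _ _ _)
        (det_rightTranslation_srcLift_ne_zero _ _ _ _)),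
    ← det_rightTranslation_eq_of_lift (𝒢.mul g h) _ (a _) (X _) _
      fun j => mfderiv_src_mulDeriv_srcLift hgh X j (hξ j),
    ← det_leftTranslation_eq_of_lift (𝒢.mul g h) _ (a _) (X _) _
      fun j => mfderiv_tgt_mulDeriv_tgtLift hgh X j (hη j)]
  exact det_leftTranslation_mul_det_mul_det hgh a (fun j => ⟨_, hξ j⟩)
    (fun j => ⟨_, lifts_mem j⟩) (fun j => ⟨_, hη j⟩)

end Multiplicativity

/-! ### The fibres of the transverse bundle -/

section TransverseFibre

variable {𝒢 : LieGroupoid n r M G} {χ : ℝ →*₀ ℝ}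

theorem transverseFibre_apply {x : M} (ξ : 𝒢.transverseFibre χ x)
    (a a' : Module.Basis (Fin r) ℝ (𝒢.algebroidFibre x))
    (X X' : Module.Basis (Fin n) ℝ (TangentSpace (𝓡 n) x)) :
    ξ.1 a' X' = χ (a'.det a) * χ (X.det X') * ξ.1 a X :=
  ξ.2 a a' X X'

theorem character_ne_zero (χ : ℝ →*₀ ℝ) {t : ℝ} (ht : t ≠ 0) : χ t ≠ 0 :=
  (map_ne_zero χ).2 ht

theorem transverseFibre_ext {x : M} {ξ η : 𝒢.transverseFibre χ x}
    (a : Module.Basis (Fin r) ℝ (𝒢.algebroidFibre x))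
    (X : Module.Basis (Fin n) ℝ (TangentSpace (𝓡 n) x)) (h : ξ.1 a X = η.1 a X) : ξ = η := by
  apply Subtype.ext
  funext a' X'
  rw [transverseFibre_apply ξ a a' X X', transverseFibre_apply η a a' X X', h]

theorem transverseFibre_apply_ne_zero {x : M} {ξ : 𝒢.transverseFibre χ x} (hξ : ξ ≠ 0)
    (a : Module.Basis (Fin r) ℝ (𝒢.algebroidFibre x))
    (X : Module.Basis (Fin n) ℝ (TangentSpace (𝓡 n) x)) : ξ.1 a X ≠ 0 :=
  fun h => hξ (transverseFibre_ext a X h)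

theorem ne_zero_of_apply_ne_zero {x : M} {ξ : 𝒢.transverseFibre χ x}
    {a : Module.Basis (Fin r) ℝ (𝒢.algebroidFibre x)}
    {X : Module.Basis (Fin n) ℝ (TangentSpace (𝓡 n) x)} (h : ξ.1 a X ≠ 0) : ξ ≠ 0 := by
  rintro rfl
  exact h rfl

variable (𝒢 χ) in
/-- The element of the fibre of the transverse bundle with a given value on given frames. -/
noncomputable def ofFrame {x : M} (a : Module.Basis (Fin r) ℝ (𝒢.algebroidFibre x))
    (X : Module.Basis (Fin n) ℝ (TangentSpace (𝓡 n) x)) (c : ℝ) : 𝒢.transverseFibre χ x :=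
  ⟨fun a' X' => χ (a'.det a) * χ (X.det X') * c, fun a₁ a₂ X₁ X₂ => by
    beta_reduce
    rw [← Module.Basis.det_mul_det a₂ a₁ a, ← Module.Basis.det_mul_det X X₁ X₂, map_mul, map_mul]
    ring⟩

theorem ofFrame_apply {x : M} (a a' : Module.Basis (Fin r) ℝ (𝒢.algebroidFibre x))
    (X X' : Module.Basis (Fin n) ℝ (TangentSpace (𝓡 n) x)) (c : ℝ) :
    (𝒢.ofFrame χ a X c).1 a' X' = χ (a'.det a) * χ (X.det X') * c := rfl

theorem ofFrame_apply_self {x : M} (a : Module.Basis (Fin r) ℝ (𝒢.algebroidFibre x))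
    (X : Module.Basis (Fin n) ℝ (TangentSpace (𝓡 n) x)) (c : ℝ) :
    (𝒢.ofFrame χ a X c).1 a X = c := by
  simp [ofFrame_apply, Module.Basis.det_self]

theorem transverseAction_apply (g : G) (ξ : 𝒢.transverseFibre χ (𝒢.src g))
    (b : Module.Basis (Fin r) ℝ (𝒢.algebroidFibre (𝒢.src g)))
    (X : Module.Basis (Fin n) ℝ (TangentSpace (𝓡 n) (𝒢.src g)))
    (a : Module.Basis (Fin r) ℝ (𝒢.algebroidFibre (𝒢.tgt g)))
    (Y : Module.Basis (Fin n) ℝ (TangentSpace (𝓡 n) (𝒢.tgt g))) :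
    (𝒢.transverseAction χ g ξ).1 a Y = χ (𝒢.frameRatio g b X a Y) * ξ.1 b X := by
  change χ (𝒢.frameRatio g (𝒢.someFrame (𝒢.src g)) (someTangentFrame (𝒢.src g)) a Y) *
        ξ.1 (𝒢.someFrame (𝒢.src g)) (someTangentFrame (𝒢.src g)) = _
  rw [frameRatio_eq_of_src g _ b _ X, transverseFibre_apply ξ b _ X _, map_mul, map_mul]
  have frame_cancel := congrArg χ (basis_det_mul_det_symm b (𝒢.someFrame (𝒢.src g)))
  have tangentFrame_cancel := congrArg χ (basis_det_mul_det_symm X (someTangentFrame (𝒢.src g)))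
  rw [map_mul, map_one] at frame_cancel tangentFrame_cancel
  linear_combination χ (𝒢.frameRatio g b X a Y) * ξ.1 b X *
    (χ (X.det (someTangentFrame (𝒢.src g))) * χ ((someTangentFrame (𝒢.src g)).det X) *
      frame_cancel + tangentFrame_cancel)

theorem transverseAction_ne_zero {g : G} {ξ : 𝒢.transverseFibre χ (𝒢.src g)} (hξ : ξ ≠ 0) :
    𝒢.transverseAction χ g ξ ≠ 0 :=
  ne_zero_of_apply_ne_zero (a := 𝒢.someFrame _) (X := someTangentFrame _) (by
    rw [transverseAction_apply g ξ (𝒢.someFrame _) (someTangentFrame _)]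
    exact mul_ne_zero (character_ne_zero χ (frameRatio_ne_zero _ _ _ _ _))
      (transverseFibre_apply_ne_zero hξ _ _))

variable (𝒢) in
/-- The frame ratio for a choice of frames at all points. -/
noncomputable def ratio (g : G) : ℝ :=
  𝒢.frameRatio g (𝒢.someFrame _) (someTangentFrame _) (𝒢.someFrame _) (someTangentFrame _)

theorem ratio_ne_zero (g : G) : 𝒢.ratio g ≠ 0 := frameRatio_ne_zero _ _ _ _ _

theorem ratio_mul {g h : G} (hgh : 𝒢.src g = 𝒢.tgt h) :
    𝒢.ratio (𝒢.mul g h) = 𝒢.ratio g * 𝒢.ratio h :=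
  frameRatio_mul hgh 𝒢.someFrame someTangentFrame

theorem ratio_unit (x : M) : 𝒢.ratio (𝒢.unit x) = 1 := by
  have mul_unit_unit := 𝒢.mul_unit (𝒢.unit x)
  rw [𝒢.src_unit] at mul_unit_unit
  have ratio_mul_self := ratio_mul (𝒢 := 𝒢) (g := 𝒢.unit x) (h := 𝒢.unit x)
    (by rw [𝒢.src_unit, 𝒢.tgt_unit])
  rw [mul_unit_unit] at ratio_mul_self
  exact (mul_eq_left₀ (ratio_ne_zero _)).1 ratio_mul_self.symm

variable (𝒢 χ) in
/-- The value of an element of the transverse bundle on the chosen frames. -/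
noncomputable def value {x : M} (ξ : 𝒢.transverseFibre χ x) : ℝ :=
  ξ.1 (𝒢.someFrame x) (someTangentFrame x)

theorem value_injective {x : M} : Function.Injective (𝒢.value χ (x := x)) :=
  fun _ _ h => transverseFibre_ext _ _ h

theorem value_ne_zero {x : M} {ξ : 𝒢.transverseFibre χ x} : 𝒢.value χ ξ ≠ 0 ↔ ξ ≠ 0 :=
  ⟨ne_zero_of_apply_ne_zero, fun h => transverseFibre_apply_ne_zero h _ _⟩

theorem value_smul {x : M} (c : ℝ) (ξ : 𝒢.transverseFibre χ x) :
    𝒢.value χ (c • ξ) = c * 𝒢.value χ ξ := rfl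

theorem value_transverseAction (g : G) (ξ : 𝒢.transverseFibre χ (𝒢.src g)) :
    𝒢.value χ (𝒢.transverseAction χ g ξ) = χ (𝒢.ratio g) * 𝒢.value χ ξ := rfl

theorem exists_apply_eq_mul_value {x : M} (a : Module.Basis (Fin r) ℝ (𝒢.algebroidFibre x))
    (X : Module.Basis (Fin n) ℝ (TangentSpace (𝓡 n) x)) :
    ∃ k : ℝ, k ≠ 0 ∧ ∀ ξ : 𝒢.transverseFibre χ x, ξ.1 a X = k * 𝒢.value χ ξ :=
  ⟨_, mul_ne_zero (character_ne_zero χ (a.isUnit_det _).ne_zero)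
    (character_ne_zero χ ((someTangentFrame x).isUnit_det _).ne_zero),
    fun ξ => transverseFibre_apply ξ _ a _ X⟩

end TransverseFibre

/-! ### Smooth frames -/

section SmoothFrames

variable {𝒢 : LieGroupoid n r M G}

theorem mfderiv_src_mfderiv_unit (x : M) (v : TangentSpace (𝓡 n) x) :
    (mfderiv (𝓡 (r + n)) (𝓡 n) 𝒢.src (𝒢.unit x) (mfderiv (𝓡 n) (𝓡 (r + n)) 𝒢.unit x v) :
      EuclideanSpace ℝ (Fin n)) = v := by
  have mfderiv_src_comp_unit :
      (mfderiv (𝓡 n) (𝓡 n) (𝒢.src ∘ 𝒢.unit) x v : EuclideanSpace ℝ (Fin n)) = v := by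
    rw [show 𝒢.src ∘ 𝒢.unit = id from funext 𝒢.src_unit, mfderiv_id]
    rfl
  rw [mfderiv_comp x (𝒢.mdifferentiableAt_src _)
    (𝒢.contMDiff_unit.mdifferentiableAt (by simp))] at mfderiv_src_comp_unit
  exact mfderiv_src_comp_unit

theorem mem_algebroidFibre_sub (x : M) (v : TangentSpace (𝓡 (r + n)) (𝒢.unit x)) :
    v - (mfderiv (𝓡 n) (𝓡 (r + n)) 𝒢.unit x
      (mfderiv (𝓡 (r + n)) (𝓡 n) 𝒢.src (𝒢.unit x) v : EuclideanSpace ℝ (Fin n)) :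
        EuclideanSpace ℝ (Fin (r + n))) ∈ 𝒢.algebroidFibre x := by
  rw [LinearMap.mem_ker]
  change mfderiv (𝓡 (r + n)) (𝓡 n) 𝒢.src (𝒢.unit x) _ = 0
  rw [map_sub, sub_eq_zero]
  exact (mfderiv_src_mfderiv_unit x _).symm

variable (𝒢) in
/-- The projection to the Lie algebroid along the tangent space of the units. -/
noncomputable def algebroidProj (x : M) (v : TangentSpace (𝓡 (r + n)) (𝒢.unit x)) :
    𝒢.algebroidFibre x :=
  ⟨_, mem_algebroidFibre_sub x v⟩

theorem algebroidProj_apply (x : M) (a : 𝒢.algebroidFibre x) : 𝒢.algebroidProj x a.1 = a := by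
  apply Subtype.ext
  change a.1 - _ = a.1
  rw [show mfderiv (𝓡 (r + n)) (𝓡 n) 𝒢.src (𝒢.unit x) a.1 = 0 from a.2]
  exact (congrArg (fun w => a.1 - w) (map_zero (mfderiv (𝓡 n) (𝓡 (r + n)) 𝒢.unit x))).trans
    (sub_zero _)

variable (𝒢) in
/-- The tangent vectors at a unit given by a family in the fibre of the Lie algebroid and a family
of vectors tangent to the units. -/
noncomputable def unitFamily {x : M} (s : Fin r → 𝒢.algebroidFibre x)
    (X : Fin n → TangentSpace (𝓡 n) x) : Fin r ⊕ Fin n → TangentSpace (𝓡 (r + n)) (𝒢.unit x) :=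
  Sum.elim (fun i => (s i).1) fun j => mfderiv (𝓡 n) (𝓡 (r + n)) 𝒢.unit x (X j)

theorem det_unitFamily_ne_zero {x : M}
    (B : Module.Basis (Fin r ⊕ Fin n) ℝ (TangentSpace (𝓡 (r + n)) (𝒢.unit x)))
    {s : Fin r → 𝒢.algebroidFibre x} (hs : LinearIndependent ℝ s)
    (X : ∀ x : M, Module.Basis (Fin n) ℝ (TangentSpace (𝓡 n) x)) :
    B.det (𝒢.unitFamily s (X x)) ≠ 0 :=
  (linearIndependent_iff_basis_det_ne_zero B).1 <|
    linearIndependent_sumElim_of_comp (mfderiv (𝓡 (r + n)) (𝓡 n) 𝒢.src (𝒢.unit x)).toLinearMap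
      (hs.map' (𝒢.algebroidFibre x).subtype (Submodule.ker_subtype _)) (fun i => (s i).2)
      (linearIndependent_of_eq_basis (X (𝒢.src (𝒢.unit x))) fun j =>
        (mfderiv_src_mfderiv_unit x _).trans (apply_eq_of_eq X (𝒢.src_unit x).symm j))

variable [IsManifold (𝓡 (r + n)) ∞ G]

variable (𝒢) in
/-- Smoothness at a point of a section of the Lie algebroid, as a map to the tangent bundle of the
space of arrows. -/
def IsSmoothSectionAt (s : ∀ x : M, 𝒢.algebroidFibre x) (x₀ : M) : Prop :=
  ContMDiffAt (𝓡 n) (𝓡 (r + n)).tangent ∞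
    (fun x => (⟨𝒢.unit x, (s x).1⟩ : TangentBundle (𝓡 (r + n)) G)) x₀

variable (𝒢) in
/-- Smoothness at a point of a frame of the Lie algebroid. -/
def IsSmoothFrameAt (a : ∀ x : M, Module.Basis (Fin r) ℝ (𝒢.algebroidFibre x)) (x₀ : M) : Prop :=
  ∀ i, 𝒢.IsSmoothSectionAt (fun x => a x i) x₀

variable [IsManifold (𝓡 n) ∞ M]

/-- Smoothness at a point of a frame of the tangent bundle. -/
def IsSmoothTangentFrameAt (X : ∀ x : M, Module.Basis (Fin n) ℝ (TangentSpace (𝓡 n) x))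
    (x₀ : M) : Prop :=
  ∀ j, ContMDiffAt (𝓡 n) (𝓡 n).tangent ∞ (fun x => (⟨x, X x j⟩ : TangentBundle (𝓡 n) M)) x₀

variable (n) in
/-- The standard basis of the model space of `M`. -/
noncomputable def modelBasis : Module.Basis (Fin n) ℝ (EuclideanSpace ℝ (Fin n)) :=
  (EuclideanSpace.basisFun (Fin n) ℝ).toBasis

variable (n r) in
/-- The standard basis of the model space of `G`. -/
noncomputable def modelSumBasis :
    Module.Basis (Fin r ⊕ Fin n) ℝ (EuclideanSpace ℝ (Fin (r + n))) :=
  (modelBasis (r + n)).reindex finSumFinEquiv.symm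

theorem exists_isSmoothTangentFrameAt (x₀ : M) :
    ∃ X : ∀ x : M, Module.Basis (Fin n) ℝ (TangentSpace (𝓡 n) x),
      ∀ᶠ x in 𝓝 x₀, IsSmoothTangentFrameAt X x := by
  refine ⟨chartBasis (𝓡 n) (modelBasis n) x₀, ?_⟩
  filter_upwards [chart_source_mem_nhds (EuclideanSpace ℝ (Fin n)) x₀] with x hx j
  refine (contMDiffAt_chartVector (φ := id) contMDiffAt_id hx
    (modelBasis n j)).congr_of_eventuallyEq ?_
  filter_upwards [(chartAt (EuclideanSpace ℝ (Fin n)) x₀).open_source.mem_nhds hx] with y hy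
  rw [chartBasis_apply _ hy]
  rfl

theorem IsSmoothTangentFrameAt.contMDiffAt_unit
    {X : ∀ x : M, Module.Basis (Fin n) ℝ (TangentSpace (𝓡 n) x)} {x₀ : M}
    (hX : IsSmoothTangentFrameAt X x₀) (j : Fin n) :
    ContMDiffAt (𝓡 n) (𝓡 (r + n)).tangent ∞ (fun x => (⟨𝒢.unit x,
      mfderiv (𝓡 n) (𝓡 (r + n)) 𝒢.unit x (X x j)⟩ : TangentBundle (𝓡 (r + n)) G)) x₀ :=
  contMDiffAt_mfderiv 𝒢.contMDiff_unit (hX j)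

theorem isSmoothSectionAt_algebroidProj {x₀ : M} {v : ∀ x, TangentSpace (𝓡 (r + n)) (𝒢.unit x)}
    (hv : ContMDiffAt (𝓡 n) (𝓡 (r + n)).tangent ∞
      (fun x => (⟨𝒢.unit x, v x⟩ : TangentBundle (𝓡 (r + n)) G)) x₀) :
    𝒢.IsSmoothSectionAt (fun x => 𝒢.algebroidProj x (v x)) x₀ := by
  have contMDiffAt_src : ContMDiffAt (𝓡 n) (𝓡 n).tangent ∞ (fun x => (⟨x,
      (mfderiv (𝓡 (r + n)) (𝓡 n) 𝒢.src (𝒢.unit x) (v x) : EuclideanSpace ℝ (Fin n))⟩ :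
        TangentBundle (𝓡 n) M)) x₀ :=
    (contMDiffAt_mfderiv 𝒢.contMDiff_src hv).congr_of_eventuallyEq
      (Filter.Eventually.of_forall fun x => (tangentBundle_mk_eq (𝒢.src_unit x) _).symm)
  exact contMDiffAt_tangent_sub hv (contMDiffAt_mfderiv 𝒢.contMDiff_unit contMDiffAt_src)

theorem exists_isSmoothSectionAt_eq (x₀ : M) (ξ : 𝒢.algebroidFibre x₀) :
    ∃ s : ∀ x, 𝒢.algebroidFibre x, s x₀ = ξ ∧ ∀ᶠ x in 𝓝 x₀, 𝒢.IsSmoothSectionAt s x := by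
  let p₀ := 𝒢.unit x₀
  let v : ∀ x, TangentSpace (𝓡 (r + n)) (𝒢.unit x) := fun x => chartVector (𝓡 (r + n)) p₀
    (trivializationAt _ (TangentSpace (𝓡 (r + n))) p₀ ⟨p₀, ξ.1⟩).2 (𝒢.unit x)
  have v_x₀ : v x₀ = ξ.1 := chartVector_trivializationAt (mem_chart_source _ _) _
  refine ⟨fun x => 𝒢.algebroidProj x (v x),
    (congrArg (𝒢.algebroidProj x₀) v_x₀).trans (algebroidProj_apply x₀ ξ), ?_⟩
  filter_upwards [𝒢.contMDiff_unit.continuous.continuousAt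
    (chart_source_mem_nhds (EuclideanSpace ℝ (Fin (r + n))) p₀)] with x hx
  exact isSmoothSectionAt_algebroidProj
    (contMDiffAt_chartVector 𝒢.contMDiff_unit.contMDiffAt hx _)

theorem contMDiffAt_det_unitFamily {s : ∀ x, Fin r → 𝒢.algebroidFibre x}
    {X : ∀ x : M, Module.Basis (Fin n) ℝ (TangentSpace (𝓡 n) x)} {x₀ : M}
    (hs : ∀ i, 𝒢.IsSmoothSectionAt (fun x => s x i) x₀) (hX : IsSmoothTangentFrameAt X x₀) :
    ContMDiffAt (𝓡 n) 𝓘(ℝ, ℝ) ∞ (fun x => (chartBasis (𝓡 (r + n)) (modelSumBasis n r) (𝒢.unit x₀)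
      (𝒢.unit x)).det (𝒢.unitFamily (s x) (X x))) x₀ := by
  refine contMDiffAt_chartBasis_det _ rfl 𝒢.contMDiff_unit.contMDiffAt ?_
  rintro (i | j)
  · exact hs i
  · exact hX.contMDiffAt_unit j

theorem eventually_linearIndependent {s : ∀ x, Fin r → 𝒢.algebroidFibre x} {x₀ : M}
    (hs : ∀ i, 𝒢.IsSmoothSectionAt (fun x => s x i) x₀) (hs₀ : LinearIndependent ℝ (s x₀)) :
    ∀ᶠ x in 𝓝 x₀, LinearIndependent ℝ (s x) := by
  obtain ⟨X, hX⟩ := exists_isSmoothTangentFrameAt (n := n) x₀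
  filter_upwards [(contMDiffAt_det_unitFamily hs hX.self_of_nhds).continuousAt.eventually_ne
    (det_unitFamily_ne_zero _ hs₀ X)] with x hx
  exact .of_comp (𝒢.algebroidFibre x).subtype
    (((linearIndependent_iff_basis_det_ne_zero _).2 hx).comp Sum.inl Sum.inl_injective)

theorem exists_isSmoothFrameAt (x₀ : M) :
    ∃ a : ∀ x : M, Module.Basis (Fin r) ℝ (𝒢.algebroidFibre x),
      ∀ᶠ x in 𝓝 x₀, 𝒢.IsSmoothFrameAt a x := by
  classical
  choose s hs₀ hs using fun i => exists_isSmoothSectionAt_eq x₀ (𝒢.someFrame x₀ i)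
  have eventually_linearIndependent_s : ∀ᶠ x in 𝓝 x₀, LinearIndependent ℝ fun i => s i x :=
    eventually_linearIndependent (fun i => (hs i).self_of_nhds)
      (linearIndependent_of_eq_basis (𝒢.someFrame x₀) hs₀)
  have finiteDimensional_algebroidFibre (x : M) : FiniteDimensional ℝ (𝒢.algebroidFibre x) :=
    (𝒢.someFrame x).finiteDimensional_of_finite
  let a (x : M) : Module.Basis (Fin r) ℝ (𝒢.algebroidFibre x) :=
    if h : LinearIndependent ℝ fun i => s i x then
      basisOfLinearIndependentOfCardEqFinrank' _ h
        (Module.finrank_eq_card_basis (𝒢.someFrame x)).symm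
    else 𝒢.someFrame x
  refine ⟨a, ?_⟩
  filter_upwards [Filter.eventually_all.2 hs, eventually_linearIndependent_s.eventually_nhds]
    with x smooth_s linearIndependent_s i
  refine (smooth_s i).congr_of_eventuallyEq ?_
  filter_upwards [linearIndependent_s] with y hy
  simp only [a, dif_pos hy, coe_basisOfLinearIndependentOfCardEqFinrank']

theorem IsSmoothTangentFrameAt.contMDiffAt_det
    {X X' : ∀ x : M, Module.Basis (Fin n) ℝ (TangentSpace (𝓡 n) x)} {x₀ : M}
    (hX : IsSmoothTangentFrameAt X x₀) (hX' : IsSmoothTangentFrameAt X' x₀) :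
    ContMDiffAt (𝓡 n) 𝓘(ℝ, ℝ) ∞ (fun x => (X x).det (X' x)) x₀ := by
  have contMDiffAt_chartDet {Y : ∀ x : M, Module.Basis (Fin n) ℝ (TangentSpace (𝓡 n) x)}
      (hY : IsSmoothTangentFrameAt Y x₀) :
      ContMDiffAt (𝓡 n) 𝓘(ℝ, ℝ) ∞
        (fun x => (chartBasis (𝓡 n) (modelBasis n) x₀ x).det (Y x)) x₀ :=
    contMDiffAt_chartBasis_det (modelBasis n) (φ := id) rfl contMDiffAt_id hY
  refine ((contMDiffAt_chartDet hX').div₀ (contMDiffAt_chartDet hX)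
    (Module.Basis.isUnit_det _ _).ne_zero).congr_of_eventuallyEq
    (Filter.Eventually.of_forall fun x => ?_)
  exact eq_div_of_mul_eq (Module.Basis.isUnit_det _ _).ne_zero
    ((mul_comm _ _).trans (basis_det_eq_mul _ (X x) (X' x)).symm)

theorem IsSmoothFrameAt.contMDiffAt_det
    {a a' : ∀ x : M, Module.Basis (Fin r) ℝ (𝒢.algebroidFibre x)} {x₀ : M}
    (ha : 𝒢.IsSmoothFrameAt a x₀) (ha' : 𝒢.IsSmoothFrameAt a' x₀) :
    ContMDiffAt (𝓡 n) 𝓘(ℝ, ℝ) ∞ (fun x => (a x).det (a' x)) x₀ := by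
  obtain ⟨X, hX⟩ := exists_isSmoothTangentFrameAt (n := n) x₀
  refine ((contMDiffAt_det_unitFamily ha' hX.self_of_nhds).div₀
    (contMDiffAt_det_unitFamily ha hX.self_of_nhds)
    (det_unitFamily_ne_zero _ (a x₀).linearIndependent X)).congr_of_eventuallyEq
    (Filter.Eventually.of_forall fun x => ?_)
  exact eq_div_of_mul_eq (det_unitFamily_ne_zero _ (a x).linearIndependent X)
    (det_sumElim_left _ (𝒢.algebroidFibre x).subtype _ (a x) (a' x)).symm

theorem exists_smoothFrames (𝒢 : LieGroupoid n r M G) (x₀ : M) :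
    ∃ (a : ∀ x : M, Module.Basis (Fin r) ℝ (𝒢.algebroidFibre x))
      (X : ∀ x : M, Module.Basis (Fin n) ℝ (TangentSpace (𝓡 n) x)),
      ∀ᶠ x in 𝓝 x₀, 𝒢.IsSmoothFrameAt a x ∧ IsSmoothTangentFrameAt X x := by
  obtain ⟨a, ha⟩ := exists_isSmoothFrameAt (𝒢 := 𝒢) x₀
  obtain ⟨X, hX⟩ := exists_isSmoothTangentFrameAt (n := n) x₀
  exact ⟨a, X, ha.and hX⟩

/-! ### Smooth sections of the transverse bundle -/

theorem isSmoothOn_of_exists {χ : ℝ →*₀ ℝ} (hχ : ContDiffOn ℝ ∞ χ {0}ᶜ)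
    {σ : ∀ x : M, 𝒢.transverseFibre χ x} {U : Opens M}
    (h : ∀ x₀ ∈ U, ∃ a X, 𝒢.IsSmoothFrameAt a x₀ ∧ IsSmoothTangentFrameAt X x₀ ∧
      ContMDiffAt (𝓡 n) 𝓘(ℝ, ℝ) ∞ (fun x => (σ x).1 (a x) (X x)) x₀) :
    𝒢.IsSmoothOn χ σ U := by
  intro W hW a' X' ha' hX' x₀ hx₀
  obtain ⟨a, X, ha, hX, hσ⟩ := h x₀ (hW hx₀)
  have W_mem_nhds : (W : Set M) ∈ 𝓝 x₀ := W.isOpen.mem_nhds hx₀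
  have isSmoothFrameAt_a' : 𝒢.IsSmoothFrameAt a' x₀ := fun i => (ha' i).contMDiffAt W_mem_nhds
  have isSmoothTangentFrameAt_X' : IsSmoothTangentFrameAt X' x₀ :=
    fun j => (hX' j).contMDiffAt W_mem_nhds
  have contMDiffAt_frame_change := (hχ.contDiffAt
    (isOpen_compl_singleton.mem_nhds ((a' x₀).isUnit_det (a x₀)).ne_zero)).contMDiffAt.comp x₀
    (isSmoothFrameAt_a'.contMDiffAt_det ha)
  have contMDiffAt_tangentFrame_change := (hχ.contDiffAt
    (isOpen_compl_singleton.mem_nhds ((X x₀).isUnit_det (X' x₀)).ne_zero)).contMDiffAt.comp x₀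
    (hX.contMDiffAt_det isSmoothTangentFrameAt_X')
  exact (((contMDiffAt_frame_change.mul contMDiffAt_tangentFrame_change).mul
    hσ).congr_of_eventuallyEq (Filter.Eventually.of_forall fun x =>
      transverseFibre_apply (σ x) (a x) (a' x) (X x) (X' x))).contMDiffWithinAt

theorem IsSmoothOn.contMDiffAt_apply {χ : ℝ →*₀ ℝ} {σ : ∀ x : M, 𝒢.transverseFibre χ x}
    {U : Opens M} (hσ : 𝒢.IsSmoothOn χ σ U) {x₀ : M} (hx₀ : x₀ ∈ U)
    {a : ∀ x : M, Module.Basis (Fin r) ℝ (𝒢.algebroidFibre x)}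
    {X : ∀ x : M, Module.Basis (Fin n) ℝ (TangentSpace (𝓡 n) x)}
    (haX : ∀ᶠ x in 𝓝 x₀, 𝒢.IsSmoothFrameAt a x ∧ IsSmoothTangentFrameAt X x) :
    ContMDiffAt (𝓡 n) 𝓘(ℝ, ℝ) ∞ (fun x => (σ x).1 (a x) (X x)) x₀ := by
  obtain ⟨W, hW, W_open, hx₀W⟩ := eventually_nhds_iff.1 haX
  exact (hσ (U ⊓ ⟨W, W_open⟩) inf_le_left a X
    (fun i y hy => ((hW y hy.2).1 i).contMDiffWithinAt)
    (fun j y hy => ((hW y hy.2).2 j).contMDiffWithinAt)).contMDiffAt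
      ((U ⊓ ⟨W, W_open⟩).isOpen.mem_nhds ⟨hx₀, hx₀W⟩)

end SmoothFrames

/-! ### Smoothness of the frame ratio -/

section SmoothRatio

variable [IsManifold (𝓡 (r + n)) ∞ G] {𝒢 : LieGroupoid n r M G}

theorem contMDiffAt_rightTranslation
    {a : ∀ x : M, Module.Basis (Fin r) ℝ (𝒢.algebroidFibre x)} {g₀ : G}
    (ha : 𝒢.IsSmoothFrameAt a (𝒢.tgt g₀)) (i : Fin r) :
    ContMDiffAt (𝓡 (r + n)) (𝓡 (r + n)).tangent ∞ (fun g =>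
      (⟨g, 𝒢.rightTranslation g (a (𝒢.tgt g) i)⟩ : TangentBundle (𝓡 (r + n)) G)) g₀ := by
  refine contMDiffAt_of_hasVelocity 𝒢.contMDiffOn_mul (φ := fun g => (𝒢.unit (𝒢.tgt g), g))
    (v := fun g => ((a (𝒢.tgt g) i).1, 0)) (fun g => 𝒢.src_unit _)
    (contMDiffAt_tangent_prodMk ((ha i).comp g₀ 𝒢.contMDiff_tgt.contMDiffAt)
      (contMDiff_tangent_zero G).contMDiffAt)
    (ψ := fun g => g) (fun g => 𝒢.unit_mul g) (Filter.Eventually.of_forall fun g => ?_)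
  obtain ⟨c, hc, hcs⟩ := exists_hasVelocity_algebroidFibre _ (a (𝒢.tgt g) i)
  exact ⟨fun t => (c t, g), hc.prodMk (HasVelocity.const g), hcs,
    hasVelocity_rightTranslation rfl (fun x => a x i) hc hcs⟩

theorem contMDiffAt_leftTranslation
    {b : ∀ x : M, Module.Basis (Fin r) ℝ (𝒢.algebroidFibre x)} {g₀ : G}
    (hb : 𝒢.IsSmoothFrameAt b (𝒢.src g₀)) (i : Fin r) :
    ContMDiffAt (𝓡 (r + n)) (𝓡 (r + n)).tangent ∞ (fun g =>
      (⟨g, 𝒢.leftTranslation g (b (𝒢.src g) i)⟩ : TangentBundle (𝓡 (r + n)) G)) g₀ := by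
  suffices contMDiffAt_neg : ContMDiffAt (𝓡 (r + n)) (𝓡 (r + n)).tangent ∞ (fun g =>
      (⟨g, -𝒢.leftTranslation g (b (𝒢.src g) i)⟩ : TangentBundle (𝓡 (r + n)) G)) g₀ by
    simpa only [neg_neg] using contMDiffAt_tangent_neg contMDiffAt_neg
  refine contMDiffAt_of_hasVelocity 𝒢.contMDiffOn_mul
    (φ := fun g => (g, 𝒢.inv (𝒢.unit (𝒢.src g))))
    (v := fun g => (0, mfderiv (𝓡 (r + n)) (𝓡 (r + n)) 𝒢.inv _ (b (𝒢.src g) i).1))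
    (fun g => by simp [𝒢.tgt_inv, 𝒢.src_unit])
    (contMDiffAt_tangent_prodMk (contMDiff_tangent_zero G).contMDiffAt
      (contMDiffAt_mfderiv 𝒢.contMDiff_inv ((hb i).comp g₀ 𝒢.contMDiff_src.contMDiffAt)))
    (ψ := fun g => g) (fun g => by simp only [𝒢.inv_unit, 𝒢.mul_unit])
    (Filter.Eventually.of_forall fun g => ?_)
  obtain ⟨c, hc, hcs⟩ := exists_hasVelocity_algebroidFibre _ (b (𝒢.src g) i)
  exact ⟨fun t => (g, 𝒢.inv (c t)), (HasVelocity.const g).prodMk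
      (hc.mfderiv (𝒢.mdifferentiableAt_inv _)),
    hcs.mono fun t ht => by simp [𝒢.tgt_inv, ht],
    hasVelocity_leftTranslation rfl (fun x => b x i) hc hcs⟩

variable [IsManifold (𝓡 n) ∞ M]

theorem contMDiffAt_det_rightTranslation
    {a : ∀ x : M, Module.Basis (Fin r) ℝ (𝒢.algebroidFibre x)}
    {X : ∀ x : M, Module.Basis (Fin n) ℝ (TangentSpace (𝓡 n) x)} {g₀ : G}
    (ha : 𝒢.IsSmoothFrameAt a (𝒢.tgt g₀)) (hX : IsSmoothTangentFrameAt X (𝒢.src g₀)) :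
    ContMDiffAt (𝓡 (r + n)) 𝓘(ℝ, ℝ) ∞ (fun g =>
      (chartBasis (𝓡 (r + n)) (modelSumBasis n r) g₀ g).det
        (Sum.elim (𝒢.rightTranslation g ∘ a (𝒢.tgt g)) (𝒢.srcLift g ∘ X (𝒢.src g)))) g₀ := by
  refine contMDiffAt_chartBasis_det_sumElim _ (modelBasis n) 𝒢.contMDiff_src
    𝒢.surjective_mfderiv_src (fun g => linearIndependent_rightTranslation g _)
    (fun g i => mfderiv_src_rightTranslation g _) (contMDiffAt_rightTranslation ha) ?_ fun j => ?_
  · exact linearIndependent_of_eq_basis (X (𝒢.src g₀)) fun j => mfderiv_src_srcLift g₀ _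
  · simp only [Function.comp_apply, mfderiv_src_srcLift]
    exact (hX j).comp g₀ 𝒢.contMDiff_src.contMDiffAt

theorem contMDiffAt_det_leftTranslation
    {b : ∀ x : M, Module.Basis (Fin r) ℝ (𝒢.algebroidFibre x)}
    {Y : ∀ x : M, Module.Basis (Fin n) ℝ (TangentSpace (𝓡 n) x)} {g₀ : G}
    (hb : 𝒢.IsSmoothFrameAt b (𝒢.src g₀)) (hY : IsSmoothTangentFrameAt Y (𝒢.tgt g₀)) :
    ContMDiffAt (𝓡 (r + n)) 𝓘(ℝ, ℝ) ∞ (fun g =>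
      (chartBasis (𝓡 (r + n)) (modelSumBasis n r) g₀ g).det
        (Sum.elim (𝒢.leftTranslation g ∘ b (𝒢.src g)) (𝒢.tgtLift g ∘ Y (𝒢.tgt g)))) g₀ := by
  refine contMDiffAt_chartBasis_det_sumElim _ (modelBasis n) 𝒢.contMDiff_tgt
    𝒢.surjective_mfderiv_tgt (fun g => linearIndependent_leftTranslation g _)
    (fun g i => mfderiv_tgt_leftTranslation g _) (contMDiffAt_leftTranslation hb) ?_ fun j => ?_
  · exact linearIndependent_of_eq_basis (Y (𝒢.tgt g₀)) fun j => mfderiv_tgt_tgtLift g₀ _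
  · simp only [Function.comp_apply, mfderiv_tgt_tgtLift]
    exact (hY j).comp g₀ 𝒢.contMDiff_tgt.contMDiffAt

theorem contMDiffAt_frameRatio
    {a b : ∀ x : M, Module.Basis (Fin r) ℝ (𝒢.algebroidFibre x)}
    {X Y : ∀ x : M, Module.Basis (Fin n) ℝ (TangentSpace (𝓡 n) x)} {g₀ : G}
    (hb : 𝒢.IsSmoothFrameAt b (𝒢.src g₀)) (hX : IsSmoothTangentFrameAt X (𝒢.src g₀))
    (ha : 𝒢.IsSmoothFrameAt a (𝒢.tgt g₀)) (hY : IsSmoothTangentFrameAt Y (𝒢.tgt g₀)) :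
    ContMDiffAt (𝓡 (r + n)) 𝓘(ℝ, ℝ) ∞ (fun g =>
      𝒢.frameRatio g (b (𝒢.src g)) (X (𝒢.src g)) (a (𝒢.tgt g)) (Y (𝒢.tgt g))) g₀ :=
  ((contMDiffAt_det_leftTranslation hb hY).div₀ (contMDiffAt_det_rightTranslation ha hX)
    (det_rightTranslation_srcLift_ne_zero _ _ _ _)).congr_of_eventuallyEq
    (Filter.Eventually.of_forall fun _ => basis_det_div_basis_det _ _ _ _)

end SmoothRatio

/-! ### Coefficients of the action -/

section ActionCoefficient

variable {𝒢 : LieGroupoid n r M G} {χ : ℝ →*₀ ℝ}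

/-- The function `f` on `M` with `σ = f τ`, for a nowhere vanishing section `τ`. -/
noncomputable def sectionRatio (σ τ : ∀ x : M, 𝒢.transverseFibre χ x) (x : M) : ℝ :=
  𝒢.value χ (σ x) / 𝒢.value χ (τ x)

/-- The function `c` on arrows with `g_* σ(x) = c(g) τ(y)`, `g : x → y`, for a nowhere vanishing
section `τ`. -/
noncomputable def actionCoefficient (σ τ : ∀ x : M, 𝒢.transverseFibre χ x) (g : G) : ℝ :=
  χ (𝒢.ratio g) * 𝒢.value χ (σ (𝒢.src g)) / 𝒢.value χ (τ (𝒢.tgt g))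

theorem sectionRatio_ne_zero {σ τ : ∀ x : M, 𝒢.transverseFibre χ x} {x : M}
    (hσ : σ x ≠ 0) (hτ : τ x ≠ 0) : sectionRatio σ τ x ≠ 0 :=
  div_ne_zero (value_ne_zero.2 hσ) (value_ne_zero.2 hτ)

theorem actionCoefficient_ne_zero {σ τ : ∀ x : M, 𝒢.transverseFibre χ x} {g : G}
    (hσ : σ (𝒢.src g) ≠ 0) (hτ : τ (𝒢.tgt g) ≠ 0) : actionCoefficient σ τ g ≠ 0 :=
  div_ne_zero (mul_ne_zero (character_ne_zero χ (ratio_ne_zero g)) (value_ne_zero.2 hσ))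
    (value_ne_zero.2 hτ)

theorem transverseAction_eq_smul_iff {σ τ : ∀ x : M, 𝒢.transverseFibre χ x} {g : G}
    (hτ : τ (𝒢.tgt g) ≠ 0) {c : ℝ} :
    𝒢.transverseAction χ g (σ (𝒢.src g)) = c • τ (𝒢.tgt g) ↔ actionCoefficient σ τ g = c := by
  rw [← value_injective.eq_iff, value_smul, value_transverseAction, actionCoefficient,
    div_eq_iff (value_ne_zero.2 hτ)]

theorem actionCoefficient_mul {σ τ ρ : ∀ x : M, 𝒢.transverseFibre χ x} {g h : G}
    (hgh : 𝒢.src g = 𝒢.tgt h) (hτ : τ (𝒢.src g) ≠ 0) :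
    actionCoefficient σ ρ (𝒢.mul g h) = actionCoefficient τ ρ g * actionCoefficient σ τ h := by
  have value_τ_ne_zero := value_ne_zero.2 hτ
  simp only [actionCoefficient]
  rw [ratio_mul hgh, 𝒢.src_mul g h hgh, 𝒢.tgt_mul g h hgh, map_mul, ← hgh]
  field_simp

theorem actionCoefficient_change {σ σ' τ τ' : ∀ x : M, 𝒢.transverseFibre χ x} {g : G}
    (hσ : σ (𝒢.src g) ≠ 0) (hτ : τ (𝒢.tgt g) ≠ 0) :
    actionCoefficient σ' τ' g = actionCoefficient σ τ g *
      (sectionRatio σ' σ (𝒢.src g) / sectionRatio τ' τ (𝒢.tgt g)) := by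
  have value_σ_ne_zero := value_ne_zero.2 hσ
  have value_τ_ne_zero := value_ne_zero.2 hτ
  simp only [actionCoefficient, sectionRatio]
  field_simp

theorem actionCoefficient_unit (σ τ : ∀ x : M, 𝒢.transverseFibre χ x) (x : M) :
    actionCoefficient σ τ (𝒢.unit x) = sectionRatio σ τ x := by
  rw [actionCoefficient, sectionRatio, ratio_unit, 𝒢.src_unit, 𝒢.tgt_unit, map_one, one_mul]

theorem contDiffOn_volumeCharacter : ContDiffOn ℝ ∞ volumeCharacter {0}ᶜ :=
  contDiffOn_id

theorem contDiffOn_densityCharacter : ContDiffOn ℝ ∞ densityCharacter {0}ᶜ :=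
  fun _ ht => (contDiffAt_abs ht).contDiffWithinAt

variable [IsManifold (𝓡 n) ∞ M] [IsManifold (𝓡 (r + n)) ∞ G]

theorem contMDiffAt_actionCoefficient (hχ : ContDiffOn ℝ ∞ χ {0}ᶜ)
    {σ τ : ∀ x : M, 𝒢.transverseFibre χ x} {U V : Opens M}
    (hσ : 𝒢.IsSmoothOn χ σ U) (hτ : 𝒢.IsSmoothOn χ τ V) {g₀ : G} (hU : 𝒢.src g₀ ∈ U)
    (hV : 𝒢.tgt g₀ ∈ V) (hτ₀ : τ (𝒢.tgt g₀) ≠ 0) :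
    ContMDiffAt (𝓡 (r + n)) 𝓘(ℝ, ℝ) ∞ (actionCoefficient σ τ) g₀ := by
  obtain ⟨b, X, hbX⟩ := exists_smoothFrames 𝒢 (𝒢.src g₀)
  obtain ⟨a, Y, haY⟩ := exists_smoothFrames 𝒢 (𝒢.tgt g₀)
  have contMDiffAt_character := (hχ.contDiffAt (isOpen_compl_singleton.mem_nhds
    (frameRatio_ne_zero (𝒢 := 𝒢) g₀ _ _ _ _))).contMDiffAt.comp g₀
      (contMDiffAt_frameRatio hbX.self_of_nhds.1 hbX.self_of_nhds.2
        haY.self_of_nhds.1 haY.self_of_nhds.2)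
  have contMDiffAt_σ := (hσ.contMDiffAt_apply hU hbX).comp g₀ 𝒢.contMDiff_src.contMDiffAt
  have contMDiffAt_τ := (hτ.contMDiffAt_apply hV haY).comp g₀ 𝒢.contMDiff_tgt.contMDiffAt
  refine ((contMDiffAt_character.mul contMDiffAt_σ).div₀ contMDiffAt_τ
    (transverseFibre_apply_ne_zero hτ₀ _ _)).congr_of_eventuallyEq
    (Filter.Eventually.of_forall fun g => ?_)
  obtain ⟨k, hk, apply_eq⟩ :=
    exists_apply_eq_mul_value (𝒢 := 𝒢) (χ := χ) (a (𝒢.tgt g)) (Y (𝒢.tgt g))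
  simp only [actionCoefficient, Pi.div_apply, Pi.mul_apply, Function.comp_apply]
  rw [← transverseAction_apply, apply_eq, apply_eq, mul_div_mul_left _ _ hk,
    value_transverseAction]

theorem contMDiffAt_sectionRatio (hχ : ContDiffOn ℝ ∞ χ {0}ᶜ)
    {σ τ : ∀ x : M, 𝒢.transverseFibre χ x} {U V : Opens M}
    (hσ : 𝒢.IsSmoothOn χ σ U) (hτ : 𝒢.IsSmoothOn χ τ V) {x₀ : M} (hU : x₀ ∈ U) (hV : x₀ ∈ V)
    (hτ₀ : τ x₀ ≠ 0) :
    ContMDiffAt (𝓡 n) 𝓘(ℝ, ℝ) ∞ (sectionRatio σ τ) x₀ :=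
  ((contMDiffAt_actionCoefficient (g₀ := 𝒢.unit x₀) hχ hσ hτ (by rwa [𝒢.src_unit])
    (by rwa [𝒢.tgt_unit]) (by rwa [𝒢.tgt_unit])).comp x₀
      𝒢.contMDiff_unit.contMDiffAt).congr_of_eventuallyEq
    (Filter.Eventually.of_forall fun x => (actionCoefficient_unit σ τ x).symm)

theorem exists_isSmoothOn_apply_eq_one (𝒢 : LieGroupoid n r M G) (hχ : ContDiffOn ℝ ∞ χ {0}ᶜ)
    (x₀ : M) :
    ∃ (U : Opens M) (σ : ∀ x : M, 𝒢.transverseFibre χ x), x₀ ∈ U ∧ 𝒢.IsSmoothOn χ σ U ∧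
      ∀ x, ∃ a X, (σ x).1 a X = 1 := by
  obtain ⟨a, X, haX⟩ := exists_smoothFrames 𝒢 x₀
  obtain ⟨W, hW, W_open, hx₀W⟩ := eventually_nhds_iff.1 haX
  refine ⟨⟨W, W_open⟩, fun x => 𝒢.ofFrame χ (a x) (X x) 1, hx₀W, isSmoothOn_of_exists hχ fun x hx =>
    ⟨a, X, (hW x hx).1, (hW x hx).2, ?_⟩, fun x => ⟨a x, X x, ofFrame_apply_self _ _ _⟩⟩
  simp only [ofFrame_apply_self]
  exact contMDiffAt_const

theorem isSmoothOn_of_value_eq_finsum (hχ : ContDiffOn ℝ ∞ χ {0}ᶜ) {ι : Type*} {s : Set M}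
    {ρ : SmoothPartitionOfUnity ι (𝓡 n) M s} {U : ι → Opens M}
    (hρ : ρ.IsSubordinate fun i => U i) {δ : ι → ∀ x : M, 𝒢.transverseFibre χ x}
    (hδ : ∀ i, 𝒢.IsSmoothOn χ (δ i) (U i)) {σ : ∀ x : M, 𝒢.transverseFibre χ x}
    (hσ : ∀ x, 𝒢.value χ (σ x) = ∑ᶠ i, ρ i x * 𝒢.value χ (δ i x)) :
    𝒢.IsSmoothOn χ σ ⊤ := by
  refine isSmoothOn_of_exists hχ fun x₀ _ => ?_
  obtain ⟨b, Y, hbY⟩ := exists_smoothFrames 𝒢 x₀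
  refine ⟨b, Y, hbY.self_of_nhds.1, hbY.self_of_nhds.2, ?_⟩
  have contMDiffAt_finsum := ρ.contMDiffAt_finsum (n := ⊤) (x₀ := x₀)
    (g := fun i x => (δ i x).1 (b x) (Y x)) fun i hi => (hδ i).contMDiffAt_apply (hρ i hi) hbY
  refine contMDiffAt_finsum.congr_of_eventuallyEq (Filter.Eventually.of_forall fun x => ?_)
  obtain ⟨k, -, apply_eq⟩ := exists_apply_eq_mul_value (𝒢 := 𝒢) (χ := χ) (b x) (Y x)
  simp only [apply_eq, hσ, smul_eq_mul, mul_left_comm _ k]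
  exact smul_finsum k _

end ActionCoefficient

/-! ### The modular class -/

section ModularClass

variable {𝒢 : LieGroupoid n r M G}

theorem density_apply_pos {x : M} {ξ : 𝒢.transverseFibre densityCharacter x}
    {a : Module.Basis (Fin r) ℝ (𝒢.algebroidFibre x)}
    {X : Module.Basis (Fin n) ℝ (TangentSpace (𝓡 n) x)} (h : 0 < ξ.1 a X)
    (a' : Module.Basis (Fin r) ℝ (𝒢.algebroidFibre x))
    (X' : Module.Basis (Fin n) ℝ (TangentSpace (𝓡 n) x)) : 0 < ξ.1 a' X' := by
  rw [transverseFibre_apply ξ a a' X X']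
  exact mul_pos (mul_pos (abs_pos.2 (a'.isUnit_det _).ne_zero)
    (abs_pos.2 (X.isUnit_det _).ne_zero)) h

variable [IsManifold (𝓡 n) ∞ M] [IsManifold (𝓡 (r + n)) ∞ G]

/-- Smooth strictly positive sections of the transverse density bundle. -/
structure IsPositiveDensity (σ : ∀ x : M, 𝒢.transverseFibre densityCharacter x) : Prop where
  isSmoothOn : 𝒢.IsSmoothOn densityCharacter σ ⊤
  apply_pos : ∀ x a X, 0 < (σ x).1 a X

theorem exists_isPositiveDensity [T2Space M] [SecondCountableTopology M]
    (𝒢 : LieGroupoid n r M G) :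
    ∃ σ : ∀ x : M, 𝒢.transverseFibre densityCharacter x, IsPositiveDensity σ := by
  have : LocallyCompactSpace M := ChartedSpace.locallyCompactSpace (EuclideanSpace ℝ (Fin n)) M
  choose U δ hU hδ a X hδ_one using exists_isSmoothOn_apply_eq_one 𝒢 contDiffOn_densityCharacter
  have δ_pos (z x : M) : 0 < 𝒢.value densityCharacter (δ z x) :=
    density_apply_pos ((hδ_one z x).symm ▸ one_pos) _ _
  obtain ⟨ρ, hρ⟩ := SmoothPartitionOfUnity.exists_isSubordinate (𝓡 n)
    (isClosed_univ (X := M)) (fun x => (U x : Set M)) (fun x => (U x).isOpen)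
    (fun x _ => Set.mem_iUnion.2 ⟨x, hU x⟩)
  have finsum_pos (x : M) : 0 < ∑ᶠ z, ρ z x • 𝒢.value densityCharacter (δ z x) :=
    ρ.finsum_smul_mem_convex (t := Set.Ioi (0 : ℝ))
      (g := fun z x => 𝒢.value densityCharacter (δ z x)) (Set.mem_univ x)
      (fun z _ => δ_pos z x) (convex_Ioi 0)
  exact ⟨fun x => 𝒢.ofFrame densityCharacter (𝒢.someFrame x) (someTangentFrame x)
      (∑ᶠ z, ρ z x • 𝒢.value densityCharacter (δ z x)),
    isSmoothOn_of_value_eq_finsum contDiffOn_densityCharacter hρ hδ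
      fun x => ofFrame_apply_self _ _ _,
    fun x => density_apply_pos ((finsum_pos x).trans_eq (ofFrame_apply_self _ _ _).symm)⟩

namespace IsPositiveDensity

variable {σ σ' : ∀ x : M, 𝒢.transverseFibre densityCharacter x}

theorem ne_zero (hσ : IsPositiveDensity σ) (x : M) : σ x ≠ 0 :=
  value_ne_zero.1 (hσ.apply_pos x _ _).ne'

theorem actionCoefficient_pos (hσ : IsPositiveDensity σ) (g : G) :
    0 < actionCoefficient σ σ g :=
  div_pos (mul_pos (abs_pos.2 (ratio_ne_zero g)) (hσ.apply_pos _ _ _)) (hσ.apply_pos _ _ _)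

/-- The cocycle `c_σ` that represents the modular class. -/
noncomputable def modularCocycle (hσ : IsPositiveDensity σ) : 𝒢.realCocycles :=
  ⟨fun g => -Real.log (actionCoefficient σ σ g),
    fun g => (contMDiffAt_log_comp (contMDiffAt_actionCoefficient contDiffOn_densityCharacter
      hσ.isSmoothOn hσ.isSmoothOn trivial trivial (hσ.ne_zero _))
      (hσ.actionCoefficient_pos g).ne').neg,
    fun g h hgh => by
      beta_reduce
      rw [actionCoefficient_mul hgh (hσ.ne_zero _),
        Real.log_mul (hσ.actionCoefficient_pos g).ne' (hσ.actionCoefficient_pos h).ne', neg_add]⟩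

theorem eq_exp_smul_transverseAction_iff (hσ : IsPositiveDensity σ) {c : 𝒢.realCocycles} :
    (∀ g, σ (𝒢.tgt g) =
      Real.exp (c.1 g) • 𝒢.transverseAction densityCharacter g (σ (𝒢.src g))) ↔
      c = hσ.modularCocycle := by
  rw [Subtype.ext_iff, funext_iff]
  refine forall_congr' fun g => ?_
  rw [eq_comm, ← eq_inv_smul_iff₀ (Real.exp_ne_zero _), ← Real.exp_neg,
    transverseAction_eq_smul_iff (hσ.ne_zero _)]
  change actionCoefficient σ σ g = _ ↔ c.1 g = -Real.log (actionCoefficient σ σ g)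
  constructor <;> intro h
  · rw [h, Real.log_exp, neg_neg]
  · rw [h, neg_neg, Real.exp_log (hσ.actionCoefficient_pos g)]

theorem modularCocycle_sub_mem_realCoboundaries (hσ : IsPositiveDensity σ)
    (hσ' : IsPositiveDensity σ') :
    hσ'.modularCocycle - hσ.modularCocycle ∈ 𝒢.realCoboundaries := by
  have sectionRatio_ne_zero (x : M) := sectionRatio_ne_zero (hσ'.ne_zero x) (hσ.ne_zero x)
  refine ⟨fun x => -Real.log (sectionRatio σ' σ x), fun x =>
    (contMDiffAt_log_comp (contMDiffAt_sectionRatio contDiffOn_densityCharacter hσ'.isSmoothOn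
      hσ.isSmoothOn trivial trivial (hσ.ne_zero x)) (sectionRatio_ne_zero x)).neg, fun g => ?_⟩
  change -Real.log (actionCoefficient σ' σ' g) - -Real.log (actionCoefficient σ σ g) = _
  rw [actionCoefficient_change (hσ.ne_zero _) (hσ.ne_zero _),
    Real.log_mul (hσ.actionCoefficient_pos g).ne'
      (div_ne_zero (sectionRatio_ne_zero _) (sectionRatio_ne_zero _)),
    Real.log_div (sectionRatio_ne_zero _) (sectionRatio_ne_zero _)]
  ring

end IsPositiveDensity

theorem existsUnique_isModularClass [T2Space M] [SecondCountableTopology M]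
    (𝒢 : LieGroupoid n r M G) : ∃! κ, 𝒢.IsModularClass κ := by
  obtain ⟨σ, hσ⟩ := exists_isPositiveDensity 𝒢
  refine ⟨Submodule.Quotient.mk hσ.modularCocycle, ⟨σ, hσ.isSmoothOn, hσ.apply_pos, _,
    hσ.eq_exp_smul_transverseAction_iff.2 rfl, rfl⟩, ?_⟩
  rintro _ ⟨σ', isSmoothOn_σ', σ'_pos, c, hc, rfl⟩
  have hσ' : IsPositiveDensity σ' := ⟨isSmoothOn_σ', σ'_pos⟩
  rw [hσ'.eq_exp_smul_transverseAction_iff.1 hc]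
  exact (Submodule.Quotient.eq _).2 (hσ.modularCocycle_sub_mem_realCoboundaries hσ')

end ModularClass

/-! ### Trivializing families -/

section StiefelWhitney

variable [IsManifold (𝓡 n) ∞ M] [IsManifold (𝓡 (r + n)) ∞ G] {𝒢 : LieGroupoid n r M G}

theorem IsSmoothOn.mono {χ : ℝ →*₀ ℝ} {σ : ∀ x : M, 𝒢.transverseFibre χ x} {U V : Opens M}
    (hσ : 𝒢.IsSmoothOn χ σ U) (hVU : V ≤ U) : 𝒢.IsSmoothOn χ σ V :=
  fun W hW => hσ W (hW.trans hVU)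

/-- Smooth nowhere vanishing sections of the transverse volume bundle over the members of a cover.
Each `σ U` is a section over all of `M`, with arbitrary values outside `U`. -/
def IsTrivializingFamily {𝒰 : OpenCover M}
    (σ : 𝒰.sets → ∀ x : M, 𝒢.transverseFibre volumeCharacter x) : Prop :=
  ∀ U : 𝒰.sets, 𝒢.IsSmoothOn volumeCharacter (σ U) U.1 ∧ ∀ x ∈ U.1, σ U x ≠ 0

theorem exists_isTrivializingFamily (𝒢 : LieGroupoid n r M G) :
    ∃ (𝒰 : OpenCover M) (σ : 𝒰.sets → ∀ x : M, 𝒢.transverseFibre volumeCharacter x),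
      IsTrivializingFamily σ := by
  let 𝒰 : OpenCover M :=
    { sets := {U | ∃ σ : ∀ x : M, 𝒢.transverseFibre volumeCharacter x,
        𝒢.IsSmoothOn volumeCharacter σ U ∧ ∀ x ∈ U, σ x ≠ 0}
      covers := fun x => by
        obtain ⟨U, σ, hx, hσ, apply_eq_one⟩ :=
          exists_isSmoothOn_apply_eq_one 𝒢 contDiffOn_volumeCharacter x
        refine ⟨U, ⟨σ, hσ, fun y _ => ?_⟩, hx⟩
        obtain ⟨a, X, h⟩ := apply_eq_one y
        exact ne_zero_of_apply_ne_zero (h.symm ▸ one_ne_zero) }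
  choose σ hσ using fun U : 𝒰.sets => U.2
  exact ⟨𝒰, σ, hσ⟩

namespace IsTrivializingFamily

variable {𝒰 𝒱 : OpenCover M} {σ σ' : 𝒰.sets → ∀ x : M, 𝒢.transverseFibre volumeCharacter x}

theorem src_ne_zero (hσ : IsTrivializingFamily σ) (p : 𝒢.PullbackArrow 𝒰.proj) :
    σ p.1.2.2.1 (𝒢.src p.1.2.1) ≠ 0 :=
  (hσ _).2 _ (p.2.2 ▸ p.1.2.2.2.2)

theorem tgt_ne_zero (hσ : IsTrivializingFamily σ) (p : 𝒢.PullbackArrow 𝒰.proj) :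
    σ p.1.1.1 (𝒢.tgt p.1.2.1) ≠ 0 :=
  (hσ _).2 _ (p.2.1 ▸ p.1.1.2.2)

theorem comp_refineIndex (hσ : IsTrivializingFamily σ) (h : 𝒰 ≤ 𝒱) :
    IsTrivializingFamily fun V : 𝒱.sets => σ (OpenCover.refineIndex h V) := fun V =>
  ⟨(hσ _).1.mono (OpenCover.le_refineIndex h V),
    fun x hx => (hσ _).2 x (OpenCover.le_refineIndex h V hx)⟩

/-! ### The transverse first Stiefel–Whitney class -/

theorem isLocallyConstant_signUnit_actionCoefficient (hσ : IsTrivializingFamily σ) :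
    IsLocallyConstant fun p : 𝒢.PullbackArrow 𝒰.proj =>
      signUnit (actionCoefficient (σ p.1.2.2.1) (σ p.1.1.1) p.1.2.1) := by
  refine (IsLocallyConstant.iff_eventually_eq _).2 fun p₀ => ?_
  have continuous_arrow : Continuous fun p : 𝒢.PullbackArrow 𝒰.proj => p.1.2.1 := by fun_prop
  have continuous_srcPt : Continuous fun p : 𝒢.PullbackArrow 𝒰.proj => p.1.2.2 := by fun_prop
  have continuous_tgtPt : Continuous fun p : 𝒢.PullbackArrow 𝒰.proj => p.1.1 := by fun_prop
  have continuousAt_coefficient :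
      ContinuousAt (actionCoefficient (σ p₀.1.2.2.1) (σ p₀.1.1.1)) p₀.1.2.1 :=
    (contMDiffAt_actionCoefficient contDiffOn_volumeCharacter (hσ _).1 (hσ _).1
      (p₀.2.2 ▸ p₀.1.2.2.2.2) (p₀.2.1 ▸ p₀.1.1.2.2) (hσ.tgt_ne_zero p₀)).continuousAt
  filter_upwards [continuous_arrow.continuousAt.eventually (eventually_signUnit_eq
      continuousAt_coefficient (actionCoefficient_ne_zero (hσ.src_ne_zero p₀) (hσ.tgt_ne_zero p₀))),
    continuous_srcPt.continuousAt.eventually (OpenCover.eventually_fst_eq p₀.1.2.2),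
    continuous_tgtPt.continuousAt.eventually (OpenCover.eventually_fst_eq p₀.1.1)]
    with p sign_eq src_eq tgt_eq
  rwa [src_eq, tgt_eq]

/-- The cocycle `sign c̃` of a trivializing family. -/
noncomputable def signCocycle (hσ : IsTrivializingFamily σ) :
    (𝒢.pullback 𝒰.proj).discreteCocycles ℤˣ :=
  ⟨fun p => signUnit (actionCoefficient (σ p.1.2.2.1) (σ p.1.1.1) p.1.2.1),
    hσ.isLocallyConstant_signUnit_actionCoefficient, fun p q (hpq : p.1.2.2 = q.1.1) => by
      have src_eq_tgt : 𝒢.src p.1.2.1 = 𝒢.tgt q.1.2.1 := by rw [p.2.2, q.2.1, hpq]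
      simp only [𝒢.pullback_mul_val 𝒰.proj p q hpq]
      rw [actionCoefficient_mul src_eq_tgt (hσ.src_ne_zero p), signUnit_mul
        (actionCoefficient_ne_zero (hσ.src_ne_zero p) (hσ.tgt_ne_zero p))
        (actionCoefficient_ne_zero (hσ.src_ne_zero q) (by simpa only [hpq] using hσ.tgt_ne_zero q)),
        hpq]⟩

theorem eq_smul_iff_eq_signCocycle (hσ : IsTrivializingFamily σ)
    {c : (𝒢.pullback 𝒰.proj).discreteCocycles ℤˣ} :
    (∀ p : 𝒢.PullbackArrow 𝒰.proj, ∃ l : ℝ, 0 < l ∧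
      𝒢.transverseAction volumeCharacter p.1.2.1 (σ p.1.2.2.1 (𝒢.src p.1.2.1)) =
        (l * ((c.1 p : ℤ) : ℝ)) • σ p.1.1.1 (𝒢.tgt p.1.2.1)) ↔ c = hσ.signCocycle := by
  rw [Subtype.ext_iff, funext_iff]
  refine forall_congr' fun p => ?_
  simp only [transverseAction_eq_smul_iff (hσ.tgt_ne_zero p)]
  exact exists_pos_eq_mul_iff (actionCoefficient_ne_zero (hσ.src_ne_zero p) (hσ.tgt_ne_zero p))

theorem signCocycle_inv_mul_mem_discreteCoboundaries (hσ : IsTrivializingFamily σ)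
    (hσ' : IsTrivializingFamily σ') :
    hσ.signCocycle⁻¹ * hσ'.signCocycle ∈ (𝒢.pullback 𝒰.proj).discreteCoboundaries ℤˣ := by
  have ratio_ne_zero (q : 𝒰.Total) : sectionRatio (σ' q.1) (σ q.1) (𝒰.proj q) ≠ 0 :=
    sectionRatio_ne_zero ((hσ' _).2 _ q.2.2) ((hσ _).2 _ q.2.2)
  refine ⟨fun q => signUnit (sectionRatio (σ' q.1) (σ q.1) (𝒰.proj q)),
    OpenCover.isLocallyConstant_iff.2 fun U x hx => eventually_signUnit_eq
      (contMDiffAt_sectionRatio contDiffOn_volumeCharacter (hσ' U).1 (hσ U).1 hx hx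
        ((hσ U).2 x hx)).continuousAt (sectionRatio_ne_zero ((hσ' U).2 x hx) ((hσ U).2 x hx)),
    fun p => ?_⟩
  change (signUnit (actionCoefficient (σ p.1.2.2.1) (σ p.1.1.1) p.1.2.1))⁻¹ *
    signUnit (actionCoefficient (σ' p.1.2.2.1) (σ' p.1.1.1) p.1.2.1) =
      signUnit (sectionRatio (σ' p.1.2.2.1) (σ p.1.2.2.1) (𝒰.proj p.1.2.2)) /
        signUnit (sectionRatio (σ' p.1.1.1) (σ p.1.1.1) (𝒰.proj p.1.1))
  rw [← signUnit_div (ratio_ne_zero p.1.2.2) (ratio_ne_zero p.1.1), ← p.2.1, ← p.2.2,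
    inv_mul_eq_iff_eq_mul, actionCoefficient_change (hσ.src_ne_zero p) (hσ.tgt_ne_zero p),
    signUnit_mul (actionCoefficient_ne_zero (hσ.src_ne_zero p) (hσ.tgt_ne_zero p)) (div_ne_zero
      (sectionRatio_ne_zero (hσ'.src_ne_zero p) (hσ.src_ne_zero p))
      (sectionRatio_ne_zero (hσ'.tgt_ne_zero p) (hσ.tgt_ne_zero p)))]

theorem mk_signCocycle_eq (hσ : IsTrivializingFamily σ) (h : 𝒰 ≤ 𝒱) :
    (Quotient.mk _ ⟨𝒰, QuotientGroup.mk hσ.signCocycle⟩ : 𝒢.CechH1 ℤˣ) =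
      Quotient.mk _ ⟨𝒱, QuotientGroup.mk (hσ.comp_refineIndex h).signCocycle⟩ :=
  DirectLimit.eq_of_le _ 𝒱 h

end IsTrivializingFamily

theorem existsUnique_isTransverseStiefelWhitneyClass (𝒢 : LieGroupoid n r M G) :
    ∃! w, 𝒢.IsTransverseStiefelWhitneyClass w := by
  obtain ⟨𝒰, σ, hσ⟩ := exists_isTrivializingFamily 𝒢
  refine ⟨_, ⟨𝒰, σ, hσ, hσ.signCocycle, hσ.eq_smul_iff_eq_signCocycle.2 rfl, rfl⟩, ?_⟩
  rintro _ ⟨𝒰', σ', hσ', c, hc, rfl⟩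
  obtain rfl := (IsTrivializingFamily.eq_smul_iff_eq_signCocycle hσ').1 hc
  obtain ⟨𝒱, h, h'⟩ := exists_ge_ge 𝒰 𝒰'
  rw [IsTrivializingFamily.mk_signCocycle_eq hσ' h', hσ.mk_signCocycle_eq h]
  refine congrArg (fun z => Quotient.mk _ (⟨𝒱, z⟩ : Σ 𝒱 : OpenCover M, _)) ?_
  exact QuotientGroup.eq.2
    (IsTrivializingFamily.signCocycle_inv_mul_mem_discreteCoboundaries _ _)

end StiefelWhitney

/-! ### Transverse orientations -/

section Orientations

variable {𝒢 : LieGroupoid n r M G}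

theorem actionCoefficient_smul {χ : ℝ →*₀ ℝ} (k l : M → ℝ)
    (σ τ : ∀ x : M, 𝒢.transverseFibre χ x) (g : G) :
    actionCoefficient (fun x => k x • σ x) (fun x => l x • τ x) g =
      k (𝒢.src g) / l (𝒢.tgt g) * actionCoefficient σ τ g := by
  simp only [actionCoefficient, value_smul]
  ring

theorem eq_sectionRatio_smul {χ : ℝ →*₀ ℝ} {σ τ : ∀ x : M, 𝒢.transverseFibre χ x} {x : M}
    (hτ : τ x ≠ 0) : σ x = sectionRatio σ τ x • τ x := by
  rw [← value_injective.eq_iff, value_smul, sectionRatio, div_mul_cancel₀ _ (value_ne_zero.2 hτ)]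

theorem rayOfNeZero_eq_iff {σ τ : ∀ x : M, 𝒢.transverseFibre volumeCharacter x} {x : M}
    (hσ : σ x ≠ 0) (hτ : τ x ≠ 0) :
    rayOfNeZero ℝ (σ x) hσ = rayOfNeZero ℝ (τ x) hτ ↔ 0 < sectionRatio σ τ x := by
  rw [ray_eq_iff, eq_sectionRatio_smul (σ := σ) hτ,
    sameRay_smul_left_iff_of_ne hτ (sectionRatio_ne_zero hσ hτ)]

theorem rayOfNeZero_transverseAction_eq_iff
    {σ τ : ∀ x : M, 𝒢.transverseFibre volumeCharacter x} {g : G}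
    (hσ : σ (𝒢.src g) ≠ 0) (hτ : τ (𝒢.tgt g) ≠ 0) :
    rayOfNeZero ℝ (𝒢.transverseAction volumeCharacter g (σ (𝒢.src g)))
        (transverseAction_ne_zero hσ) = rayOfNeZero ℝ (τ (𝒢.tgt g)) hτ ↔
      0 < actionCoefficient σ τ g := by
  rw [ray_eq_iff, (transverseAction_eq_smul_iff hτ).2 rfl,
    sameRay_smul_left_iff_of_ne hτ (actionCoefficient_ne_zero hσ hτ)]

variable [IsManifold (𝓡 n) ∞ M] [IsManifold (𝓡 (r + n)) ∞ G]

theorem IsSmoothOn.smul {χ : ℝ →*₀ ℝ} {σ : ∀ x : M, 𝒢.transverseFibre χ x} {U : Opens M}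
    (hσ : 𝒢.IsSmoothOn χ σ U) {f : M → ℝ} (hf : ContMDiffOn (𝓡 n) 𝓘(ℝ, ℝ) ∞ f U) :
    𝒢.IsSmoothOn χ (fun x => f x • σ x) U :=
  fun W hW a X ha hX => (hf.mono hW).mul (hσ W hW a X ha hX)

/-- Trivializing families `σ` for which all the coefficients `c̃` of the action are positive, so
that they define an invariant orientation. -/
structure IsOrientedFamily {𝒰 : OpenCover M}
    (σ : 𝒰.sets → ∀ x : M, 𝒢.transverseFibre volumeCharacter x) : Prop where
  isTrivializingFamily : IsTrivializingFamily σ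
  actionCoefficient_pos : ∀ (U V : 𝒰.sets) (g : G), 𝒢.src g ∈ U.1 → 𝒢.tgt g ∈ V.1 →
    0 < actionCoefficient (σ U) (σ V) g

variable {𝒰 : OpenCover M} {σ : 𝒰.sets → ∀ x : M, 𝒢.transverseFibre volumeCharacter x}

theorem IsOrientedFamily.sectionRatio_pos (hσ : IsOrientedFamily σ) {U V : 𝒰.sets} {x : M}
    (hU : x ∈ U.1) (hV : x ∈ V.1) : 0 < sectionRatio (σ U) (σ V) x := by
  rw [← actionCoefficient_unit]
  exact hσ.actionCoefficient_pos U V _ (by rwa [𝒢.src_unit]) (by rwa [𝒢.tgt_unit])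

theorem IsOrientedFamily.transverselyOrientable (hσ : IsOrientedFamily σ) :
    𝒢.TransverselyOrientable := by
  choose U hU hxU using 𝒰.covers
  have σ_ne_zero (x : M) : σ ⟨U x, hU x⟩ x ≠ 0 := (hσ.isTrivializingFamily _).2 x (hxU x)
  refine ⟨fun x => rayOfNeZero ℝ (σ ⟨U x, hU x⟩ x) (σ_ne_zero x), fun x => ?_, fun g v hv hvo => ?_⟩
  · exact ⟨U x, hxU x, σ ⟨U x, hU x⟩, (hσ.isTrivializingFamily _).1, fun y hy =>
      ⟨(hσ.isTrivializingFamily _).2 y hy,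
        (rayOfNeZero_eq_iff _ _).2 (hσ.sectionRatio_pos hy (hxU y))⟩⟩
  · refine ⟨transverseAction_ne_zero hv, Eq.trans ?_ ((rayOfNeZero_transverseAction_eq_iff
      (σ_ne_zero _) (σ_ne_zero _)).2 (hσ.actionCoefficient_pos _ _ g (hxU _) (hxU _)))⟩
    exact (ray_eq_iff _ _).2 (((ray_eq_iff _ _).1 hvo).map _)

theorem TransverselyOrientable.exists_isOrientedFamily (h : 𝒢.TransverselyOrientable) :
    ∃ (𝒰 : OpenCover M) (σ : 𝒰.sets → ∀ x : M, 𝒢.transverseFibre volumeCharacter x),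
      IsOrientedFamily σ := by
  obtain ⟨o, o_local, o_invariant⟩ := h
  let 𝒰 : OpenCover M :=
    { sets := {U | ∃ σ : ∀ y : M, 𝒢.transverseFibre volumeCharacter y,
        𝒢.IsSmoothOn volumeCharacter σ U ∧ ∀ y ∈ U, ∃ h : σ y ≠ 0, rayOfNeZero ℝ (σ y) h = o y}
      covers := fun x => by
        obtain ⟨U, hx, hU⟩ := o_local x
        exact ⟨U, hU, hx⟩ }
  choose σ isSmoothOn_σ σ_ne_zero ray_σ using fun U : 𝒰.sets => U.2
  refine ⟨𝒰, σ, fun U => ⟨isSmoothOn_σ U, σ_ne_zero U⟩, fun U V g hU hV => ?_⟩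
  rw [← rayOfNeZero_transverseAction_eq_iff (σ_ne_zero U _ hU) (σ_ne_zero V _ hV), ray_σ V _ hV]
  exact (o_invariant g _ _ (ray_σ U _ hU)).choose_spec

theorem IsTrivializingFamily.signCocycle_eq_one_iff (hσ : IsTrivializingFamily σ) :
    hσ.signCocycle = 1 ↔ IsOrientedFamily σ := by
  rw [Subtype.ext_iff, funext_iff]
  refine ⟨fun h => ⟨hσ, fun U V g hU hV => signUnit_eq_one_iff.1
    (h ⟨(⟨V, _, hV⟩, g, ⟨U, _, hU⟩), rfl, rfl⟩)⟩, fun h p => signUnit_eq_one_iff.2 ?_⟩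
  exact h.actionCoefficient_pos _ _ _ (p.2.2 ▸ p.1.2.2.2.2) (p.2.1 ▸ p.1.1.2.2)

theorem IsTrivializingFamily.exists_isOrientedFamily (hσ : IsTrivializingFamily σ)
    (h : hσ.signCocycle ∈ (𝒢.pullback 𝒰.proj).discreteCoboundaries ℤˣ) :
    ∃ τ : 𝒰.sets → ∀ x : M, 𝒢.transverseFibre volumeCharacter x, IsOrientedFamily τ := by
  classical
  obtain ⟨f, isLocallyConstant_f, signCocycle_eq⟩ := h
  let F (U : 𝒰.sets) (x : M) : ℤˣ := if hx : x ∈ U.1 then f ⟨U, x, hx⟩ else 1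
  have F_eq {U : 𝒰.sets} {x : M} (hx : x ∈ U.1) : F U x = f ⟨U, x, hx⟩ := dif_pos hx
  have F_comp_proj : (fun q : 𝒰.Total => F q.1 (𝒰.proj q)) = f := funext fun q => F_eq q.2.2
  have F_eventuallyEq := OpenCover.isLocallyConstant_iff.1 (F_comp_proj ▸ isLocallyConstant_f)
  refine ⟨fun U x => ((F U x : ℤ) : ℝ) • σ U x, fun U => ⟨(hσ U).1.smul fun x hx => ?_,
    fun x hx => smul_ne_zero (units_intCast_ne_zero _) ((hσ U).2 x hx)⟩, fun U V g hU hV => ?_⟩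
  · refine (contMDiffAt_const (c := ((F U x : ℤ) : ℝ))).congr_of_eventuallyEq ?_
      |>.contMDiffWithinAt
    filter_upwards [F_eventuallyEq U x hx] with y hy
    rw [hy]
  · have coefficient_ne_zero := actionCoefficient_ne_zero ((hσ U).2 _ hU) ((hσ V).2 _ hV)
    have sign_eq : signUnit (actionCoefficient (σ U) (σ V) g) =
        f ⟨U, _, hU⟩ / f ⟨V, _, hV⟩ :=
      signCocycle_eq ⟨(⟨V, _, hV⟩, g, ⟨U, _, hU⟩), rfl, rfl⟩
    rw [actionCoefficient_smul, ← signUnit_eq_one_iff, signUnit_mul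
      (div_ne_zero (units_intCast_ne_zero _) (units_intCast_ne_zero _)) coefficient_ne_zero,
      signUnit_div (units_intCast_ne_zero _) (units_intCast_ne_zero _), signUnit_intCast,
      signUnit_intCast, F_eq hU, F_eq hV, sign_eq, Int.units_mul_self]

theorem IsTrivializingFamily.transverselyOrientable_of_mk_signCocycle_eq_one
    (hσ : IsTrivializingFamily σ)
    (h : (Quotient.mk _ ⟨𝒰, QuotientGroup.mk hσ.signCocycle⟩ : 𝒢.CechH1 ℤˣ) = 1) :
    𝒢.TransverselyOrientable := by
  obtain ⟨𝒱, h𝒱, h𝒰, map_eq⟩ := Quotient.exact (h.trans (DirectLimit.one_def 𝒰))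
  obtain ⟨τ, hτ⟩ := (hσ.comp_refineIndex h𝒱).exists_isOrientedFamily
    ((QuotientGroup.eq_one_iff _).1 (map_eq.trans (map_one _)))
  exact hτ.transverselyOrientable

theorem isTransverseStiefelWhitneyClass_one_iff :
    𝒢.IsTransverseStiefelWhitneyClass 1 ↔ 𝒢.TransverselyOrientable := by
  constructor
  · rintro ⟨𝒰, σ, hσ, c, hc, one_eq⟩
    obtain rfl := (IsTrivializingFamily.eq_smul_iff_eq_signCocycle hσ).1 hc
    exact IsTrivializingFamily.transverselyOrientable_of_mk_signCocycle_eq_one hσ one_eq.symm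
  · intro h
    obtain ⟨𝒰, σ, hσ⟩ := h.exists_isOrientedFamily
    have hσ' := hσ.isTrivializingFamily
    exact ⟨𝒰, σ, hσ', 1, hσ'.eq_smul_iff_eq_signCocycle.2 (hσ'.signCocycle_eq_one_iff.2 hσ).symm,
      DirectLimit.one_def 𝒰⟩

end Orientations

/-! ### Transverse volume forms -/

section VolumeForms

variable {𝒢 : LieGroupoid n r M G}

/-- The density `|ξ|` of a volume element `ξ`. -/
noncomputable def absDensity {x : M} (ξ : 𝒢.transverseFibre volumeCharacter x) :
    𝒢.transverseFibre densityCharacter x :=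
  ⟨fun a X => |ξ.1 a X|, fun a a' X X' => by
    beta_reduce
    rw [transverseFibre_apply ξ a a' X X', abs_mul, abs_mul]
    rfl⟩

theorem absDensity_ne_zero {x : M} {ξ : 𝒢.transverseFibre volumeCharacter x} (hξ : ξ ≠ 0) :
    absDensity ξ ≠ 0 :=
  value_ne_zero.1 (abs_ne_zero.2 (value_ne_zero.2 hξ))

theorem actionCoefficient_absDensity (σ τ : ∀ x : M, 𝒢.transverseFibre volumeCharacter x) (g : G) :
    actionCoefficient (fun x => absDensity (σ x)) (fun x => absDensity (τ x)) g =
      |actionCoefficient σ τ g| := by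
  rw [actionCoefficient, actionCoefficient, abs_div, abs_mul]
  rfl

variable [IsManifold (𝓡 n) ∞ M] [IsManifold (𝓡 (r + n)) ∞ G]

theorem IsSmoothOn.absDensity {σ : ∀ x : M, 𝒢.transverseFibre volumeCharacter x} {U : Opens M}
    (hσ : 𝒢.IsSmoothOn volumeCharacter σ U) (σ_ne_zero : ∀ x ∈ U, σ x ≠ 0) :
    𝒢.IsSmoothOn densityCharacter (fun x => absDensity (σ x)) U :=
  fun W hW a X ha hX x hx => (contDiffAt_abs (transverseFibre_apply_ne_zero
    (σ_ne_zero x (hW hx)) (a x) (X x))).contMDiffAt.comp_contMDiffWithinAt x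
      (hσ W hW a X ha hX x hx)

theorem isSmoothOn_top_of_forall_exists_eqOn {χ : ℝ →*₀ ℝ} {σ : ∀ x : M, 𝒢.transverseFibre χ x}
    (h : ∀ x, ∃ (U : Opens M) (τ : ∀ x : M, 𝒢.transverseFibre χ x),
      x ∈ U ∧ 𝒢.IsSmoothOn χ τ U ∧ ∀ y ∈ U, σ y = τ y) :
    𝒢.IsSmoothOn χ σ ⊤ := by
  intro W _ a X ha hX x hx
  obtain ⟨U, τ, hxU, hτ, eq_τ⟩ := h x
  have contMDiffOn_τ := hτ (W ⊓ U) inf_le_right a X (fun i => (ha i).mono Set.inter_subset_left)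
    (fun j => (hX j).mono Set.inter_subset_left)
  refine ((contMDiffOn_τ x ⟨hx, hxU⟩).contMDiffAt
    ((W ⊓ U).isOpen.mem_nhds ⟨hx, hxU⟩)).congr_of_eventuallyEq ?_ |>.contMDiffWithinAt
  filter_upwards [U.isOpen.mem_nhds hxU] with y hy
  rw [eq_τ y hy]

theorem isModularClass_zero_iff :
    𝒢.IsModularClass 0 ↔ ∃ δ : ∀ x : M, 𝒢.transverseFibre densityCharacter x,
      IsPositiveDensity δ ∧ ∀ g, actionCoefficient δ δ g = 1 := by
  constructor
  · rintro ⟨δ, isSmoothOn_δ, δ_pos, c, hc, zero_eq⟩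
    have hδ : IsPositiveDensity δ := ⟨isSmoothOn_δ, δ_pos⟩
    obtain rfl := hδ.eq_exp_smul_transverseAction_iff.1 hc
    obtain ⟨f, contMDiff_f, neg_log_eq⟩ := (Submodule.Quotient.mk_eq_zero _).1 zero_eq.symm
    have coefficient_eq (g : G) :
        actionCoefficient δ δ g = Real.exp (f (𝒢.tgt g)) / Real.exp (f (𝒢.src g)) := by
      rw [← Real.exp_sub, ← neg_sub, ← neg_log_eq g]
      exact ((congrArg Real.exp (neg_neg _)).trans
        (Real.exp_log (hδ.actionCoefficient_pos g))).symm
    refine ⟨fun x => Real.exp (f x) • δ x, ⟨isSmoothOn_δ.smul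
      (Real.contDiff_exp.contMDiff.comp contMDiff_f).contMDiffOn,
      fun x a X => mul_pos (Real.exp_pos _) (δ_pos x a X)⟩, fun g => ?_⟩
    rw [actionCoefficient_smul, coefficient_eq, div_mul_div_cancel₀ (Real.exp_ne_zero _),
      div_self (Real.exp_ne_zero _)]
  · rintro ⟨δ, hδ, coefficient_eq_one⟩
    refine ⟨δ, hδ.isSmoothOn, hδ.apply_pos, _, hδ.eq_exp_smul_transverseAction_iff.2 rfl,
      congrArg _ (Subtype.ext (funext fun g => ?_))⟩
    change 0 = -Real.log (actionCoefficient δ δ g)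
    rw [coefficient_eq_one, Real.log_one, neg_zero]

variable {𝒰 : OpenCover M} {σ : 𝒰.sets → ∀ x : M, 𝒢.transverseFibre volumeCharacter x}

theorem IsTrivializingFamily.admitsTransverseVolumeForm (hσ : IsTrivializingFamily σ)
    (coefficient_eq_one : ∀ (U V : 𝒰.sets) (g : G), 𝒢.src g ∈ U.1 → 𝒢.tgt g ∈ V.1 →
      actionCoefficient (σ U) (σ V) g = 1) :
    𝒢.AdmitsTransverseVolumeForm := by
  choose U hU hxU using 𝒰.covers
  have σ_ne_zero (x : M) : σ ⟨U x, hU x⟩ x ≠ 0 := (hσ _).2 x (hxU x)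
  refine ⟨fun x => σ ⟨U x, hU x⟩ x, isSmoothOn_top_of_forall_exists_eqOn fun x =>
    ⟨U x, σ ⟨U x, hU x⟩, hxU x, (hσ _).1, fun y hy => ?_⟩, σ_ne_zero, fun g => ?_⟩
  · rw [eq_sectionRatio_smul (σ := σ ⟨U y, hU y⟩) ((hσ ⟨U x, hU x⟩).2 y hy),
      ← actionCoefficient_unit, coefficient_eq_one, one_smul]
    · rw [𝒢.src_unit]
      exact hxU y
    · rwa [𝒢.tgt_unit]
  · rw [(transverseAction_eq_smul_iff (σ_ne_zero _)).2
      (coefficient_eq_one _ _ g (hxU _) (hxU _)), one_smul]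

/-- An oriented family becomes invariant once it is rescaled so that `|σ U|` is the given
invariant density `δ`. -/
theorem IsOrientedFamily.admitsTransverseVolumeForm (hσ : IsOrientedFamily σ)
    {δ : ∀ x : M, 𝒢.transverseFibre densityCharacter x} (hδ : IsPositiveDensity δ)
    (coefficient_eq_one : ∀ g, actionCoefficient δ δ g = 1) :
    𝒢.AdmitsTransverseVolumeForm := by
  have isSmoothOn_σ (U : 𝒰.sets) := (hσ.isTrivializingFamily U).1
  have absDensity_ne_zero (U : 𝒰.sets) (x : M) (hx : x ∈ U.1) : absDensity (σ U x) ≠ 0 :=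
    absDensity_ne_zero ((hσ.isTrivializingFamily U).2 x hx)
  let scale (U : 𝒰.sets) : M → ℝ := sectionRatio δ fun x => absDensity (σ U x)
  have contMDiffOn_scale (U : 𝒰.sets) : ContMDiffOn (𝓡 n) 𝓘(ℝ, ℝ) ∞ (scale U) U.1 :=
    fun x hx => (contMDiffAt_sectionRatio contDiffOn_densityCharacter hδ.isSmoothOn
      ((isSmoothOn_σ U).absDensity (hσ.isTrivializingFamily U).2) trivial hx
      (absDensity_ne_zero U x hx)).contMDiffWithinAt
  have rescaled_isTrivializingFamily : IsTrivializingFamily fun U x => scale U x • σ U x :=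
    fun U => ⟨(isSmoothOn_σ U).smul (contMDiffOn_scale U), fun x hx => smul_ne_zero
      (sectionRatio_ne_zero (hδ.ne_zero x) (absDensity_ne_zero U x hx))
      ((hσ.isTrivializingFamily U).2 x hx)⟩
  refine rescaled_isTrivializingFamily.admitsTransverseVolumeForm fun U V g hU hV => ?_
  rw [actionCoefficient_smul, ← abs_of_pos (hσ.actionCoefficient_pos U V g hU hV),
    ← actionCoefficient_absDensity, mul_comm, ← coefficient_eq_one g]
  exact (actionCoefficient_change (absDensity_ne_zero U _ hU) (absDensity_ne_zero V _ hV)).symm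

theorem AdmitsTransverseVolumeForm.transverselyOrientable (h : 𝒢.AdmitsTransverseVolumeForm) :
    𝒢.TransverselyOrientable := by
  obtain ⟨σ, isSmoothOn_σ, σ_ne_zero, σ_invariant⟩ := h
  let 𝒰 : OpenCover M := ⟨{⊤}, fun _ => ⟨⊤, rfl, trivial⟩⟩
  refine IsOrientedFamily.transverselyOrientable (𝒰 := 𝒰) (σ := fun _ => σ)
    ⟨fun U => ⟨U.2.symm ▸ isSmoothOn_σ, fun x _ => σ_ne_zero x⟩, fun _ _ g _ _ => ?_⟩
  rw [(transverseAction_eq_smul_iff (σ_ne_zero _)).1 ((σ_invariant g).trans (one_smul _ _).symm)]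
  exact one_pos

theorem AdmitsTransverseVolumeForm.isModularClass_zero (h : 𝒢.AdmitsTransverseVolumeForm) :
    𝒢.IsModularClass 0 := by
  obtain ⟨σ, isSmoothOn_σ, σ_ne_zero, σ_invariant⟩ := h
  refine isModularClass_zero_iff.2 ⟨fun x => absDensity (σ x),
    ⟨isSmoothOn_σ.absDensity fun x _ => σ_ne_zero x,
      fun x a X => abs_pos.2 (transverseFibre_apply_ne_zero (σ_ne_zero x) a X)⟩, fun g => ?_⟩
  rw [actionCoefficient_absDensity, (transverseAction_eq_smul_iff (σ_ne_zero _)).1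
    ((σ_invariant g).trans (one_smul _ _).symm), abs_one]

theorem admitsTransverseVolumeForm_iff :
    𝒢.AdmitsTransverseVolumeForm ↔ 𝒢.IsModularClass 0 ∧ 𝒢.TransverselyOrientable := by
  refine ⟨fun h => ⟨h.isModularClass_zero, h.transverselyOrientable⟩, fun ⟨hκ, ho⟩ => ?_⟩
  obtain ⟨δ, hδ, coefficient_eq_one⟩ := isModularClass_zero_iff.1 hκ
  obtain ⟨𝒰, σ, hσ⟩ := ho.exists_isOrientedFamily
  exact hσ.admitsTransverseVolumeForm hδ coefficient_eq_one

end VolumeForms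

end LieGroupoid

theorem mainTheorem6 (n r : ℕ) (M G : Type*)
    [TopologicalSpace M] [ChartedSpace (EuclideanSpace ℝ (Fin n)) M]
    [IsManifold (𝓡 n) ∞ M] [T2Space M] [SecondCountableTopology M]
    [TopologicalSpace G] [ChartedSpace (EuclideanSpace ℝ (Fin (r + n))) G]
    [IsManifold (𝓡 (r + n)) ∞ G]
    (𝒢 : LieGroupoid n r M G) :
    (∃! κ, 𝒢.IsModularClass κ) ∧ (∃! w, 𝒢.IsTransverseStiefelWhitneyClass w) ∧
    (𝒢.TransverselyOrientable ↔ 𝒢.transverseStiefelWhitneyClass = 1) ∧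
    (𝒢.AdmitsTransverseVolumeForm ↔
      𝒢.modularClass = 0 ∧ 𝒢.transverseStiefelWhitneyClass = 1) := by
  have existsUnique_modularClass := 𝒢.existsUnique_isModularClass
  have existsUnique_stiefelWhitneyClass := 𝒢.existsUnique_isTransverseStiefelWhitneyClass
  have isModularClass : 𝒢.IsModularClass 𝒢.modularClass :=
    Classical.epsilon_spec existsUnique_modularClass.exists
  have isStiefelWhitneyClass :
      𝒢.IsTransverseStiefelWhitneyClass 𝒢.transverseStiefelWhitneyClass :=
    Classical.epsilon_spec existsUnique_stiefelWhitneyClass.exists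
  have modularClass_eq_zero_iff : 𝒢.modularClass = 0 ↔ 𝒢.IsModularClass 0 :=
    ⟨fun h => h ▸ isModularClass, existsUnique_modularClass.unique isModularClass⟩
  have stiefelWhitneyClass_eq_one_iff :
      𝒢.transverseStiefelWhitneyClass = 1 ↔ 𝒢.TransverselyOrientable :=
    Iff.trans ⟨fun h => h ▸ isStiefelWhitneyClass,
      existsUnique_stiefelWhitneyClass.unique isStiefelWhitneyClass⟩
      LieGroupoid.isTransverseStiefelWhitneyClass_one_iff
  refine ⟨existsUnique_modularClass, existsUnique_stiefelWhitneyClass,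
    stiefelWhitneyClass_eq_one_iff.symm, ?_⟩
  rw [modularClass_eq_zero_iff, stiefelWhitneyClass_eq_one_iff]
  exact LieGroupoid.admitsTransverseVolumeForm_iff
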